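/- For every $C_B\in(0,\infty)$ there is a constant $C\in(0,\infty)$, depending only on $C_B$, with the following property. Let $(M,g)$ be a complete smooth three-dimensional Riemannian manifold without boundary with $C_B$-bounded geometry, that is, for every $p\in M$ the injectivity radius satisfies $\operatorname{inj}(M,g,p)\ge C_B^{-1}$, and the Riemann tensor and its covariant derivative satisfy $|\mathrm{Riem}|+|\nabla \mathrm{Riem}|\le C_B$ everywhere on $M$. Let $\Sigma$ be a closed (compact, without boundary) connected smooth surface and let $f:\Sigma\to M$ be a smooth immersion. Let $\mu$ be the area measure on $\Sigma$ of the induced metric $f^*g$, let $|\Sigma|=\mu(\Sigma)$, let $H$ be the mean curvature of $f$ (the sum of the principal curvatures, defined up to sign, so that $H^2$ is the squared length of the mean curvature vector), and let $\mathcal W(\Sigma)=\frac12\int_\Sigma H^2\,d\mu$ be the Willmore energy. Let $\operatorname{diam}(\Sigma)=\max\{d_{(M,g)}(f(p),f(q)) : p,q\in\Sigma\}$ be the extrinsic diameter, where $d_{(M,g)}$ is the geodesic distance of the ambient manifold. Then $$\operatorname{diam}(\Sigma)\le C\big(|\Sigma|^{1/2}\,\mathcal W(\Sigma)^{1/2}+|\Sigma|\big).$$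 -/

import Mathlib

open Set MeasureTheory Bundle
open scoped Manifold ContDiff ENNReal

noncomputable section

namespace WillmoreDiam

/-- The model space `ℝⁿ`. -/
abbrev Eu (n : ℕ) : Type := EuclideanSpace ℝ (Fin n)

/-! ### Tensor calculus for a metric given by its matrix in coordinates on (an open part of) `ℝⁿ` -/

section Coordinates

variable {n : ℕ}

/-- The `i`-th partial derivative `∂ᵢ φ (y)`. -/
def pderiv {W : Type*} [NormedAddCommGroup W] [NormedSpace ℝ W]
    (i : Fin n) (φ : Eu n → W) (y : Eu n) : W :=
  fderiv ℝ φ y (EuclideanSpace.single i 1)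

/-- The Christoffel symbols
`Γᵏᵢⱼ = ½ gᵏˡ (∂ᵢ gⱼₗ + ∂ⱼ gᵢₗ - ∂ₗ gᵢⱼ)` of the Levi-Civita connection. -/
def christoffel (g : Eu n → Matrix (Fin n) (Fin n) ℝ) (y : Eu n) (k i j : Fin n) : ℝ :=
  (1 / 2) * ∑ l, (g y)⁻¹ k l *
    (pderiv i (fun z => g z j l) y + pderiv j (fun z => g z i l) y
      - pderiv l (fun z => g z i j) y)

/-- The components
`Rˡₖᵢⱼ = ∂ᵢ Γˡⱼₖ - ∂ⱼ Γˡᵢₖ + Γˡᵢₘ Γᵐⱼₖ - Γˡⱼₘ Γᵐᵢₖ` of the curvature,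
`R(∂ᵢ, ∂ⱼ) ∂ₖ = Rˡₖᵢⱼ ∂ₗ`. -/
def curvature (g : Eu n → Matrix (Fin n) (Fin n) ℝ) (y : Eu n) (l k i j : Fin n) : ℝ :=
  pderiv i (fun z => christoffel g z l j k) y - pderiv j (fun z => christoffel g z l i k) y
    + ∑ m, (christoffel g y l i m * christoffel g y m j k
      - christoffel g y l j m * christoffel g y m i k)

/-- A covariant tensor field of rank `r`, given by its components `T_{a₀ … aᵣ₋₁}`. -/
abbrev CovTensor (n r : ℕ) : Type := Eu n → (Fin r → Fin n) → ℝ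

/-- The Riemann tensor with all indices lowered, `R_{a₀a₁a₂a₃} = g_{a₀l} Rˡ_{a₁a₂a₃}`. -/
def riemannTensor (g : Eu n → Matrix (Fin n) (Fin n) ℝ) : CovTensor n 4 :=
  fun y a => ∑ l, g y (a 0) l * curvature g y l (a 1) (a 2) (a 3)

/-- The covariant derivative of a covariant tensor field,
`(∇T)_{m a₀ … aᵣ₋₁} = ∂ₘ T_{a₀ … aᵣ₋₁} - ∑ₛ Γᵉ_{m aₛ} T_{a₀ … e … aᵣ₋₁}` (`e` in slot `s`). -/
def covDeriv (g : Eu n → Matrix (Fin n) (Fin n) ℝ) {r : ℕ} (T : CovTensor n r) :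
    CovTensor n (r + 1) :=
  fun y b => pderiv (b 0) (fun z => T z (Fin.tail b)) y
    - ∑ s : Fin r, ∑ e : Fin n,
        christoffel g y e (b 0) (Fin.tail b s) * T y (Function.update (Fin.tail b) s e)

/-- The pointwise norm of a covariant tensor field with respect to `g`,
`|T|² = g^{a₀b₀} ⋯ g^{aᵣ₋₁bᵣ₋₁} T_{a₀ … aᵣ₋₁} T_{b₀ … bᵣ₋₁}`. -/
def tensorNorm (g : Eu n → Matrix (Fin n) (Fin n) ℝ) {r : ℕ} (T : CovTensor n r) (y : Eu n) : ℝ :=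
  √(∑ a : Fin r → Fin n, ∑ b : Fin r → Fin n, (∏ s, (g y)⁻¹ (a s) (b s)) * T y a * T y b)

end Coordinates

/-! ### Riemannian manifolds -/

section Manifolds

attribute [-instance] TopCat.of.chartedSpace

variable {n : ℕ} {M : Type*} [EMetricSpace M] [ChartedSpace (Eu n) M]
  [RiemannianBundle (fun x : M => TangentSpace (𝓡 n) x)]

/-- For `f : N → M`, the matrix `⟨∂ᵢ f, ∂ⱼ f⟩` of the pulled back Riemannian metric, as a function
of the coordinates `u` given by the chart of `N` around `x`. -/
def pullbackMetric {m : ℕ} {N : Type*} [TopologicalSpace N] [ChartedSpace (Eu m) N]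
    (f : N → M) (x : N) (u : Eu m) : Matrix (Fin m) (Fin m) ℝ :=
  Matrix.of fun i j =>
    inner ℝ
      (mfderiv 𝓘(ℝ, Eu m) (𝓡 n) (f ∘ (extChartAt (𝓡 m) x).symm) u (EuclideanSpace.single i 1))
      (mfderiv 𝓘(ℝ, Eu m) (𝓡 n) (f ∘ (extChartAt (𝓡 m) x).symm) u (EuclideanSpace.single j 1))

/-- The matrix `gᵢⱼ` of the Riemannian metric of `M` in the chart around `p`. -/
def metricCoord (p : M) : Eu n → Matrix (Fin n) (Fin n) ℝ :=
  pullbackMetric (n := n) (id : M → M) p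

/-- `γ : ℝ → M` is a geodesic: it is smooth and satisfies
`c̈ᵏ + Γᵏᵢⱼ(c) ċⁱ ċʲ = 0` in the charts of `M`. -/
def IsGeodesic (γ : ℝ → M) : Prop :=
  ContMDiff 𝓘(ℝ, ℝ) (𝓡 n) ∞ γ ∧
    ∀ (p : M) (t : ℝ), γ t ∈ (chartAt (Eu n) p).source →
      let c : ℝ → Eu n := fun s => extChartAt (𝓡 n) p (γ s)
      ∀ k, deriv (deriv c) t k
        + ∑ i, ∑ j, christoffel (metricCoord p) (c t) k i j * deriv c t i * deriv c t j = 0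

open Classical in
/-- The exponential map `exp_p` of a complete Riemannian manifold: `exp_p v = γ 1` for the geodesic
`γ` with `γ 0 = p` and `γ' 0 = v`. -/
def expMap (p : M) (v : Eu n) : M :=
  if h : ∃ γ : ℝ → M, IsGeodesic (n := n) γ ∧ γ 0 = p ∧
      (mfderiv 𝓘(ℝ, ℝ) (𝓡 n) γ 0 (1 : ℝ) : Eu n) = v
  then h.choose 1 else p

/-- The open ball of radius `r` around the origin of `T_p M`, for the norm given by the metric. -/
def tangentBall (p : M) (r : ℝ≥0∞) : Set (TangentSpace (𝓡 n) p) :=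
  {v : TangentSpace (𝓡 n) p | ‖v‖ₑ < r}

variable (n) in
/-- The injectivity radius at `p`: the supremum of all `r` such that `exp_p` is a diffeomorphism
from the ball of radius `r` in `T_p M` onto its image. -/
def injRadius (p : M) : ℝ≥0∞ :=
  sSup {r : ℝ≥0∞ |
    IsLocalDiffeomorphOn 𝓘(ℝ, Eu n) (𝓡 n) ∞ (expMap (n := n) p) (tangentBall (n := n) p r) ∧
      InjOn (expMap (n := n) p) (tangentBall (n := n) p r)}

variable (n M) in
/-- `M` is complete, its injectivity radius is at least `C⁻¹` at each point, and
`|Riem| + |∇Riem| ≤ C` everywhere (the norms do not depend on the chart in which they are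
computed). -/
structure HasBoundedGeometry (C : ℝ) : Prop where
  complete : CompleteSpace M
  inj : ∀ p : M, ENNReal.ofReal C⁻¹ ≤ injRadius n p
  curv : ∀ p : M, ∀ y ∈ (extChartAt (𝓡 n) p).target,
    tensorNorm (metricCoord p) (riemannTensor (metricCoord p)) y
      + tensorNorm (metricCoord p) (covDeriv (metricCoord p) (riemannTensor (metricCoord p))) y ≤ C

/-! ### Immersed submanifolds -/

variable {m : ℕ} {S : Type*} [TopologicalSpace S] [ChartedSpace (Eu m) S]

/-- A smooth immersion. -/
def IsSmoothImmersion (f : S → M) : Prop :=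
  ContMDiff (𝓡 m) (𝓡 n) ∞ f ∧ ∀ x, Function.Injective (mfderiv (𝓡 m) (𝓡 n) f x)

/-- The measure `√(det (⟨∂ᵢ f, ∂ⱼ f⟩)) du` on the domain of the chart of `S` around `x`,
extended by zero to `S`. -/
def chartAreaMeasure [MeasurableSpace S] (f : S → M) (x : S) : Measure S :=
  ((volume.withDensity fun u : Eu m =>
      ENNReal.ofReal √((pullbackMetric (n := n) f x u).det)).restrict
    (extChartAt (𝓡 m) x).target).map (extChartAt (𝓡 m) x).symm

/-- The measure on `S` induced by the immersion `f` into the Riemannian manifold `M`. The measures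
`chartAreaMeasure f x` agree where two charts overlap, and their supremum is the measure on `S`
that restricts to each of them. -/
def areaMeasure [MeasurableSpace S] (f : S → M) : Measure S :=
  ⨆ x : S, chartAreaMeasure (n := n) (m := m) f x

/-- The components, in the chart of `M` around `f x`, of the vector
`hⁱʲ (∂ᵢ ∂ⱼ F + Γ(F)(∂ᵢ F, ∂ⱼ F))`, where `F` is `f` in the charts around `x` and `f x` and `h` is
the induced metric. -/
def traceHessian (f : S → M) (x : S) (k : Fin n) : ℝ :=
  let F : Eu m → Eu n := writtenInExtChartAt (𝓡 m) (𝓡 n) x f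
  let u : Eu m := extChartAt (𝓡 m) x x
  ∑ i, ∑ j, (pullbackMetric (n := n) f x u)⁻¹ i j *
    (pderiv i (pderiv j F) u k
      + ∑ a, ∑ b, christoffel (metricCoord (f x)) (F u) k a b * pderiv i F u a * pderiv j F u b)

/-- The mean curvature vector of the immersion `f` at `x`, that is, the trace of its (vector valued)
second fundamental form: the normal part `V - hⁱʲ g(V, ∂ⱼ F) ∂ᵢ F` of the vector
`V = traceHessian f x`, by its components in the chart around `f x`. -/
def meanCurvatureVector (f : S → M) (x : S) (k : Fin n) : ℝ :=
  let F : Eu m → Eu n := writtenInExtChartAt (𝓡 m) (𝓡 n) x f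
  let u : Eu m := extChartAt (𝓡 m) x x
  let V : Fin n → ℝ := traceHessian (m := m) f x
  V k - ∑ i, ∑ j, (pullbackMetric (n := n) f x u)⁻¹ i j *
    (∑ a, ∑ b, metricCoord (f x) (F u) a b * V a * pderiv j F u b) * pderiv i F u k

/-- The square `H²` of the mean curvature: the squared length of the mean curvature vector. For a
hypersurface the mean curvature vector is `± H ν` with the unit normal `ν` and `H` the sum of the
principal curvatures. -/
def meanCurvatureSq (f : S → M) (x : S) : ℝ :=
  ∑ a, ∑ b, metricCoord (f x) (extChartAt (𝓡 n) (f x) (f x)) a b *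
    meanCurvatureVector (m := m) f x a * meanCurvatureVector (m := m) f x b

variable (n m) in
/-- The area `|Σ|` of the immersion. -/
def area [MeasurableSpace S] (f : S → M) : ℝ≥0∞ :=
  areaMeasure (n := n) (m := m) f univ

variable (n m) in
/-- The Willmore functional `½ ∫ H² dμ`. -/
def willmore [MeasurableSpace S] (f : S → M) : ℝ≥0∞ :=
  (1 / 2) * ∫⁻ x, ENNReal.ofReal (meanCurvatureSq (n := n) (m := m) f x)
    ∂(areaMeasure (n := n) (m := m) f)

end Manifolds

end WillmoreDiam

end

/-!
The proof is Simon's monotonicity argument in normal coordinates, followed by a covering argument.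

*Normal coordinates.* The lower bound on the injectivity radius makes `exp_p` a chart on a ball of
fixed radius, and a short calculation with Jacobi fields along rays bounds the Hessian of half the
squared distance, `u = |y|² / 2`, from below by `(1 - K |y|²) g`, where `K` bounds the curvature
(`IsNormalMetric.gauss`, `IsNormalMetric.hess_radial_ge`).

*The test function.* Let `Φ` be the primitive of the cut-off weight
`w(u) = (1 - (u + ε) / (R + ε))₊² / (u + ε)`, and let `v` be `Φ ∘ u` on the surface. With the normal
part `N` of the position vector and the mean curvature vector `H`, the Hessian bound gives
`Δ v ≥ 2 w (1 - 2 K u) + w' (2 u - |N|²) - w |N| |H|` (`radial_laplacian_ge`). As in the plane, where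
`Φ` is a cut-off of `log u`, the main terms `2 w + 2 u w'` cancel up to a multiple of `ε / (u + ε)²`,
which is an approximate Dirac mass, and completing the square absorbs the normal part into `|H|² / 4`
(`weight_inequality`). Since `∫ Δ v = 0` (`integral_lapl_eq_zero`) and small balls of the surface
have area at least `ε` (`exists_le_area_preball`), the result is that
`1 / 8 ≤ ∫ (12 / r² + H² / 4)` over the part of the surface in any ball of radius `r` around one of
its points, for all `r` below a radius that depends on `C_B` only (`le_lintegral_ball`).

*Covering.* As the surface is connected, the distance from a given point takes all values up to the
diameter `d`, so there are at least `d / (2 r)` disjoint such balls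
(`edist_le_of_le_lintegral_ball`). Hence `d ≤ 192 |Σ| / r + 8 r 𝒲(Σ)`, and the radius
`r = min (r₁, (|Σ| / 𝒲(Σ))^(1/2))` gives the theorem (`exists_radius`).

The divergence theorem is proved with a partition of unity: in a chart of the surface
`√d Δ v = ∂ᵢ (√d hⁱʲ ∂ⱼ v)` (`sum_pderiv_densGrad`), and the Laplacian does not depend on the chart
(`laplC_trans`). Since the metric quantities are defined by coordinate formulas, Christoffel symbols
enter the argument only through the Koszul identity `IsChristoffelAt`, which determines them and
yields their behaviour under changes of coordinates and immersions (`christoffel_transform`,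
`inner_covariant_sndFDeriv`).
-/

open Set MeasureTheory Bundle Filter Topology
open scoped Manifold ContDiff ENNReal

noncomputable section

namespace WillmoreDiam

/-! ### Levi-Civita calculus on normed spaces -/

section Calculus

-- These instances endow fibres of Riemannian bundles with norms and inner products; instance search
-- would try them on every type here, where only ordinary normed spaces occur.
attribute [-instance] instNormedAddCommGroupOfRiemannianBundleOfIsTopologicalAddGroupOfContinuousConstSMulReal
  instInnerProductSpaceReal

variable {E E' : Type*} [NormedAddCommGroup E] [NormedSpace ℝ E]
  [NormedAddCommGroup E'] [NormedSpace ℝ E']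

/-- `Γ` is the Christoffel map at `y` of the field of symmetric bilinear forms `G`: it is symmetric
and satisfies the Koszul formula. -/
structure IsChristoffelAt (G : E → E →L[ℝ] E →L[ℝ] ℝ) (Γ : E →L[ℝ] E →L[ℝ] E) (y : E) : Prop where
  symm : ∀ a b, Γ a b = Γ b a
  koszul : ∀ a b c, 2 * G y (Γ a b) c
    = fderiv ℝ G y a b c + fderiv ℝ G y b a c - fderiv ℝ G y c a b

/-- The curvature `R(a, b) c` of the connection with Christoffel maps `Γ`. -/
def curv (Γ : E → E →L[ℝ] E →L[ℝ] E) (y a b c : E) : E :=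
  fderiv ℝ Γ y a b c - fderiv ℝ Γ y b a c + Γ y a (Γ y b c) - Γ y b (Γ y a c)

/-- The covariant Hessian of `ψ` for the connection with Christoffel map `Γ` at `y`. -/
def hess (Γ : E →L[ℝ] E →L[ℝ] E) (ψ : E → ℝ) (y a b : E) : ℝ :=
  fderiv ℝ (fderiv ℝ ψ) y a b - fderiv ℝ ψ y (Γ a b)

lemma fderiv_clm_apply₂ {F : Type*} [NormedAddCommGroup F] [NormedSpace ℝ F]
    {h : E' → E →L[ℝ] E →L[ℝ] F} {u : E'} (hh : DifferentiableAt ℝ h u)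
    (c : E') (a b : E) : fderiv ℝ h u c a b = fderiv ℝ (fun z => h z a b) u c := by
  have h1 := (hh.hasFDerivAt.clm_apply (hasFDerivAt_const a u)).clm_apply (hasFDerivAt_const b u)
  rw [h1.fderiv]; simp

lemma fderiv_metric_symm {G : E' → E →L[ℝ] E →L[ℝ] ℝ} {y : E'} (hG : DifferentiableAt ℝ G y)
    (hs : ∀ z a b, G z a b = G z b a) (c : E') (a b : E) :
    fderiv ℝ G y c a b = fderiv ℝ G y c b a := by
  rw [fderiv_clm_apply₂ hG, fderiv_clm_apply₂ hG]
  simp only [hs _ a b]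

/-- The Levi-Civita connection is compatible with the metric. -/
lemma IsChristoffelAt.compat {G : E → E →L[ℝ] E →L[ℝ] ℝ} {Γ : E →L[ℝ] E →L[ℝ] E} {y : E}
    (hΓ : IsChristoffelAt G Γ y) (hG : DifferentiableAt ℝ G y)
    (hs : ∀ z a b, G z a b = G z b a) (c a b : E) :
    fderiv ℝ G y c a b = G y (Γ c a) b + G y a (Γ c b) := by
  have h1 := hΓ.koszul c a b
  have h2 := hΓ.koszul c b a
  rw [hs y _ a] at h2
  have h3 := fderiv_metric_symm hG hs c a b
  have h4 := fderiv_metric_symm hG hs a b c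
  have h5 := fderiv_metric_symm hG hs b a c
  linarith

lemma sndFDeriv_symm {F : E' → E} {u : E'} (hF : ContDiffAt ℝ 2 F u) (a b : E') :
    fderiv ℝ (fderiv ℝ F) u a b = fderiv ℝ (fderiv ℝ F) u b a :=
  (hF.isSymmSndFDerivAt (by simp)) a b

lemma differentiableAt_fderiv {F : E' → E} {u : E'} (hF : ContDiffAt ℝ 2 F u) :
    DifferentiableAt ℝ (fderiv ℝ F) u :=
  ((hF.fderiv_right (m := 1) (by norm_num)).differentiableAt (by norm_num))

/-- The derivative of a pulled back metric. -/
lemma fderiv_pullback {G : E → E →L[ℝ] E →L[ℝ] ℝ} {F : E' → E} {h : E' → E' →L[ℝ] E' →L[ℝ] ℝ}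
    {u : E'} (hF : ContDiffAt ℝ 2 F u) (hG : DifferentiableAt ℝ G (F u))
    (hh : DifferentiableAt ℝ h u)
    (hpb : ∀ᶠ z in 𝓝 u, ∀ a b, h z a b = G (F z) (fderiv ℝ F z a) (fderiv ℝ F z b)) (c a b : E') :
    fderiv ℝ h u c a b
      = fderiv ℝ G (F u) (fderiv ℝ F u c) (fderiv ℝ F u a) (fderiv ℝ F u b)
        + G (F u) (fderiv ℝ (fderiv ℝ F) u c a) (fderiv ℝ F u b)
        + G (F u) (fderiv ℝ F u a) (fderiv ℝ (fderiv ℝ F) u c b) := by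
  rw [fderiv_clm_apply₂ hh]
  have h1 : (fun z => h z a b) =ᶠ[𝓝 u] fun z => G (F z) (fderiv ℝ F z a) (fderiv ℝ F z b) :=
    hpb.mono fun z hz => hz a b
  rw [h1.fderiv_eq]
  have hF1 : HasFDerivAt F (fderiv ℝ F u) u := (hF.differentiableAt (by norm_num)).hasFDerivAt
  have hF2 := (differentiableAt_fderiv hF).hasFDerivAt
  have hGF : HasFDerivAt (fun z => G (F z)) ((fderiv ℝ G (F u)).comp (fderiv ℝ F u)) u :=
    HasFDerivAt.comp (g := G) (f := F) u hG.hasFDerivAt hF1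
  have ha := hF2.clm_apply (hasFDerivAt_const a u)
  have hb := hF2.clm_apply (hasFDerivAt_const b u)
  have h2 := (hGF.clm_apply ha).clm_apply hb
  rw [h2.fderiv]
  simp
  ring

/-- The Christoffel map of the induced metric is the tangential part of the covariant second
derivative of the immersion. -/
lemma inner_covariant_sndFDeriv {G : E → E →L[ℝ] E →L[ℝ] ℝ} {F : E' → E}
    {h : E' → E' →L[ℝ] E' →L[ℝ] ℝ} {u : E'} {Γ : E →L[ℝ] E →L[ℝ] E} {Γh : E' →L[ℝ] E' →L[ℝ] E'}
    (hs : ∀ z a b, G z a b = G z b a)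
    (hF : ContDiffAt ℝ 2 F u) (hG : DifferentiableAt ℝ G (F u)) (hh : DifferentiableAt ℝ h u)
    (hpb : ∀ᶠ z in 𝓝 u, ∀ a b, h z a b = G (F z) (fderiv ℝ F z a) (fderiv ℝ F z b))
    (hΓ : IsChristoffelAt G Γ (F u)) (hΓh : IsChristoffelAt h Γh u) (a b c : E') :
    G (F u) (fderiv ℝ (fderiv ℝ F) u a b + Γ (fderiv ℝ F u a) (fderiv ℝ F u b)) (fderiv ℝ F u c)
      = G (F u) (fderiv ℝ F u (Γh a b)) (fderiv ℝ F u c) := by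
  rw [← hpb.self_of_nhds]
  have h0 := hΓh.koszul a b c
  rw [fderiv_pullback hF hG hh hpb, fderiv_pullback hF hG hh hpb,
    fderiv_pullback hF hG hh hpb] at h0
  have h1 := hΓ.koszul (fderiv ℝ F u a) (fderiv ℝ F u b) (fderiv ℝ F u c)
  rw [sndFDeriv_symm hF b a, sndFDeriv_symm hF c a, sndFDeriv_symm hF c b,
    hs _ (fderiv ℝ F u b), hs _ (fderiv ℝ F u a) (fderiv ℝ (fderiv ℝ F) u b c)] at h0
  simp only [map_add, add_apply]
  linarith

/-- Transformation law of the Christoffel maps under local diffeomorphisms. -/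
lemma christoffel_transform {G : E → E →L[ℝ] E →L[ℝ] ℝ} {F : E' → E}
    {h : E' → E' →L[ℝ] E' →L[ℝ] ℝ} {u : E'} {Γ : E →L[ℝ] E →L[ℝ] E} {Γh : E' →L[ℝ] E' →L[ℝ] E'}
    (hs : ∀ z a b, G z a b = G z b a)
    (hF : ContDiffAt ℝ 2 F u) (hG : DifferentiableAt ℝ G (F u)) (hh : DifferentiableAt ℝ h u)
    (hpb : ∀ᶠ z in 𝓝 u, ∀ a b, h z a b = G (F z) (fderiv ℝ F z a) (fderiv ℝ F z b))
    (hΓ : IsChristoffelAt G Γ (F u)) (hΓh : IsChristoffelAt h Γh u)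
    (hnd : ∀ w, (∀ c, G (F u) w c = 0) → w = 0) (hsurj : Function.Surjective (fderiv ℝ F u))
    (a b : E') :
    fderiv ℝ (fderiv ℝ F) u a b + Γ (fderiv ℝ F u a) (fderiv ℝ F u b)
      = fderiv ℝ F u (Γh a b) := by
  rw [← sub_eq_zero]
  apply hnd
  intro c
  obtain ⟨c, rfl⟩ := hsurj c
  rw [map_sub, sub_apply,
    inner_covariant_sndFDeriv hs hF hG hh hpb hΓ hΓh, sub_self]

/-- Naturality of the curvature. -/
lemma curv_transform {T : E' → E} {u : E'} {Γ : E → E →L[ℝ] E →L[ℝ] E}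
    {Γh : E' → E' →L[ℝ] E' →L[ℝ] E'} (hT : ContDiffAt ℝ 3 T u)
    (hΓ : DifferentiableAt ℝ Γ (T u)) (hΓh : DifferentiableAt ℝ Γh u)
    (htr : ∀ᶠ z in 𝓝 u, ∀ a b, fderiv ℝ (fderiv ℝ T) z a b
      + Γ (T z) (fderiv ℝ T z a) (fderiv ℝ T z b) = fderiv ℝ T z (Γh z a b)) (a b c : E') :
    curv Γ (T u) (fderiv ℝ T u a) (fderiv ℝ T u b) (fderiv ℝ T u c)
      = fderiv ℝ T u (curv Γh u a b c) := by
  have hT2 : ContDiffAt ℝ 2 T u := hT.of_le (by norm_num)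
  have hT1 : HasFDerivAt T (fderiv ℝ T u) u := (hT.differentiableAt (by norm_num)).hasFDerivAt
  have hdT2 : ContDiffAt ℝ 2 (fderiv ℝ T) u := hT.fderiv_right (by norm_num)
  have hD1 := (differentiableAt_fderiv hT2).hasFDerivAt
  have hD2 := (differentiableAt_fderiv hdT2).hasFDerivAt
  have key : ∀ a b c : E', fderiv ℝ (fderiv ℝ (fderiv ℝ T)) u a b c
      + (fderiv ℝ Γ (T u) (fderiv ℝ T u a) (fderiv ℝ T u b) (fderiv ℝ T u c)
      + Γ (T u) (fderiv ℝ (fderiv ℝ T) u a b) (fderiv ℝ T u c)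
      + Γ (T u) (fderiv ℝ T u b) (fderiv ℝ (fderiv ℝ T) u a c))
      = fderiv ℝ (fderiv ℝ T) u a (Γh u b c) + fderiv ℝ T u (fderiv ℝ Γh u a b c) := by
    intro a b c
    have h1 : (fun z => fderiv ℝ (fderiv ℝ T) z b c
      + Γ (T z) (fderiv ℝ T z b) (fderiv ℝ T z c)) =ᶠ[𝓝 u] fun z => fderiv ℝ T z (Γh z b c) :=
      htr.mono fun z hz => hz b c
    have h2 := h1.fderiv_eq (𝕜 := ℝ)
    have hΓT : HasFDerivAt (fun z => Γ (T z)) ((fderiv ℝ Γ (T u)).comp (fderiv ℝ T u)) u :=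
      HasFDerivAt.comp (g := Γ) (f := T) u hΓ.hasFDerivAt hT1
    have hb := hD1.clm_apply (hasFDerivAt_const b u)
    have hc := hD1.clm_apply (hasFDerivAt_const c u)
    have hl1 := (hD2.clm_apply (hasFDerivAt_const b u)).clm_apply (hasFDerivAt_const c u)
    have hl := hl1.add ((hΓT.clm_apply hb).clm_apply hc)
    have hr1 := (hΓh.hasFDerivAt.clm_apply (hasFDerivAt_const b u)).clm_apply
      (hasFDerivAt_const c u)
    have hr := hD1.clm_apply hr1
    have h3 := hl.fderiv.symm.trans (h2.trans hr.fderiv)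
    have h4 := congrArg (fun L => L a) h3
    simp at h4
    rw [← add_comm (fderiv ℝ T u _), ← h4]
    abel
  have k1 := key a b c
  have k2 := key b a c
  rw [sndFDeriv_symm hT2 b a] at k2
  have k3 := sndFDeriv_symm hdT2 a b
  rw [← k3] at k2
  have t := htr.self_of_nhds
  have t1 := t a (Γh u b c)
  have t2 := t b (Γh u a c)
  have t3 := congrArg (Γ (T u) (fderiv ℝ T u a)) (t b c)
  have t4 := congrArg (Γ (T u) (fderiv ℝ T u b)) (t a c)
  simp only [map_add] at t3 t4
  simp only [curv, map_add, map_sub]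
  have e1 := congrArg₂ (fun x y => x - y) k1 k2
  rw [← t1, ← t2, ← t3, ← t4]
  rw [← sub_eq_zero] at e1 ⊢
  rw [← e1]
  abel

lemma fderiv_comp_apply {ψ : E → ℝ} {F : E' → E} {u : E'}
    (hF : DifferentiableAt ℝ F u) (hψ : DifferentiableAt ℝ ψ (F u)) (a : E') :
    fderiv ℝ (fun z => ψ (F z)) u a = fderiv ℝ ψ (F u) (fderiv ℝ F u a) := by
  have := fderiv_comp u hψ hF
  simp only [Function.comp_def] at this
  rw [this]; rfl

lemma sndFDeriv_comp {W : Type*} [NormedAddCommGroup W] [NormedSpace ℝ W]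
    {ψ : E → W} {F : E' → E} {u : E'}
    (hF : ContDiffAt ℝ 2 F u) (hψ : ContDiffAt ℝ 2 ψ (F u)) (a b : E') :
    fderiv ℝ (fderiv ℝ (fun z => ψ (F z))) u a b
      = fderiv ℝ (fderiv ℝ ψ) (F u) (fderiv ℝ F u a) (fderiv ℝ F u b)
        + fderiv ℝ ψ (F u) (fderiv ℝ (fderiv ℝ F) u a b) := by
  have h1 : fderiv ℝ (fun z => ψ (F z)) =ᶠ[𝓝 u] fun z => (fderiv ℝ ψ (F z)).comp (fderiv ℝ F z) := by
    filter_upwards [hF.eventually (by simp), hF.continuousAt.eventually (hψ.eventually (by simp))]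
      with z h1 h2
    exact fderiv_comp z (h2.differentiableAt (by norm_num)) (h1.differentiableAt (by norm_num))
  rw [h1.fderiv_eq]
  have hF1 : HasFDerivAt F (fderiv ℝ F u) u := (hF.differentiableAt (by norm_num)).hasFDerivAt
  have h0 : HasFDerivAt (fun z => fderiv ℝ ψ (F z))
      ((fderiv ℝ (fderiv ℝ ψ) (F u)).comp (fderiv ℝ F u)) u :=
    (differentiableAt_fderiv hψ).hasFDerivAt.comp u hF1
  have h2 := h0.clm_comp (differentiableAt_fderiv hF).hasFDerivAt
  rw [h2.fderiv]
  simp [add_comm]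

/-- The Hessian of a composition: the remaining term pairs the differential with the second
fundamental form of `F`. -/
lemma hess_comp {ψ : E → ℝ} {F : E' → E} {u : E'} (Γ : E →L[ℝ] E →L[ℝ] E)
    (Γh : E' →L[ℝ] E' →L[ℝ] E') (hF : ContDiffAt ℝ 2 F u) (hψ : ContDiffAt ℝ 2 ψ (F u)) (a b : E') :
    hess Γh (fun z => ψ (F z)) u a b = hess Γ ψ (F u) (fderiv ℝ F u a) (fderiv ℝ F u b)
      + fderiv ℝ ψ (F u) (fderiv ℝ (fderiv ℝ F) u a b + Γ (fderiv ℝ F u a) (fderiv ℝ F u b)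
        - fderiv ℝ F u (Γh a b)) := by
  rw [hess, sndFDeriv_comp hF hψ, fderiv_comp_apply (hF.differentiableAt (by norm_num))
    (hψ.differentiableAt (by norm_num)), hess]
  simp only [map_add, map_sub]
  ring

end Calculus

/-! ### Metrics in normal coordinates -/

section NormalBall

attribute [-instance] instNormedAddCommGroupOfRiemannianBundleOfIsTopologicalAddGroupOfContinuousConstSMulReal
  instInnerProductSpaceReal

variable {E : Type*} [NormedAddCommGroup E] [NormedSpace ℝ E]

/-- A symmetric positive definite bilinear form. -/
structure IsInnerForm (B : E →L[ℝ] E →L[ℝ] ℝ) : Prop where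
  symm : ∀ a b, B a b = B b a
  pos : ∀ a, a ≠ 0 → 0 < B a a

namespace IsInnerForm

variable {B : E →L[ℝ] E →L[ℝ] ℝ}

lemma nonneg (hB : IsInnerForm B) (a : E) : 0 ≤ B a a := by
  by_cases h : a = 0
  · simp [h]
  · exact (hB.pos a h).le

lemma cauchy_schwarz (hB : IsInnerForm B) (a b : E) : B a b ^ 2 ≤ B a a * B b b := by
  by_cases h : b = 0
  · simp [h]
  · have hb := hB.pos b h
    have h1 := hB.nonneg (B b b • a - B a b • b)
    have h2 : B (B b b • a - B a b • b) (B b b • a - B a b • b)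
        = B b b * (B a a * B b b - B a b ^ 2) := by
      simp only [map_sub, map_smul, sub_apply, smul_apply, smul_eq_mul, hB.symm b a]
      ring
    rw [h2] at h1
    nlinarith [nonneg_of_mul_nonneg_right h1 hb]

lemma abs_le (hB : IsInnerForm B) (a b : E) : |B a b| ≤ √(B a a) * √(B b b) := by
  rw [← Real.sqrt_mul (hB.nonneg a)]
  exact Real.abs_le_sqrt (hB.cauchy_schwarz a b)

lemma nondegenerate (hB : IsInnerForm B) (w : E) (h : ∀ c, B w c = 0) : w = 0 := by
  by_contra h0
  exact (hB.pos w h0).ne' (h w)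

end IsInnerForm

/-- The derivative of a squared norm `β` with `β' ≤ 2 c s² √β` and `β 0 = 0` gives
`√β ≤ c s³ / 3`. -/
lemma sqrt_le_of_deriv_le {β β' : ℝ → ℝ} {c : ℝ} (hc : 0 ≤ c)
    (hd : ∀ s ∈ Icc (0 : ℝ) 1, HasDerivAt β (β' s) s) (h0 : β 0 = 0) (hn : ∀ s ∈ Icc (0 : ℝ) 1, 0 ≤ β s)
    (hb : ∀ s ∈ Icc (0 : ℝ) 1, β' s ≤ 2 * c * s ^ 2 * √(β s)) {s : ℝ} (hs : s ∈ Icc (0 : ℝ) 1) :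
    √(β s) ≤ c * s ^ 3 / 3 := by
  apply le_of_forall_pos_le_add
  intro η hη
  have hη2 : 0 < η ^ 2 := by positivity
  have hder : ∀ x ∈ Icc (0 : ℝ) 1, HasDerivAt (fun x => √(β x + η ^ 2))
      (β' x / (2 * √(β x + η ^ 2))) x := by
    intro x hx
    have := hn x hx
    exact ((hd x hx).add_const _).sqrt (by positivity)
  have key := image_le_of_deriv_right_le_deriv_boundary (f := fun x => √(β x + η ^ 2))
    (f' := fun x => β' x / (2 * √(β x + η ^ 2))) (a := 0) (b := 1)
    (B := fun x => c * x ^ 3 / 3 + η) (B' := fun x => c * x ^ 2)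
    (fun x hx => (hder x hx).continuousAt.continuousWithinAt)
    (fun x hx => (hder x (Ico_subset_Icc_self hx)).hasDerivWithinAt)
    (by simp [h0, Real.sqrt_sq hη.le]) (by fun_prop)
    (fun x _ => by
      have : HasDerivAt (fun x : ℝ => c * x ^ 3 / 3 + η) (c * x ^ 2) x := by
        have h := (((hasDerivAt_pow 3 x).const_mul c).div_const 3).add_const η
        refine HasDerivAt.congr_deriv (h) ?_
        push_cast
        ring
      exact this.hasDerivWithinAt)
    (fun x hx => by
      have hx' := Ico_subset_Icc_self hx
      have h1 := hb x hx'
      have hnx := hn x hx'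
      have hpos : 0 < √(β x + η ^ 2) := Real.sqrt_pos.2 (by positivity)
      rw [div_le_iff₀ (by positivity)]
      have h2 : √(β x) ≤ √(β x + η ^ 2) := Real.sqrt_le_sqrt (by linarith)
      have h3 : 0 ≤ 2 * c * x ^ 2 := by positivity
      calc β' x ≤ 2 * c * x ^ 2 * √(β x) := h1
        _ ≤ 2 * c * x ^ 2 * √(β x + η ^ 2) := by gcongr
        _ = c * x ^ 2 * (2 * √(β x + η ^ 2)) := by ring)
    hs
  refine le_trans (Real.sqrt_le_sqrt ?_) key
  linarith

/-- A metric `G` on a star-shaped open set `D` for which rays from the origin are geodesics and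
whose radial curvature operators are bounded by `K`. -/
structure IsNormalMetric (G : E → E →L[ℝ] E →L[ℝ] ℝ) (Γ : E → E →L[ℝ] E →L[ℝ] E) (D : Set E)
    (K : ℝ) : Prop where
  isOpen : IsOpen D
  star : ∀ y ∈ D, ∀ s ∈ Icc (0 : ℝ) 1, s • y ∈ D
  symm : ∀ z a b, G z a b = G z b a
  inner : ∀ y ∈ D, IsInnerForm (G y)
  diff : ∀ y ∈ D, DifferentiableAt ℝ G y
  diffΓ : ∀ y ∈ D, DifferentiableAt ℝ Γ y
  christoffel : ∀ y ∈ D, IsChristoffelAt G (Γ y) y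
  ray : ∀ y ∈ D, ∀ s ∈ Icc (0 : ℝ) 1, Γ (s • y) y y = 0
  K_nonneg : 0 ≤ K
  curv_le : ∀ y ∈ D, ∀ a v, G y (curv Γ y a v v) (curv Γ y a v v) ≤ (K * G y v v) ^ 2 * G y a a

namespace IsNormalMetric

variable {G : E → E →L[ℝ] E →L[ℝ] ℝ} {Γ : E → E →L[ℝ] E →L[ℝ] E} {D : Set E} {K : ℝ}

/-- Along the ray `s ↦ s • v`, inner products of vector fields are differentiated by covariant
derivatives `P' + Γ v P`. -/
lemma hasDerivAt_ray (h : IsNormalMetric G Γ D K) {v : E} {s : ℝ} (hs : s • v ∈ D)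
    {P Q : ℝ → E} {P' Q' : E} (hP : HasDerivAt P P' s) (hQ : HasDerivAt Q Q' s) :
    HasDerivAt (fun s => G (s • v) (P s) (Q s))
      (G (s • v) (P' + Γ (s • v) v (P s)) (Q s) + G (s • v) (P s) (Q' + Γ (s • v) v (Q s))) s := by
  have h1 : HasDerivAt (fun s : ℝ => s • v) v s := by
    simpa using (hasDerivAt_id s).smul_const v
  have h2 : HasDerivAt (fun s : ℝ => G (s • v)) (fderiv ℝ G (s • v) v) s :=
    HasFDerivAt.comp_hasDerivAt (l := G) s (h.diff _ hs).hasFDerivAt h1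
  have h3 := (h2.clm_apply hP).clm_apply hQ
  refine HasDerivAt.congr_deriv (h3) ?_
  have := (h.christoffel _ hs).compat (h.diff _ hs) h.symm v (P s) (Q s)
  simp only [add_apply, map_add, this]
  ring

lemma eq_of_hasDerivAt_zero {f : ℝ → ℝ} (hf : ∀ s ∈ Icc (0 : ℝ) 1, HasDerivAt f 0 s) :
    f 1 = f 0 :=
  constant_of_has_deriv_right_zero (fun x hx => (hf x hx).continuousAt.continuousWithinAt)
    (fun x hx => (hf x (Ico_subset_Icc_self hx)).hasDerivWithinAt) 1 (by simp)

lemma speed (h : IsNormalMetric G Γ D K) {y : E} (hy : y ∈ D) {s : ℝ} (hs : s ∈ Icc (0 : ℝ) 1) :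
    G (s • y) y y = G 0 y y := by
  have := constant_of_has_deriv_right_zero (f := fun s : ℝ => G (s • y) y y) (a := 0) (b := 1)
  have hd : ∀ s ∈ Icc (0 : ℝ) 1, HasDerivAt (fun s : ℝ => G (s • y) y y) 0 s := by
    intro s hs
    refine HasDerivAt.congr_deriv (h.hasDerivAt_ray (h.star y hy s hs) (hasDerivAt_const s y) (hasDerivAt_const s y)) ?_
    simp [h.ray y hy s hs]
  simpa using this (fun x hx => (hd x hx).continuousAt.continuousWithinAt)
    (fun x hx => (hd x (Ico_subset_Icc_self hx)).hasDerivWithinAt) s hs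

lemma speed_one (h : IsNormalMetric G Γ D K) {y : E} (hy : y ∈ D) : G y y y = G 0 y y := by
  simpa using h.speed hy (s := 1) (by simp)

/-- The derivative of `|y|² = |y|²₀`, the conservation of the speed of the rays. -/
lemma gauss_aux (h : IsNormalMetric G Γ D K) {y : E} (hy : y ∈ D) (a : E) :
    G y (Γ y a y) y + G y a y = G 0 a y := by
  have h1 : (fun z => G z z z) =ᶠ[𝓝 y] fun z => G 0 z z :=
    Filter.eventuallyEq_of_mem (h.isOpen.mem_nhds hy) fun z hz => h.speed_one hz
  have h2 := h1.fderiv_eq (𝕜 := ℝ)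
  have h3 := ((h.diff y hy).hasFDerivAt.clm_apply (hasFDerivAt_id y)).clm_apply (hasFDerivAt_id y)
  have h4 := ((hasFDerivAt_const (G 0) y).clm_apply (hasFDerivAt_id y)).clm_apply (hasFDerivAt_id y)
  have h5 := h3.fderiv.symm.trans (h2.trans h4.fderiv)
  have h6 := congrArg (fun L => L a) h5
  simp at h6
  rw [(h.christoffel y hy).compat (h.diff y hy) h.symm, h.symm y y, h.symm y y, h.symm 0 y] at h6
  linarith

/-- **Gauss lemma**. -/
lemma gauss (h : IsNormalMetric G Γ D K) {y : E} (hy : y ∈ D) (a : E) : G y y a = G 0 y a := by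
  have hd : ∀ s ∈ Icc (0 : ℝ) 1, HasDerivAt (fun s : ℝ => G (s • y) (s • y) a - s * G 0 y a) 0 s := by
    intro s hs
    have h1 : HasDerivAt (fun s : ℝ => s • y) y s := by simpa using (hasDerivAt_id s).smul_const y
    have hsy := h.star y hy s hs
    have h2 := (h.hasDerivAt_ray hsy h1 (hasDerivAt_const s a)).sub
      ((hasDerivAt_id s).mul_const (G 0 y a))
    refine HasDerivAt.congr_deriv (h2) ?_
    simp only [map_smul, smul_apply, smul_eq_mul, h.ray y hy s hs, zero_add, smul_zero, add_zero,
      one_mul]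
    have h3 := h.gauss_aux hsy a
    simp only [map_smul, smul_apply, smul_eq_mul] at h3
    rcases eq_or_ne s 0 with rfl | hs0
    · simp
    · have h4 : s * G (s • y) (Γ (s • y) a y) y + G (s • y) a y = G 0 a y := by
        apply mul_left_cancel₀ hs0
        linarith
      rw [(h.christoffel _ hsy).symm y a, h.symm _ y, h.symm _ y, h.symm 0 y]
      linarith
  have := eq_of_hasDerivAt_zero hd
  simp at this
  linarith

/-- The Hessian of half the squared distance to the origin. -/
lemma hess_radial (h : IsNormalMetric G Γ D K) {y : E} (hy : y ∈ D) (a b : E) :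
    G 0 a b - G 0 y (Γ y a b) = G y (a + Γ y a y) b := by
  have h1 : (fun z => G z z b) =ᶠ[𝓝 y] fun z => G 0 z b :=
    Filter.eventuallyEq_of_mem (h.isOpen.mem_nhds hy) fun z hz => h.gauss hz b
  have h2 := h1.fderiv_eq (𝕜 := ℝ)
  have h3 := ((h.diff y hy).hasFDerivAt.clm_apply (hasFDerivAt_id y)).clm_apply
    (hasFDerivAt_const b y)
  have h4 := ((hasFDerivAt_const (G 0) y).clm_apply (hasFDerivAt_id y)).clm_apply
    (hasFDerivAt_const b y)
  have h5 := h3.fderiv.symm.trans (h2.trans h4.fderiv)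
  have h6 := congrArg (fun L => L a) h5
  simp at h6
  rw [(h.christoffel y hy).compat (h.diff y hy) h.symm] at h6
  rw [← h.gauss hy, map_add, add_apply]
  linarith

/-- Comparison along a ray: the field `W s = s² Γ(s y)(a, y)` has covariant derivative
`-s² R(a, y) y`, and it controls the derivative of the length of the constant field `a`. -/
lemma christoffel_radial_le (h : IsNormalMetric G Γ D K) {y : E} (hy : y ∈ D)
    (hK : K * G 0 y y ≤ 1) (a : E) :
    G y (Γ y a y) (Γ y a y) ≤ (K * G 0 y y) ^ 2 * G y a a := by
  have hmem := fun s hs => h.star y hy s hs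
  set κ := K * G 0 y y with hκ
  have hκ0 : 0 ≤ κ := by
    have h1 := (h.inner y hy).nonneg y
    rw [h.speed_one hy] at h1
    exact mul_nonneg h.K_nonneg h1
  -- the constant field `a`
  have hn' : ∀ s ∈ Icc (0 : ℝ) 1, HasDerivAt (fun s : ℝ => G (s • y) a a)
      (2 * G (s • y) (Γ (s • y) a y) a) s := by
    intro s hs
    refine HasDerivAt.congr_deriv (h.hasDerivAt_ray (hmem s hs) (hasDerivAt_const s a) (hasDerivAt_const s a)) ?_
    rw [(h.christoffel _ (hmem s hs)).symm y a, h.symm _ a]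
    simp
    ring
  -- `N` is the largest squared length of `a` on the ray; the bound for `N` in terms of the value at
  -- the end of the ray is obtained at the end
  obtain ⟨s₀, hs₀, hmax⟩ := isCompact_Icc.exists_isMaxOn (nonempty_Icc.2 zero_le_one)
    (fun x hx => (hn' x hx).continuousAt.continuousWithinAt)
  set N := G (s₀ • y) a a with hN
  have hle : ∀ s ∈ Icc (0 : ℝ) 1, G (s • y) a a ≤ N := fun s hs => hmax hs
  have hN0 : 0 ≤ N := (h.inner _ (hmem s₀ hs₀)).nonneg a
  -- the field `W`
  have hW : ∀ s ∈ Icc (0 : ℝ) 1, HasDerivAt (fun s : ℝ => s ^ 2 • Γ (s • y) a y)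
      (-(s ^ 2 • curv Γ (s • y) a y y) - Γ (s • y) y (s ^ 2 • Γ (s • y) a y)) s := by
    intro s hs
    have hsy := hmem s hs
    have hz : ∀ᶠ z in 𝓝 (s • y), Γ z z z = 0 := by
      filter_upwards [h.isOpen.mem_nhds hsy] with z hz
      simpa using h.ray z hz 1 (by simp)
    have e1 : HasDerivAt (fun s : ℝ => s • y) y s := by simpa using (hasDerivAt_id s).smul_const y
    have e2 : HasDerivAt (fun s : ℝ => Γ (s • y)) (fderiv ℝ Γ (s • y) y) s :=
      HasFDerivAt.comp_hasDerivAt (l := Γ) s (h.diffΓ _ hsy).hasFDerivAt e1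
    have e3 := (hasDerivAt_pow 2 s).smul
      ((e2.clm_apply (hasDerivAt_const s a)).clm_apply (hasDerivAt_const s y))
    refine HasDerivAt.congr_deriv (e3) ?_
    have f1 := Filter.EventuallyEq.fderiv_eq (𝕜 := ℝ) (f₁ := fun z => Γ z z z) (f := fun _ => 0) hz
    have f2 := (((h.diffΓ _ hsy).hasFDerivAt.clm_apply (hasFDerivAt_id _)).clm_apply
      (hasFDerivAt_id _)).fderiv
    simp only [id] at f2
    rw [f1] at f2
    have f3 := congrArg (fun L => L a) f2
    simp at f3
    rw [(h.christoffel _ hsy).symm y a] at f3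
    have f4 : s ^ 2 • fderiv ℝ Γ (s • y) a y y = -((2 * s) • Γ (s • y) a y) := by
      rw [eq_neg_iff_add_eq_zero]
      refine Eq.trans ?_ f3.symm
      module
    simp only [curv, h.ray y hy s hs, smul_add, smul_sub, f4, map_smul]
    simp
  have hβ' : ∀ s ∈ Icc (0 : ℝ) 1, HasDerivAt
      (fun s : ℝ => G (s • y) (s ^ 2 • Γ (s • y) a y) (s ^ 2 • Γ (s • y) a y))
      (-(2 * s ^ 2 * G (s • y) (curv Γ (s • y) a y y) (s ^ 2 • Γ (s • y) a y))) s := by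
    intro s hs
    refine HasDerivAt.congr_deriv (h.hasDerivAt_ray (hmem s hs) (hW s hs) (hW s hs)) ?_
    rw [h.symm _ (s ^ 2 • Γ (s • y) a y) (_ + _)]
    simp
    ring
  have hsqrt : ∀ s ∈ Icc (0 : ℝ) 1,
      √(G (s • y) (s ^ 2 • Γ (s • y) a y) (s ^ 2 • Γ (s • y) a y)) ≤ (κ * √N) * s ^ 3 / 3 := by
    intro s hs
    refine sqrt_le_of_deriv_le (by positivity) hβ' (by simp)
      (fun s hs => (h.inner _ (hmem s hs)).nonneg _) (fun s hs => ?_) hs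
    have g1 := (abs_le.1 ((h.inner _ (hmem s hs)).abs_le (curv Γ (s • y) a y y)
      (s ^ 2 • Γ (s • y) a y))).1
    have g2 := h.curv_le _ (hmem s hs) a y
    rw [h.speed hy hs] at g2
    have g3 : √(G (s • y) (curv Γ (s • y) a y y) (curv Γ (s • y) a y y)) ≤ κ * √N := by
      rw [Real.sqrt_le_left (by positivity), mul_pow, Real.sq_sqrt hN0]
      exact g2.trans (by gcongr; exact hle s hs)
    have g4 : -(√(G (s • y) (curv Γ (s • y) a y y) (curv Γ (s • y) a y y))
      * √(G (s • y) (s ^ 2 • Γ (s • y) a y) (s ^ 2 • Γ (s • y) a y))) ≥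
      -((κ * √N) * √(G (s • y) (s ^ 2 • Γ (s • y) a y) (s ^ 2 • Γ (s • y) a y))) := by gcongr
    nlinarith [sq_nonneg s]
  -- the length of `a` varies little
  have hn2 : ∀ s ∈ Icc (0 : ℝ) 1, -(κ * N * s) ≤ 2 * G (s • y) (Γ (s • y) a y) a := by
    intro s hs
    rcases eq_or_lt_of_le hs.1 with h0 | h0
    · have hd : G (s • y) (Γ (s • y) a y) a = 0 := by
        have e := (h.christoffel _ (hmem 0 (by simp)))
        rw [← h0] at *
        simp only [zero_smul] at *
        have hz : ∀ v ∈ D, Γ 0 v v = 0 := fun v hv => by simpa using h.ray v hv 0 (by simp)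
        -- `Γ 0` vanishes on the diagonal by homogeneity, and then everywhere by polarization
        have hall : ∀ v, Γ 0 v v = 0 := by
          intro v
          have h0D : (0 : E) ∈ D := by simpa using h.star y hy 0 (by simp)
          have ht : Tendsto (fun t : ℝ => t • v) (𝓝 0) (𝓝 0) := by
            have : ContinuousAt (fun t : ℝ => t • v) 0 := by fun_prop
            simpa [ContinuousAt] using this
          have h1 := (ht.eventually (h.isOpen.mem_nhds h0D)).filter_mono
            (nhdsWithin_le_nhds (s := {0}ᶜ))
          obtain ⟨t, ht, ht0⟩ := (h1.and self_mem_nhdsWithin).exists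
          have h2 := hz _ ht
          simp only [map_smul, smul_apply, smul_eq_zero] at h2
          rcases h2 with h2 | h2 | h2
          · exact absurd h2 ht0
          · exact absurd h2 ht0
          · exact h2
        have h3 := hall (a + y)
        simp only [map_add, add_apply, hall a, hall y, e.symm y a] at h3
        have h4 : Γ 0 a y = 0 := by
          have : (2 : ℝ) • Γ 0 a y = 0 := by rw [two_smul]; simpa using h3
          simpa using this
        simp [h4]
      rw [hd, ← h0]; simp
    · have g1 := (abs_le.1 ((h.inner _ (hmem s hs)).abs_le (s ^ 2 • Γ (s • y) a y) a)).1
      have g2 : √(G (s • y) a a) ≤ √N := Real.sqrt_le_sqrt (hle s hs)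
      have g3 : √(G (s • y) (s ^ 2 • Γ (s • y) a y) (s ^ 2 • Γ (s • y) a y)) * √(G (s • y) a a)
          ≤ ((κ * √N) * s ^ 3 / 3) * √N := by
        gcongr
        exact hsqrt s hs
      have g4 : ((κ * √N) * s ^ 3 / 3) * √N = κ * N * s ^ 3 / 3 := by
        rw [← Real.mul_self_sqrt hN0]; simp only [Real.mul_self_sqrt hN0]
        linear_combination (κ * s ^ 3 / 3) * Real.mul_self_sqrt hN0
      simp only [map_smul, smul_apply, smul_eq_mul] at g1 g3
      have g5 : 0 ≤ κ * N * s := by positivity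
      have hs2 : 0 < s ^ 2 := by positivity
      have g6 : s ^ 2 * (-(κ * N * s)) ≤ s ^ 2 * (2 * G (s • y) (Γ (s • y) a y) a) := by
        nlinarith
      exact le_of_mul_le_mul_left g6 hs2
  have hNle : N ≤ 2 * G y a a := by
    have key := image_le_of_deriv_right_le_deriv_boundary
      (f := fun s : ℝ => -(G (s • y) a a)) (f' := fun s => -(2 * G (s • y) (Γ (s • y) a y) a))
      (a := s₀) (b := 1) (B := fun x => κ * N * x ^ 2 / 2 - N - κ * N * s₀ ^ 2 / 2)
      (B' := fun x => κ * N * x)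
      (fun x hx => (hn' x ⟨hs₀.1.trans hx.1, hx.2⟩).neg.continuousAt.continuousWithinAt)
      (fun x hx => (hn' x ⟨hs₀.1.trans hx.1, hx.2.le⟩).neg.hasDerivWithinAt)
      (by simp [hN]) (by fun_prop)
      (fun x _ => by
        have : HasDerivAt (fun x : ℝ => κ * N * x ^ 2 / 2 - N - κ * N * s₀ ^ 2 / 2)
            (κ * N * x) x := by
          have h := ((((hasDerivAt_pow 2 x).const_mul (κ * N)).div_const 2).sub_const N).sub_const
            (κ * N * s₀ ^ 2 / 2)
          refine HasDerivAt.congr_deriv (h) ?_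
          push_cast
          ring
        exact this.hasDerivWithinAt)
      (fun x hx => by
        have := hn2 x ⟨hs₀.1.trans hx.1, hx.2.le⟩
        linarith)
      (x := 1) ⟨hs₀.2, le_rfl⟩
    simp only [one_smul] at key
    have : 0 ≤ κ * N * s₀ ^ 2 / 2 := by positivity
    have : κ * N ≤ 1 * N := by gcongr
    linarith
  have hfin := hsqrt 1 (by simp)
  simp only [one_smul, one_pow, mul_one] at hfin
  rw [Real.sqrt_le_left (by positivity), div_pow, mul_pow, Real.sq_sqrt hN0] at hfin
  have : 0 ≤ κ ^ 2 * N := by positivity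
  have : κ ^ 2 * N ≤ κ ^ 2 * (2 * G y a a) := by gcongr
  linarith

/-- The Hessian of half the squared distance is almost the metric. -/
lemma hess_radial_ge (h : IsNormalMetric G Γ D K) {y : E} (hy : y ∈ D)
    (hK : K * G 0 y y ≤ 1) (a : E) :
    (1 - K * G 0 y y) * G y a a ≤ G 0 a a - G 0 y (Γ y a a) := by
  rw [h.hess_radial hy, map_add, add_apply]
  have h1 := (abs_le.1 ((h.inner y hy).abs_le (Γ y a y) a)).1
  have hκ0 : 0 ≤ K * G 0 y y := by
    have h1 := (h.inner y hy).nonneg y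
    rw [h.speed_one hy] at h1
    exact mul_nonneg h.K_nonneg h1
  have h0 := (h.inner y hy).nonneg a
  have h2 : √(G y (Γ y a y) (Γ y a y)) ≤ K * G 0 y y * √(G y a a) := by
    rw [Real.sqrt_le_left (by positivity), mul_pow, Real.sq_sqrt h0]
    exact h.christoffel_radial_le hy hK a
  have h3 : √(G y (Γ y a y) (Γ y a y)) * √(G y a a) ≤ K * G 0 y y * √(G y a a) * √(G y a a) := by
    gcongr
  rw [mul_assoc, Real.mul_self_sqrt h0] at h3
  linarith

end IsNormalMetric

end NormalBall

/-! ### Matrices of metrics as bilinear forms -/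

section MatrixForms

attribute [-instance] instNormedAddCommGroupOfRiemannianBundleOfIsTopologicalAddGroupOfContinuousConstSMulReal
  instInnerProductSpaceReal

variable {n : ℕ}

/-- The `i`-th vector of the standard basis. -/
abbrev sb (i : Fin n) : Eu n := EuclideanSpace.single i 1

lemma sum_smul_sb (a : Eu n) : ∑ i, a i • sb i = a := by
  ext j
  simp [Pi.single_apply]

/-- Induction along linear combinations of the standard basis. -/
lemma eu_induction {p : Eu n → Prop} (hsb : ∀ i, p (sb i)) (hadd : ∀ a b, p a → p b → p (a + b))
    (hsmul : ∀ (t : ℝ) a, p a → p (t • a)) (h0 : p 0) (c : Eu n) : p c := by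
  rw [← sum_smul_sb c]
  exact Finset.sum_induction _ p hadd h0 fun i _ => hsmul _ _ (hsb i)

/-- The bilinear form with matrix `A` in the standard basis. -/
def matB (A : Matrix (Fin n) (Fin n) ℝ) : Eu n →L[ℝ] Eu n →L[ℝ] ℝ :=
  ∑ i, ∑ j, A i j • (EuclideanSpace.proj i : Eu n →L[ℝ] ℝ).smulRight
    (EuclideanSpace.proj j : Eu n →L[ℝ] ℝ)

lemma matB_apply (A : Matrix (Fin n) (Fin n) ℝ) (a b : Eu n) :
    matB A a b = ∑ i, ∑ j, A i j * a i * b j := by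
  simp [matB, mul_assoc]

lemma matB_sb (A : Matrix (Fin n) (Fin n) ℝ) (i j : Fin n) : matB A (sb i) (sb j) = A i j := by
  simp [matB_apply]

lemma matB_sb_right (A : Matrix (Fin n) (Fin n) ℝ) (a : Eu n) (j : Fin n) :
    matB A a (sb j) = ∑ i, A i j * a i := by
  simp [matB_apply]

lemma matB_eq_dotProduct (A : Matrix (Fin n) (Fin n) ℝ) (a b : Eu n) :
    matB A a b = dotProduct a.ofLp (A.mulVec b.ofLp) := by
  simp only [matB_apply, dotProduct, Matrix.mulVec, Finset.mul_sum]
  exact Finset.sum_congr rfl fun i _ => Finset.sum_congr rfl fun j _ => by ring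

lemma matB_symm {A : Matrix (Fin n) (Fin n) ℝ} (hA : ∀ i j, A i j = A j i) (a b : Eu n) :
    matB A a b = matB A b a := by
  rw [matB_apply, matB_apply, Finset.sum_comm]
  refine Finset.sum_congr rfl fun i _ => Finset.sum_congr rfl fun j _ => ?_
  rw [hA]; ring

/-- A bilinear form is determined by its matrix. -/
lemma matB_of_form (B : Eu n →L[ℝ] Eu n →L[ℝ] ℝ) :
    matB (Matrix.of fun i j => B (sb i) (sb j)) = B := by
  ext a b
  induction a using eu_induction with
  | h0 => simp
  | hadd a a' h h' => simp only [map_add, add_apply, h, h']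
  | hsmul t a h => simp only [map_smul, smul_apply, h]
  | hsb i =>
    induction b using eu_induction with
    | h0 => simp
    | hadd a a' h h' => simp only [map_add, h, h']
    | hsmul t a h => simp only [map_smul, h]
    | hsb j => rw [matB_sb]; rfl

lemma posDef_of_isInnerForm {A : Matrix (Fin n) (Fin n) ℝ} (hA : IsInnerForm (matB A)) :
    A.PosDef := by
  refine Matrix.PosDef.of_dotProduct_mulVec_pos ?_ ?_
  · ext i j
    simpa [matB_sb] using hA.symm (sb j) (sb i)
  · intro x hx
    have := hA.pos (WithLp.toLp 2 x) (by simpa using hx)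
    rw [matB_eq_dotProduct] at this
    simpa using this

/-- The Christoffel symbols as a bilinear map. -/
def chrMap (g : Eu n → Matrix (Fin n) (Fin n) ℝ) (y : Eu n) : Eu n →L[ℝ] Eu n →L[ℝ] Eu n :=
  ∑ i, ∑ j, ∑ k, christoffel g y k i j • (EuclideanSpace.proj i : Eu n →L[ℝ] ℝ).smulRight
    ((EuclideanSpace.proj j : Eu n →L[ℝ] ℝ).smulRight (sb k))

lemma chrMap_apply (g : Eu n → Matrix (Fin n) (Fin n) ℝ) (y a b : Eu n) (k : Fin n) :
    chrMap g y a b k = ∑ i, ∑ j, christoffel g y k i j * a i * b j := by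
  simp [chrMap, Pi.single_apply, mul_assoc]

lemma chrMap_sb (g : Eu n → Matrix (Fin n) (Fin n) ℝ) (y : Eu n) (i j k : Fin n) :
    chrMap g y (sb i) (sb j) k = christoffel g y k i j := by
  rw [chrMap_apply]
  simp

variable {g : Eu n → Matrix (Fin n) (Fin n) ℝ} {y : Eu n}

lemma contDiffAt_sum_smul_const {N : ℕ∞ω} {X W : Type*} [NormedAddCommGroup X] [NormedSpace ℝ X]
    [NormedAddCommGroup W] [NormedSpace ℝ W] {ι : Type*} (s : Finset ι) {f : ι → X → ℝ} {w : ι → W}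
    {y : X} (hf : ∀ i, ContDiffAt ℝ N (f i) y) :
    ContDiffAt ℝ N (fun z => ∑ i ∈ s, f i z • w i) y :=
  ContDiffAt.sum fun i _ => (hf i).smul contDiffAt_const

lemma contDiffAt_matB {N : ℕ∞ω} {X : Type*} [NormedAddCommGroup X] [NormedSpace ℝ X]
    {g : X → Matrix (Fin n) (Fin n) ℝ} {y : X}
    (hg : ∀ i j, ContDiffAt ℝ N (fun z => g z i j) y) :
    ContDiffAt ℝ N (fun z => matB (g z)) y := by
  unfold matB
  exact ContDiffAt.sum fun i _ => contDiffAt_sum_smul_const _ fun j => hg i j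

lemma contDiffAt_det {N : ℕ∞ω} {X : Type*} [NormedAddCommGroup X] [NormedSpace ℝ X]
    {g : X → Matrix (Fin n) (Fin n) ℝ} {y : X}
    (hg : ∀ i j, ContDiffAt ℝ N (fun z => g z i j) y) : ContDiffAt ℝ N (fun z => (g z).det) y := by
  simp only [Matrix.det_apply']
  exact ContDiffAt.sum fun σ _ => contDiffAt_const.mul (contDiffAt_prod fun i _ => hg _ _)

lemma contDiffAt_inv {N : ℕ∞ω} {X : Type*} [NormedAddCommGroup X] [NormedSpace ℝ X]
    {g : X → Matrix (Fin n) (Fin n) ℝ} {y : X}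
    (hg : ∀ i j, ContDiffAt ℝ N (fun z => g z i j) y)
    (hdet : (g y).det ≠ 0) (k l : Fin n) : ContDiffAt ℝ N (fun z => (g z)⁻¹ k l) y := by
  simp only [Matrix.inv_def, Matrix.smul_apply, Ring.inverse_eq_inv', Matrix.adjugate_apply,
    smul_eq_mul]
  refine ((contDiffAt_det hg).inv hdet).mul (contDiffAt_det fun i j => ?_)
  simp only [Matrix.updateRow_apply]
  split_ifs
  · exact contDiffAt_const
  · exact hg i j

lemma contDiffAt_pderiv {W : Type*} [NormedAddCommGroup W] [NormedSpace ℝ W] {φ : Eu n → W}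
    (hφ : ContDiffAt ℝ ∞ φ y) (i : Fin n) : ContDiffAt ℝ ∞ (pderiv i φ) y :=
  (hφ.fderiv_right (m := ∞) (by simp)).clm_apply contDiffAt_const

lemma contDiffAt_christoffel (hg : ∀ i j, ContDiffAt ℝ ∞ (fun z => g z i j) y)
    (hdet : (g y).det ≠ 0) (k i j : Fin n) :
    ContDiffAt ℝ ∞ (fun z => christoffel g z k i j) y := by
  unfold christoffel
  refine contDiffAt_const.mul (ContDiffAt.sum fun l _ => (contDiffAt_inv hg hdet k l).mul ?_)
  exact ((contDiffAt_pderiv (hg j l) i).add (contDiffAt_pderiv (hg i l) j)).sub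
    (contDiffAt_pderiv (hg i j) l)

lemma contDiffAt_chrMap (hg : ∀ i j, ContDiffAt ℝ ∞ (fun z => g z i j) y)
    (hdet : (g y).det ≠ 0) : ContDiffAt ℝ ∞ (chrMap g) y := by
  unfold chrMap
  exact ContDiffAt.sum fun i _ => ContDiffAt.sum fun j _ =>
    contDiffAt_sum_smul_const _ fun k => contDiffAt_christoffel hg hdet k i j

lemma fderiv_matB_sb (hg : ∀ i j, ContDiffAt ℝ 1 (fun z => g z i j) y) (c i j : Fin n) :
    fderiv ℝ (fun z => matB (g z)) y (sb c) (sb i) (sb j) = pderiv c (fun z => g z i j) y := by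
  have hd : DifferentiableAt ℝ (fun z => matB (g z)) y :=
    (contDiffAt_matB hg).differentiableAt (by norm_num)
  rw [fderiv_clm_apply₂ hd]
  simp only [matB_sb]
  rfl

/-- The Christoffel symbols satisfy the Koszul formula. -/
lemma isChristoffelAt_chrMap (hs : ∀ z i j, g z i j = g z j i)
    (hg : ∀ i j, ContDiffAt ℝ 1 (fun z => g z i j) y) (hdet : (g y).det ≠ 0) :
    IsChristoffelAt (fun z => matB (g z)) (chrMap g y) y where
  symm a b := by
    have hsym : ∀ k i j, christoffel g y k i j = christoffel g y k j i := by
      intro k i j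
      unfold christoffel
      refine congrArg _ (Finset.sum_congr rfl fun l _ => ?_)
      simp only [hs _ j i]
      ring
    ext k
    rw [chrMap_apply, chrMap_apply, Finset.sum_comm]
    refine Finset.sum_congr rfl fun i _ => Finset.sum_congr rfl fun j _ => ?_
    rw [hsym]; ring
  koszul a b c := by
    induction a using eu_induction with
    | h0 => simp
    | hadd a a' h h' => simp only [map_add, add_apply] at *; linarith
    | hsmul t a h =>
      simp only [map_smul, smul_apply, smul_eq_mul] at *
      linear_combination t * h
    | hsb i =>
    induction b using eu_induction with
    | h0 => simp
    | hadd a a' h h' => simp only [map_add, add_apply] at *; linarith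
    | hsmul t a h =>
      simp only [map_smul, smul_apply, smul_eq_mul] at *
      linear_combination t * h
    | hsb j =>
    induction c using eu_induction with
    | h0 => simp
    | hadd a a' h h' => simp only [map_add, add_apply] at *; linarith
    | hsmul t a h =>
      simp only [map_smul, smul_apply, smul_eq_mul] at *
      linear_combination t * h
    | hsb m =>
    rw [fderiv_matB_sb hg, fderiv_matB_sb hg, fderiv_matB_sb hg, matB_sb_right]
    simp only [chrMap_sb]
    set X : Fin n → ℝ := fun l => pderiv i (fun z => g z j l) y + pderiv j (fun z => g z i l) y
      - pderiv l (fun z => g z i j) y with hX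
    have h1 : (g y).mulVec ((g y)⁻¹.mulVec X) = X := by
      rw [Matrix.mulVec_mulVec, Matrix.mul_nonsing_inv _ (isUnit_iff_ne_zero.2 hdet),
        Matrix.one_mulVec]
    have h2 := congrFun h1 m
    simp only [Matrix.mulVec, dotProduct] at h2
    change _ = X m
    rw [← h2, Finset.mul_sum]
    refine Finset.sum_congr rfl fun k _ => ?_
    rw [christoffel, hs y k m]
    ring

lemma fderiv_eu_apply {X : Type*} [NormedAddCommGroup X] [NormedSpace ℝ X] {F : X → Eu n} {u : X}
    (hF : DifferentiableAt ℝ F u) (a : X) (k : Fin n) :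
    fderiv ℝ F u a k = fderiv ℝ (fun z => F z k) u a := by
  have h := ((EuclideanSpace.proj k : Eu n →L[ℝ] ℝ).hasFDerivAt (x := F u)).comp u hF.hasFDerivAt
  have h2 : HasFDerivAt (fun z => F z k) ((EuclideanSpace.proj k : Eu n →L[ℝ] ℝ).comp
    (fderiv ℝ F u)) u := h
  rw [h2.fderiv]; rfl

lemma curv_chrMap_sb (hΓ : DifferentiableAt ℝ (chrMap g) y) (i j k l : Fin n) :
    curv (chrMap g) y (sb i) (sb j) (sb k) l = curvature g y l k i j := by
  have h1 : ∀ i j, fderiv ℝ (chrMap g) y (sb i) (sb j) (sb k) l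
      = pderiv i (fun z => christoffel g z l j k) y := by
    intro i j
    rw [fderiv_clm_apply₂ hΓ, fderiv_eu_apply (by fun_prop)]
    simp only [chrMap_sb]
    rfl
  have h2 : ∀ i j, chrMap g y (sb i) (chrMap g y (sb j) (sb k)) l
      = ∑ m, christoffel g y l i m * christoffel g y m j k := by
    intro i j
    rw [chrMap_apply]
    simp [chrMap_sb]
  simp only [curv, curvature, PiLp.add_apply, PiLp.sub_apply, h1, h2, Finset.sum_sub_distrib]
  ring

/-- The lowered curvature in terms of the components of the Riemann tensor. -/
lemma matB_curv (hs : ∀ i j, g y i j = g y j i) (hΓ : DifferentiableAt ℝ (chrMap g) y)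
    (a b c d : Eu n) :
    matB (g y) (curv (chrMap g) y a b c) d
      = ∑ α : Fin 4 → Fin n, riemannTensor g y α * (d (α 0) * c (α 1) * a (α 2) * b (α 3)) := by
  induction a using eu_induction with
  | h0 => simp [curv]
  | hadd a a' h h' =>
    simp only [PiLp.add_apply, mul_add, add_mul, Finset.sum_add_distrib, ← h, ← h', ← add_apply,
      ← map_add]
    congr 2
    simp only [curv, map_add, add_apply]
    abel
  | hsmul t a h =>
    have e : ∀ α : Fin 4 → Fin n, riemannTensor g y α * (d (α 0) * c (α 1) * (t • a) (α 2) * b (α 3))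
      = t * (riemannTensor g y α * (d (α 0) * c (α 1) * a (α 2) * b (α 3))) := by
      intro α; simp only [PiLp.smul_apply, smul_eq_mul]; ring
    simp only [e, ← Finset.mul_sum, ← h]
    rw [← smul_eq_mul, ← smul_apply, ← map_smul]
    congr 2
    simp only [curv, map_smul, smul_apply]
    module
  | hsb i =>
  induction b using eu_induction with
  | h0 => simp [curv]
  | hadd a a' h h' =>
    simp only [PiLp.add_apply, mul_add, Finset.sum_add_distrib, ← h, ← h', ← add_apply,
      ← map_add]
    congr 2
    simp only [curv, map_add, add_apply]
    abel
  | hsmul t b h =>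
    have e : ∀ α : Fin 4 → Fin n,
      riemannTensor g y α * (d (α 0) * c (α 1) * (sb i) (α 2) * (t • b) (α 3))
      = t * (riemannTensor g y α * (d (α 0) * c (α 1) * (sb i) (α 2) * b (α 3))) := by
      intro α; simp only [PiLp.smul_apply, smul_eq_mul]; ring
    simp only [e, ← Finset.mul_sum, ← h]
    rw [← smul_eq_mul, ← smul_apply, ← map_smul]
    congr 2
    simp only [curv, map_smul, smul_apply]
    module
  | hsb j =>
  induction c using eu_induction with
  | h0 => simp [curv]
  | hadd a a' h h' =>
    simp only [PiLp.add_apply, mul_add, add_mul, Finset.sum_add_distrib, ← h, ← h', ← add_apply,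
      ← map_add]
    congr 2
    simp only [curv, map_add]
    abel
  | hsmul t c h =>
    have e : ∀ α : Fin 4 → Fin n,
      riemannTensor g y α * (d (α 0) * (t • c) (α 1) * (sb i) (α 2) * (sb j) (α 3))
      = t * (riemannTensor g y α * (d (α 0) * c (α 1) * (sb i) (α 2) * (sb j) (α 3))) := by
      intro α; simp only [PiLp.smul_apply, smul_eq_mul]; ring
    simp only [e, ← Finset.mul_sum, ← h]
    rw [← smul_eq_mul, ← smul_apply, ← map_smul]
    congr 2
    simp only [curv, map_smul]
    module
  | hsb k =>
  induction d using eu_induction with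
  | h0 => simp [curv]
  | hadd a a' h h' =>
    simp only [PiLp.add_apply, mul_add, add_mul, Finset.sum_add_distrib, ← h, ← h', map_add]
  | hsmul t d h =>
    have e : ∀ α : Fin 4 → Fin n,
      riemannTensor g y α * ((t • d) (α 0) * (sb k) (α 1) * (sb i) (α 2) * (sb j) (α 3))
      = t * (riemannTensor g y α * (d (α 0) * (sb k) (α 1) * (sb i) (α 2) * (sb j) (α 3))) := by
      intro α; simp only [PiLp.smul_apply, smul_eq_mul]; ring
    simp only [e, ← Finset.mul_sum, ← h, map_smul, smul_eq_mul]
  | hsb l =>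
  rw [matB_sb_right, Finset.sum_eq_single ![l, k, i, j]]
  · simp [riemannTensor, curv_chrMap_sb hΓ, hs l]
  · intro α _ hα
    by_contra hne
    apply hα
    simp only [PiLp.single_apply, mul_ite, mul_one, mul_zero,
      ite_eq_right_iff, not_forall] at hne
    ext s
    fin_cases s <;> simp_all
  · simp

/-- Cauchy–Schwarz for the norm of a covariant tensor. -/
lemma abs_contract_le_tensorNorm {r : ℕ} {A : Matrix (Fin n) (Fin n) ℝ} (hA : A.PosDef)
    (T : (Fin r → Fin n) → ℝ) (w : Fin r → Eu n) :
    |∑ α : Fin r → Fin n, T α * ∏ s, w s (α s)|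
      ≤ √(∑ α : Fin r → Fin n, ∑ β : Fin r → Fin n, (∏ s, A⁻¹ (α s) (β s)) * T α * T β)
        * ∏ s, √(matB A (w s) (w s)) := by
  obtain ⟨q, v, hv⟩ := Matrix.posSemidef_iff_eq_sum_vecMulVec.1 hA.inv.posSemidef
  let B : Matrix (Fin q) (Fin n) ℝ := Matrix.of v
  have hB : A⁻¹ = B.transpose * B := by
    rw [hv]
    ext i j
    simp [Matrix.sum_apply, Matrix.vecMulVec_apply, Matrix.mul_apply, B]
  have hdet : IsUnit A.det := isUnit_iff_ne_zero.2 hA.det_pos.ne'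
  have hBe : ∀ i j, A⁻¹ i j = ∑ c, B c i * B c j := by
    intro i j; rw [hB]; simp [Matrix.mul_apply]
  let ŵ : Fin r → Fin q → ℝ := fun s => B.mulVec (A.mulVec (w s).ofLp)
  have hw : ∀ s i, w s i = ∑ c, B c i * ŵ s c := by
    intro s i
    have h1 : B.transpose.mulVec (ŵ s) = (w s).ofLp := by
      have : B.transpose * B = A⁻¹ := hB.symm
      simp only [ŵ, Matrix.mulVec_mulVec]
      rw [← Matrix.mul_assoc, this, Matrix.nonsing_inv_mul _ hdet, Matrix.one_mulVec]
    rw [← congrFun h1 i]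
    simp [Matrix.mulVec, dotProduct]
  have hŵ : ∀ s, ∑ c, ŵ s c ^ 2 = matB A (w s) (w s) := by
    intro s
    rw [matB_apply]
    have h1 : ∀ i, A.mulVec (w s).ofLp i = ∑ j, A i j * w s j := fun i => rfl
    have h2 : ∑ c, ŵ s c ^ 2 = ∑ c, ŵ s c * ∑ i, B c i * A.mulVec (w s).ofLp i := by
      refine Finset.sum_congr rfl fun c _ => ?_
      rw [sq]; rfl
    rw [h2]
    simp only [Finset.mul_sum]
    rw [Finset.sum_comm]
    refine Finset.sum_congr rfl fun i _ => ?_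
    have h3 : ∑ c, ŵ s c * (B c i * A.mulVec (w s).ofLp i) = w s i * A.mulVec (w s).ofLp i := by
      rw [hw, Finset.sum_mul]
      exact Finset.sum_congr rfl fun c _ => by ring
    rw [h3, h1, Finset.mul_sum]
    exact Finset.sum_congr rfl fun c _ => by ring
  let T' : (Fin r → Fin q) → ℝ := fun γ => ∑ α : Fin r → Fin n, T α * ∏ s, B (γ s) (α s)
  have hT : ∑ α : Fin r → Fin n, ∑ β : Fin r → Fin n, (∏ s, A⁻¹ (α s) (β s)) * T α * T β
      = ∑ γ, T' γ ^ 2 := by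
    have h1 : ∀ α β : Fin r → Fin n, (∏ s, A⁻¹ (α s) (β s)) * T α * T β
        = ∑ γ : Fin r → Fin q, (T α * ∏ s, B (γ s) (α s)) * (T β * ∏ s, B (γ s) (β s)) := by
      intro α β
      simp only [hBe, Finset.prod_univ_sum, Fintype.piFinset_univ, Finset.prod_mul_distrib,
        Finset.sum_mul]
      exact Finset.sum_congr rfl fun c _ => by ring
    simp only [h1, T', sq, Finset.sum_mul_sum]
    calc _ = ∑ α : Fin r → Fin n, ∑ γ : Fin r → Fin q, ∑ β : Fin r → Fin n,
          (T α * ∏ s, B (γ s) (α s)) * (T β * ∏ s, B (γ s) (β s)) :=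
          Finset.sum_congr rfl fun α _ => Finset.sum_comm
      _ = _ := Finset.sum_comm
  have hL : ∑ α : Fin r → Fin n, T α * ∏ s, w s (α s) = ∑ γ, T' γ * ∏ s, ŵ s (γ s) := by
    simp only [hw, Finset.prod_univ_sum, Fintype.piFinset_univ, Finset.prod_mul_distrib, T',
      Finset.mul_sum, Finset.sum_mul]
    rw [Finset.sum_comm]
    exact Finset.sum_congr rfl fun c _ => Finset.sum_congr rfl fun d _ => by ring
  have hR : ∏ s, √(matB A (w s) (w s)) = √(∑ γ : Fin r → Fin q, (∏ s, ŵ s (γ s)) ^ 2) := by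
    simp only [← hŵ, ← Finset.prod_pow]
    have e : ∑ γ : Fin r → Fin q, ∏ s, ŵ s (γ s) ^ 2 = ∏ s, ∑ c, ŵ s c ^ 2 := by
      rw [Finset.prod_univ_sum, Fintype.piFinset_univ]
    rw [e]
    refine (Real.sqrt_eq_iff_mul_self_eq ?_ ?_).2 ?_ |>.symm
    · exact Finset.prod_nonneg fun s _ => Finset.sum_nonneg fun c _ => sq_nonneg _
    · exact Finset.prod_nonneg fun s _ => Real.sqrt_nonneg _
    · rw [← Finset.prod_mul_distrib]
      exact Finset.prod_congr rfl fun s _ =>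
        (Real.mul_self_sqrt (Finset.sum_nonneg fun c _ => sq_nonneg _)).symm
  rw [hL, hT, hR, ← Real.sqrt_mul (Finset.sum_nonneg fun c _ => sq_nonneg _)]
  exact Real.abs_le_sqrt (Finset.sum_mul_sq_le_sq_mul_sq _ _ _)

/-- A bound for the Riemann tensor bounds the radial curvature operators. -/
lemma curv_le_of_tensorNorm (hs : ∀ i j, g y i j = g y j i) (hA : IsInnerForm (matB (g y)))
    (hΓ : DifferentiableAt ℝ (chrMap g) y) {C : ℝ} (hC : tensorNorm g (riemannTensor g) y ≤ C)
    (a v : Eu n) :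
    matB (g y) (curv (chrMap g) y a v v) (curv (chrMap g) y a v v)
      ≤ (C * matB (g y) v v) ^ 2 * matB (g y) a a := by
  set R := curv (chrMap g) y a v v with hR
  have h1 := abs_contract_le_tensorNorm (posDef_of_isInnerForm hA) (riemannTensor g y) ![R, v, a, v]
  have h2 := matB_curv hs hΓ a v v R
  change |_| ≤ tensorNorm g (riemannTensor g) y * _ at h1
  simp only [Fin.prod_univ_four, Matrix.cons_val] at h1
  rw [← h2, ← hR] at h1
  have hC0 : 0 ≤ tensorNorm g (riemannTensor g) y := Real.sqrt_nonneg _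
  have hRR := hA.nonneg R
  have hvv := hA.nonneg v
  have haa := hA.nonneg a
  have h3 : √(matB (g y) R R) * √(matB (g y) R R) ≤ √(matB (g y) R R)
      * (C * matB (g y) v v * √(matB (g y) a a)) := by
    rw [Real.mul_self_sqrt hRR]
    calc matB (g y) R R ≤ |matB (g y) R R| := le_abs_self _
      _ ≤ tensorNorm g (riemannTensor g) y * (√(matB (g y) R R) * √(matB (g y) v v) *
          √(matB (g y) a a) * √(matB (g y) v v)) := h1
      _ = tensorNorm g (riemannTensor g) y * √(matB (g y) R R) * (√(matB (g y) v v)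
          * √(matB (g y) v v)) * √(matB (g y) a a) := by ring
      _ ≤ C * √(matB (g y) R R) * (√(matB (g y) v v)
          * √(matB (g y) v v)) * √(matB (g y) a a) := by gcongr
      _ = _ := by rw [Real.mul_self_sqrt hvv]; ring
  have hCn : 0 ≤ C := hC0.trans hC
  rcases eq_or_lt_of_le (Real.sqrt_nonneg (matB (g y) R R)) with h0 | h0
  · rw [eq_comm, Real.sqrt_eq_zero hRR] at h0
    rw [h0]; positivity
  · have h4 := le_of_mul_le_mul_left h3 h0
    rw [Real.sqrt_le_left (by positivity), mul_pow, Real.sq_sqrt haa] at h4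
    exact h4

end MatrixForms

/-! ### The metric of a Riemannian manifold in coordinates -/

section MetricCoordinates

set_option linter.unusedSectionVars false

variable {n m : ℕ} {M : Type*} [EMetricSpace M] [ChartedSpace (Eu n) M] [IsManifold (𝓡 n) ∞ M]
  [RiemannianBundle (fun x : M => TangentSpace (𝓡 n) x)]

/-- The inner product of two tangent vectors at `q`. Its arguments have the type of tangent vectors,
so that elements of `ℝⁿ` are not paired by the Euclidean inner product. -/
def ipT (q : M) (v w : TangentSpace (𝓡 n) q) : ℝ := inner ℝ v w

/-- The inner product on the tangent space at `q`, identified with `ℝⁿ` by the preferred chart. -/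
def ipM (q : M) : Eu n →L[ℝ] Eu n →L[ℝ] ℝ :=
  matB (Matrix.of fun i j => ipT (n := n) q (sb i) (sb j))

lemma ipM_apply (q : M) (a b : Eu n) : ipM q a b = ipT q a b := by
  induction a using eu_induction with
  | h0 =>
    rw [map_zero]
    exact (inner_zero_left (𝕜 := ℝ) (E := TangentSpace (𝓡 n) q) b).symm
  | hadd a a' h h' =>
    rw [map_add, add_apply, h, h']
    exact (inner_add_left (𝕜 := ℝ) (E := TangentSpace (𝓡 n) q) a a' b).symm
  | hsmul t a h =>
    rw [map_smul, smul_apply, h]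
    exact (real_inner_smul_left (F := TangentSpace (𝓡 n) q) a b t).symm
  | hsb i =>
    induction b using eu_induction with
    | h0 =>
      rw [map_zero]
      exact (inner_zero_right (𝕜 := ℝ) (E := TangentSpace (𝓡 n) q) (sb i : Eu n)).symm
    | hadd a a' h h' =>
      rw [map_add, h, h']
      exact (inner_add_right (𝕜 := ℝ) (E := TangentSpace (𝓡 n) q) (sb i : Eu n) a a').symm
    | hsmul t a h =>
      rw [map_smul, h]
      exact (real_inner_smul_right (F := TangentSpace (𝓡 n) q) (sb i : Eu n) a t).symm
    | hsb j => rw [ipM, matB_sb]; rfl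

lemma isInnerForm_ipM (q : M) : IsInnerForm (ipM (n := n) q) where
  symm a b := by
    rw [ipM_apply, ipM_apply]
    exact real_inner_comm (F := TangentSpace (𝓡 n) q) b a
  pos a ha := by
    rw [ipM_apply]
    exact (real_inner_self_pos (F := TangentSpace (𝓡 n) q) (x := a)).2 ha

/-- The differential of a map from `ℝᵐ` to a manifold, as a linear map into `ℝⁿ`. -/
def dM {M : Type*} [TopologicalSpace M] [ChartedSpace (Eu n) M] (φ : Eu m → M) (u : Eu m) :
    Eu m →L[ℝ] Eu n :=
  mfderiv 𝓘(ℝ, Eu m) (𝓡 n) φ u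

/-- The matrix of the pull back of the metric under a map from `ℝᵐ`. -/
def pb (φ : Eu m → M) (u : Eu m) : Matrix (Fin m) (Fin m) ℝ :=
  Matrix.of fun i j => ipM (φ u) (dM (n := n) φ u (sb i)) (dM (n := n) φ u (sb j))

lemma pullbackMetric_eq_pb {N : Type*} [TopologicalSpace N] [ChartedSpace (Eu m) N]
    (f : N → M) (x : N) (u : Eu m) :
    pullbackMetric (n := n) f x u = pb (n := n) (f ∘ (extChartAt (𝓡 m) x).symm) u := by
  ext i j
  simp only [pb, Matrix.of_apply, ipM_apply]
  rfl

lemma metricCoord_eq_pb (p : M) : metricCoord (n := n) p = pb (n := n) (extChartAt (𝓡 n) p).symm := by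
  ext u i j
  rw [metricCoord, pullbackMetric_eq_pb]
  rfl

lemma matB_pb (φ : Eu m → M) (u a b : Eu m) :
    matB (pb (n := n) φ u) a b = ipM (φ u) (dM (n := n) φ u a) (dM (n := n) φ u b) := by
  have := matB_of_form ((ipM (n := n) (φ u)).bilinearComp (dM (n := n) φ u) (dM (n := n) φ u))
  exact congrArg (fun B => B a b) this

lemma pb_symm (φ : Eu m → M) (u : Eu m) (i j : Fin m) :
    pb (n := n) φ u i j = pb (n := n) φ u j i :=
  (isInnerForm_ipM (φ u)).symm _ _

lemma isInnerForm_pb {φ : Eu m → M} {u : Eu m} (h : Function.Injective (dM (n := n) φ u)) :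
    IsInnerForm (matB (pb (n := n) φ u)) where
  symm := matB_symm (pb_symm φ u)
  pos a ha := by
    rw [matB_pb]
    exact (isInnerForm_ipM (φ u)).pos _ fun h0 => ha (h (by rw [h0, map_zero]))

lemma dM_congr {φ φ' : Eu m → M} {u : Eu m} (h : φ =ᶠ[𝓝 u] φ') : dM (n := n) φ u = dM φ' u :=
  h.mfderiv_eq

lemma dM_comp {l : ℕ} {φ : Eu m → M} {F : Eu l → Eu m}
    {u : Eu l} (hφ : MDifferentiableAt 𝓘(ℝ, Eu m) (𝓡 n) φ (F u)) (hF : DifferentiableAt ℝ F u) :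
    dM (n := n) (φ ∘ F) u = (dM (n := n) φ (F u)).comp (fderiv ℝ F u) := by
  have h := mfderiv_comp u hφ hF.mdifferentiableAt
  rw [mfderiv_eq_fderiv] at h
  exact h

section Charts

variable (p : M)

lemma contMDiffOn_chart_symm :
    ContMDiffOn 𝓘(ℝ, Eu n) (𝓡 n) ∞ (extChartAt (𝓡 n) p).symm (extChartAt (𝓡 n) p).target :=
  contMDiffOn_extChartAt_symm p

lemma target_mem_nhds {y : Eu n} (hy : y ∈ (extChartAt (𝓡 n) p).target) :
    (extChartAt (𝓡 n) p).target ∈ 𝓝 y :=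
  (isOpen_extChartAt_target p).mem_nhds hy

lemma mdifferentiableAt_chart_symm {y : Eu n} (hy : y ∈ (extChartAt (𝓡 n) p).target) :
    MDifferentiableAt 𝓘(ℝ, Eu n) (𝓡 n) (extChartAt (𝓡 n) p).symm y :=
  ((contMDiffOn_chart_symm p).contMDiffAt (target_mem_nhds p hy)).mdifferentiableAt (by simp)

lemma injective_dM_chart_symm {y : Eu n} (hy : y ∈ (extChartAt (𝓡 n) p).target) :
    Function.Injective (dM (n := n) (extChartAt (𝓡 n) p).symm y) := by
  have : IsManifold (𝓡 n) 1 M := IsManifold.of_le (n := ∞) (by simp)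
  have h := isInvertible_mfderivWithin_extChartAt_symm (I := 𝓡 n) hy
  have h2 := h.injective
  simp only [modelWithCornersSelf_coe, range_id, mfderivWithin_univ] at h2
  exact h2

lemma isInnerForm_metricCoord {y : Eu n} (hy : y ∈ (extChartAt (𝓡 n) p).target) :
    IsInnerForm (matB (metricCoord (n := n) p y)) := by
  rw [metricCoord_eq_pb]
  exact isInnerForm_pb (injective_dM_chart_symm p hy)

lemma metricCoord_symm (z : Eu n) (i j : Fin n) :
    metricCoord (n := n) p z i j = metricCoord p z j i := by
  rw [metricCoord_eq_pb]; exact pb_symm _ _ _ _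

lemma dM_chart_symm_self : dM (n := n) (extChartAt (𝓡 n) p).symm (extChartAt (𝓡 n) p p)
    = ContinuousLinearMap.id ℝ (Eu n) := by
  have : IsManifold (𝓡 n) 1 M := IsManifold.of_le (n := ∞) (by simp)
  have h := mfderivWithin_range_extChartAt_symm (I := 𝓡 n) (x := p)
  simp only [modelWithCornersSelf_coe, range_id, mfderivWithin_univ] at h
  exact h

variable [IsContMDiffRiemannianBundle (𝓡 n) ∞ (Eu n) (fun x : M => TangentSpace (𝓡 n) x)]

lemma contDiffAt_metricCoord {y : Eu n} (hy : y ∈ (extChartAt (𝓡 n) p).target) (i j : Fin n) :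
    ContDiffAt ℝ ∞ (fun z => metricCoord (n := n) p z i j) y := by
  have hop := isOpen_extChartAt_target (I := 𝓡 n) p
  have h1 := (contMDiffOn_chart_symm p).contMDiffOn_tangentMapWithin (m := ∞) (by simp)
    hop.uniqueMDiffOn
  have h2 : ∀ i : Fin n, ContMDiffAt 𝓘(ℝ, Eu n) ((𝓡 n).prod 𝓘(ℝ, Eu n)) ∞
      (fun u => (⟨(extChartAt (𝓡 n) p).symm u,
        mfderiv 𝓘(ℝ, Eu n) (𝓡 n) (extChartAt (𝓡 n) p).symm u (sb i)⟩ : TangentBundle (𝓡 n) M)) y := by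
    intro i
    have h3 : ContMDiffAt 𝓘(ℝ, Eu n) 𝓘(ℝ, Eu n).tangent ∞
        (fun u : Eu n => (⟨u, sb i⟩ : TangentBundle 𝓘(ℝ, Eu n) (Eu n))) y :=
      contMDiffAt_vectorSpace_iff_contDiffAt.2 contDiffAt_const
    have h4 := (h1.contMDiffAt (x := (⟨y, sb i⟩ : TangentBundle 𝓘(ℝ, Eu n) (Eu n)))
      ((FiberBundle.continuous_proj (Eu n) (TangentSpace 𝓘(ℝ, Eu n))).continuousAt.preimage_mem_nhds
        (hop.mem_nhds hy))).comp y h3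
    refine h4.congr_of_eventuallyEq ?_
    filter_upwards [hop.mem_nhds hy] with u hu
    simp only [Function.comp, tangentMapWithin]
    rw [mfderivWithin_of_isOpen hop hu]
  have h5 := (h2 i).inner_bundle (h2 j)
  exact h5.contDiffAt

lemma det_metricCoord_ne_zero {y : Eu n} (hy : y ∈ (extChartAt (𝓡 n) p).target) :
    (metricCoord (n := n) p y).det ≠ 0 :=
  (posDef_of_isInnerForm (isInnerForm_metricCoord p hy)).det_pos.ne'

lemma differentiableAt_metricCoord {y : Eu n} (hy : y ∈ (extChartAt (𝓡 n) p).target) :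
    DifferentiableAt ℝ (fun z => matB (metricCoord (n := n) p z)) y :=
  (contDiffAt_matB (contDiffAt_metricCoord p hy)).differentiableAt (by simp)

lemma isChristoffelAt_metricCoord {y : Eu n} (hy : y ∈ (extChartAt (𝓡 n) p).target) :
    IsChristoffelAt (fun z => matB (metricCoord (n := n) p z)) (chrMap (metricCoord p) y) y :=
  isChristoffelAt_chrMap (metricCoord_symm p)
    (fun i j => (contDiffAt_metricCoord p hy i j).of_le (by simp)) (det_metricCoord_ne_zero p hy)

lemma contDiffAt_chrMap_metricCoord {y : Eu n} (hy : y ∈ (extChartAt (𝓡 n) p).target) :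
    ContDiffAt ℝ ∞ (chrMap (metricCoord (n := n) p)) y :=
  contDiffAt_chrMap (contDiffAt_metricCoord p hy) (det_metricCoord_ne_zero p hy)

end Charts

section IntoChart

variable {φ : Eu m → M} {u : Eu m} (q : M)

lemma contDiffAt_chart_comp (hφ : ContMDiffAt 𝓘(ℝ, Eu m) (𝓡 n) ∞ φ u)
    (hq : φ u ∈ (extChartAt (𝓡 n) q).source) :
    ContDiffAt ℝ ∞ (fun z => extChartAt (𝓡 n) q (φ z)) u := by
  rw [extChartAt_source] at hq
  exact ((contMDiffAt_extChartAt' hq).comp u hφ).contDiffAt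

lemma eventually_mem_source (hφ : ContinuousAt φ u) (hq : φ u ∈ (extChartAt (𝓡 n) q).source) :
    ∀ᶠ z in 𝓝 u, φ z ∈ (extChartAt (𝓡 n) q).source :=
  hφ.eventually ((isOpen_extChartAt_source q).mem_nhds hq)

lemma dM_eq_comp (hφ : ContMDiffAt 𝓘(ℝ, Eu m) (𝓡 n) ∞ φ u)
    (hq : φ u ∈ (extChartAt (𝓡 n) q).source) :
    dM (n := n) φ u = (dM (n := n) (extChartAt (𝓡 n) q).symm (extChartAt (𝓡 n) q (φ u))).comp
      (fderiv ℝ (fun z => extChartAt (𝓡 n) q (φ z)) u) := by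
  have h1 : φ =ᶠ[𝓝 u] (extChartAt (𝓡 n) q).symm ∘ (fun z => extChartAt (𝓡 n) q (φ z)) := by
    filter_upwards [eventually_mem_source q hφ.continuousAt hq] with z hz
    exact ((extChartAt (𝓡 n) q).left_inv hz).symm
  rw [dM_congr h1, dM_comp]
  · exact mdifferentiableAt_chart_symm q ((extChartAt (𝓡 n) q).map_source hq)
  · exact (contDiffAt_chart_comp q hφ hq).differentiableAt (by simp)

/-- The pulled back metric computed in a chart. -/
lemma matB_pb_eq (hφ : ContMDiffAt 𝓘(ℝ, Eu m) (𝓡 n) ∞ φ u)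
    (hq : φ u ∈ (extChartAt (𝓡 n) q).source) (a b : Eu m) :
    matB (pb (n := n) φ u) a b = matB (metricCoord q (extChartAt (𝓡 n) q (φ u)))
      (fderiv ℝ (fun z => extChartAt (𝓡 n) q (φ z)) u a)
      (fderiv ℝ (fun z => extChartAt (𝓡 n) q (φ z)) u b) := by
  rw [metricCoord_eq_pb, matB_pb, matB_pb, dM_eq_comp q hφ hq, (extChartAt (𝓡 n) q).left_inv hq]
  rfl

variable [IsContMDiffRiemannianBundle (𝓡 n) ∞ (Eu n) (fun x : M => TangentSpace (𝓡 n) x)]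

lemma eventually_matB_pb_eq (hφ : ∀ᶠ z in 𝓝 u, ContMDiffAt 𝓘(ℝ, Eu m) (𝓡 n) ∞ φ z)
    (hq : φ u ∈ (extChartAt (𝓡 n) q).source) :
    ∀ᶠ z in 𝓝 u, ∀ a b, matB (pb (n := n) φ z) a b
      = matB (metricCoord q (extChartAt (𝓡 n) q (φ z)))
      (fderiv ℝ (fun z => extChartAt (𝓡 n) q (φ z)) z a)
      (fderiv ℝ (fun z => extChartAt (𝓡 n) q (φ z)) z b) := by
  filter_upwards [hφ, eventually_mem_source q hφ.self_of_nhds.continuousAt hq] with z h1 h2 a b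
  exact matB_pb_eq q h1 h2 a b

lemma contDiffAt_pb (hφ : ∀ᶠ z in 𝓝 u, ContMDiffAt 𝓘(ℝ, Eu m) (𝓡 n) ∞ φ z) (i j : Fin m) :
    ContDiffAt ℝ ∞ (fun z => pb (n := n) φ z i j) u := by
  have hq : φ u ∈ (extChartAt (𝓡 n) (φ u)).source := mem_extChartAt_source (φ u)
  have hF := contDiffAt_chart_comp (φ u) hφ.self_of_nhds hq
  have hdF := hF.fderiv_right (m := ∞) (by simp)
  have hB := contDiffAt_matB (contDiffAt_metricCoord (φ u) ((extChartAt (𝓡 n) (φ u)).map_source hq))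
  have hBF := hB.comp u hF
  have h := (hBF.clm_apply (hdF.clm_apply (contDiffAt_const (c := sb i)))).clm_apply
    (hdF.clm_apply (contDiffAt_const (c := sb j)))
  refine h.congr_of_eventuallyEq ?_
  filter_upwards [eventually_matB_pb_eq (φ u) hφ hq] with z hz
  rw [← matB_sb (pb (n := n) φ z), hz]
  rfl

end IntoChart

end MetricCoordinates

/-! ### Geodesics -/

section Geodesics

set_option linter.unusedSectionVars false

variable {n : ℕ} {M : Type*} [EMetricSpace M] [ChartedSpace (Eu n) M] [IsManifold (𝓡 n) ∞ M]
  [RiemannianBundle (fun x : M => TangentSpace (𝓡 n) x)]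

lemma contDiffAt_chart_curve {γ : ℝ → M} (hγ : ContMDiff 𝓘(ℝ, ℝ) (𝓡 n) ∞ γ) (q : M) {t : ℝ}
    (hq : γ t ∈ (extChartAt (𝓡 n) q).source) :
    ContDiffAt ℝ ∞ (fun s => extChartAt (𝓡 n) q (γ s)) t := by
  rw [extChartAt_source] at hq
  exact ((contMDiffAt_extChartAt' hq).comp t (hγ t)).contDiffAt

lemma velocity_eq_deriv {γ : ℝ → M} (hγ : ContMDiff 𝓘(ℝ, ℝ) (𝓡 n) ∞ γ) (t : ℝ) :
    (mfderiv 𝓘(ℝ, ℝ) (𝓡 n) γ t (1 : ℝ) : Eu n)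
      = deriv (fun s => extChartAt (𝓡 n) (γ t) (γ s)) t := by
  have : IsManifold (𝓡 n) 1 M := IsManifold.of_le (n := ∞) (by simp)
  have h1 := mfderiv_comp (I'' := 𝓘(ℝ, Eu n)) t
    (mdifferentiableAt_extChartAt (I := 𝓡 n) (mem_chart_source (Eu n) (γ t)))
    ((hγ t).mdifferentiableAt (by simp))
  rw [mfderiv_extChartAt_self, mfderiv_eq_fderiv] at h1
  have h2 := congrArg (fun L => L (1 : ℝ)) h1
  exact h2.symm

lemma contDiffAt_deriv {c : ℝ → Eu n} {t : ℝ} (hc : ContDiffAt ℝ ∞ c t) :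
    ContDiffAt ℝ ∞ (deriv c) t :=
  (hc.fderiv_right (m := ∞) (by simp)).clm_apply contDiffAt_const

/-- The geodesic equation in a chart. -/
lemma IsGeodesic.equation {γ : ℝ → M} (hγ : IsGeodesic (n := n) γ) (q : M) {t : ℝ}
    (hq : γ t ∈ (extChartAt (𝓡 n) q).source) :
    deriv (deriv fun s => extChartAt (𝓡 n) q (γ s)) t
      = -chrMap (metricCoord q) (extChartAt (𝓡 n) q (γ t))
        (deriv (fun s => extChartAt (𝓡 n) q (γ s)) t)
        (deriv (fun s => extChartAt (𝓡 n) q (γ s)) t) := by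
  rw [extChartAt_source] at hq
  ext k
  rw [PiLp.neg_apply, chrMap_apply, eq_neg_iff_add_eq_zero]
  exact hγ.2 q t hq k

variable [IsContMDiffRiemannianBundle (𝓡 n) ∞ (Eu n) (fun x : M => TangentSpace (𝓡 n) x)]

/-- Geodesics with the same position and velocity at one time agree nearby. -/
lemma IsGeodesic.eventuallyEq {γ₁ γ₂ : ℝ → M} (h₁ : IsGeodesic (n := n) γ₁)
    (h₂ : IsGeodesic (n := n) γ₂) {t : ℝ} {q : M} (hq : γ₁ t ∈ (extChartAt (𝓡 n) q).source)
    (h0 : γ₁ t = γ₂ t)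
    (h1 : deriv (fun s => extChartAt (𝓡 n) q (γ₁ s)) t
      = deriv (fun s => extChartAt (𝓡 n) q (γ₂ s)) t) : γ₁ =ᶠ[𝓝 t] γ₂ := by
  have hq2 : γ₂ t ∈ (extChartAt (𝓡 n) q).source := h0 ▸ hq
  set φ := extChartAt (𝓡 n) q
  let V : Eu n × Eu n → Eu n × Eu n := fun z => (z.2, -chrMap (metricCoord q) z.1 z.2 z.2)
  have key : ∀ γ : ℝ → M, IsGeodesic (n := n) γ → γ t ∈ φ.source → ∀ s ∈ 𝓝 (φ (γ t),
      deriv (fun s => φ (γ s)) t), ∀ᶠ r in 𝓝 t,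
      HasDerivAt (fun r => (φ (γ r), deriv (fun s => φ (γ s)) r))
        (V (φ (γ r), deriv (fun s => φ (γ s)) r)) r ∧ (φ (γ r), deriv (fun s => φ (γ s)) r) ∈ s := by
    intro γ hγ hγq s hs
    have hc := contDiffAt_chart_curve hγ.1 q hγq
    have hcont : ContinuousAt (fun r => (φ (γ r), deriv (fun s => φ (γ s)) r)) t :=
      hc.continuousAt.prodMk (contDiffAt_deriv hc).continuousAt
    have hsrc : ∀ᶠ r in 𝓝 t, γ r ∈ φ.source :=
      (hγ.1 t).continuousAt.eventually ((isOpen_extChartAt_source q).mem_nhds hγq)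
    filter_upwards [hsrc, hcont.eventually_mem hs] with r hr hrs
    refine ⟨?_, hrs⟩
    have hcr := contDiffAt_chart_curve hγ.1 q hr
    have e1 := (hcr.differentiableAt (by simp)).hasDerivAt
    have e2 := ((contDiffAt_deriv hcr).differentiableAt (by simp)).hasDerivAt
    rw [hγ.equation q hr] at e2
    exact e1.prodMk e2
  have hy := φ.map_source hq
  have hV : ContDiffAt ℝ 1 V (φ (γ₁ t), deriv (fun s => φ (γ₁ s)) t) := by
    have hΓ : ContDiffAt ℝ 1 (chrMap (metricCoord (n := n) q)) (φ (γ₁ t)) :=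
      (contDiffAt_chrMap_metricCoord q hy).of_le (by simp)
    have hΓ2 : ContDiffAt ℝ 1 (fun z : Eu n × Eu n => chrMap (metricCoord (n := n) q) z.1)
        (φ (γ₁ t), deriv (fun s => φ (γ₁ s)) t) :=
      ContDiffAt.comp (g := chrMap (metricCoord (n := n) q)) (f := Prod.fst) _ hΓ contDiffAt_fst
    exact contDiffAt_snd.prodMk
      ((hΓ2.clm_apply contDiffAt_snd).clm_apply contDiffAt_snd).neg
  obtain ⟨K, s, hs, hlip⟩ := hV.exists_lipschitzOnWith
  have hode := ODE_solution_unique_of_eventually (v := fun _ => V) (s := fun _ => s) (K := K)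
    (Eventually.of_forall fun _ => hlip) (key γ₁ h₁ hq s hs)
    (key γ₂ h₂ hq2 s (by rw [← h0, ← h1]; exact hs)) (by rw [← h0, ← h1])
  filter_upwards [hode, (h₁.1 t).continuousAt.eventually ((isOpen_extChartAt_source q).mem_nhds hq),
    (h₂.1 t).continuousAt.eventually ((isOpen_extChartAt_source q).mem_nhds hq2)] with r hr k1 k2
  exact φ.injOn k1 k2 (congrArg Prod.fst hr)

/-- Uniqueness of geodesics with given initial data. -/
lemma IsGeodesic.unique {γ₁ γ₂ : ℝ → M} (h₁ : IsGeodesic (n := n) γ₁)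
    (h₂ : IsGeodesic (n := n) γ₂) (h0 : γ₁ 0 = γ₂ 0)
    (h1 : (mfderiv 𝓘(ℝ, ℝ) (𝓡 n) γ₁ 0 (1 : ℝ) : Eu n)
      = (mfderiv 𝓘(ℝ, ℝ) (𝓡 n) γ₂ 0 (1 : ℝ) : Eu n)) : γ₁ = γ₂ := by
  let Z : Set ℝ := {t | γ₁ =ᶠ[𝓝 t] γ₂}
  have hopen : IsOpen Z := isOpen_iff_mem_nhds.2 fun t ht => eventually_eventually_nhds.2 ht
  have hclosed : IsClosed Z := by
    rw [← closure_subset_iff_isClosed]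
    intro t ht
    have hfr := mem_closure_iff_frequently.1 ht
    have e0 : γ₁ t = γ₂ t := tendsto_nhds_unique_of_frequently_eq (h₁.1 t).continuousAt.tendsto
      (h₂.1 t).continuousAt.tendsto (hfr.mono fun s hs => hs.self_of_nhds)
    have hq : γ₁ t ∈ (extChartAt (𝓡 n) (γ₁ t)).source := mem_extChartAt_source _
    have hq2 : γ₂ t ∈ (extChartAt (𝓡 n) (γ₁ t)).source := e0 ▸ hq
    refine h₁.eventuallyEq h₂ hq e0 ?_
    refine tendsto_nhds_unique_of_frequently_eq
      (contDiffAt_deriv (contDiffAt_chart_curve h₁.1 _ hq)).continuousAt.tendsto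
      (contDiffAt_deriv (contDiffAt_chart_curve h₂.1 _ hq2)).continuousAt.tendsto
      (hfr.mono fun s hs => ?_)
    apply Filter.EventuallyEq.deriv_eq
    filter_upwards [hs] with r hr
    rw [hr]
  have hZ : (0 : ℝ) ∈ Z := by
    refine h₁.eventuallyEq h₂ (mem_extChartAt_source (γ₁ 0)) h0 ?_
    rw [← velocity_eq_deriv h₁.1, h1, velocity_eq_deriv h₂.1, h0]
  have huniv : Z = univ := IsClopen.eq_univ ⟨hclosed, hopen⟩ ⟨0, hZ⟩
  funext t
  have : t ∈ Z := huniv ▸ mem_univ t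
  exact Filter.EventuallyEq.eq_of_nhds this

lemma isGeodesic_const (p : M) : IsGeodesic (n := n) (fun _ : ℝ => p) := by
  refine ⟨contMDiff_const, fun q t _ => ?_⟩
  intro c k
  simp [c]

lemma IsGeodesic.comp_mul {γ : ℝ → M} (hγ : IsGeodesic (n := n) γ) (a : ℝ) :
    IsGeodesic (n := n) (fun t => γ (a * t)) := by
  have hm : ContMDiff 𝓘(ℝ, ℝ) 𝓘(ℝ, ℝ) ∞ (fun t : ℝ => a * t) :=
    (contDiff_const.mul contDiff_id).contMDiff
  refine ⟨hγ.1.comp hm, fun q t ht => ?_⟩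
  intro c k
  have h := hγ.2 q (a * t) ht k
  have e1 : deriv c = fun t => a • deriv (fun s => extChartAt (𝓡 n) q (γ s)) (a * t) := by
    funext t
    exact deriv_comp_mul_left a (fun s => extChartAt (𝓡 n) q (γ s)) t
  have hd := ((contDiffAt_deriv (contDiffAt_chart_curve hγ.1 q
    (by rw [extChartAt_source]; exact ht))).differentiableAt (by simp)).hasDerivAt
  have e2 : deriv (deriv c) t
      = a • a • deriv (deriv (fun s => extChartAt (𝓡 n) q (γ s))) (a * t) := by
    have hm' : HasDerivAt (fun t : ℝ => a * t) a t := by simpa using (hasDerivAt_id t).const_mul a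
    rw [e1]
    exact ((hd.scomp t hm').const_smul a).deriv
  rw [e2, e1]
  simp only [PiLp.smul_apply, smul_eq_mul]
  simp only at h
  have e3 : ∑ i, ∑ j, christoffel (metricCoord q) (c t) k i j
      * (a * deriv (fun s => extChartAt (𝓡 n) q (γ s)) (a * t) i)
      * (a * deriv (fun s => extChartAt (𝓡 n) q (γ s)) (a * t) j)
      = a * a * ∑ i, ∑ j, christoffel (metricCoord q) (c t) k i j
      * deriv (fun s => extChartAt (𝓡 n) q (γ s)) (a * t) i
      * deriv (fun s => extChartAt (𝓡 n) q (γ s)) (a * t) j := by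
    simp only [Finset.mul_sum]
    exact Finset.sum_congr rfl fun i _ => Finset.sum_congr rfl fun j _ => by ring
  rw [e3]
  linear_combination (a * a) * h

lemma velocity_comp_mul {γ : ℝ → M} (hγ : IsGeodesic (n := n) γ) (a : ℝ) :
    (mfderiv 𝓘(ℝ, ℝ) (𝓡 n) (fun t => γ (a * t)) 0 (1 : ℝ) : Eu n)
      = a • (mfderiv 𝓘(ℝ, ℝ) (𝓡 n) γ 0 (1 : ℝ) : Eu n) := by
  rw [velocity_eq_deriv (hγ.comp_mul a).1, velocity_eq_deriv hγ.1]
  have h := deriv_comp_mul_left a (fun s => extChartAt (𝓡 n) (γ 0) (γ s)) 0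
  rw [mul_zero] at h
  rw [mul_zero]
  exact h

lemma expMap_eq {γ : ℝ → M} (hγ : IsGeodesic (n := n) γ) {p : M} {v : Eu n} (h0 : γ 0 = p)
    (h1 : (mfderiv 𝓘(ℝ, ℝ) (𝓡 n) γ 0 (1 : ℝ) : Eu n) = v) : expMap p v = γ 1 := by
  have h : ∃ γ : ℝ → M, IsGeodesic (n := n) γ ∧ γ 0 = p ∧
      (mfderiv 𝓘(ℝ, ℝ) (𝓡 n) γ 0 (1 : ℝ) : Eu n) = v := ⟨γ, hγ, h0, h1⟩
  rw [expMap, dif_pos h]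
  obtain ⟨k1, k2, k3⟩ := h.choose_spec
  rw [k1.unique hγ (k2.trans h0.symm) (k3.trans h1.symm)]

lemma expMap_zero (p : M) : expMap p (0 : Eu n) = p := by
  refine expMap_eq (isGeodesic_const p) rfl ?_
  rw [velocity_eq_deriv (isGeodesic_const p).1]
  simp only [deriv_const]
  rfl

lemma expMap_smul {γ : ℝ → M} (hγ : IsGeodesic (n := n) γ) {p : M} {v : Eu n} (h0 : γ 0 = p)
    (h1 : (mfderiv 𝓘(ℝ, ℝ) (𝓡 n) γ 0 (1 : ℝ) : Eu n) = v) (s : ℝ) : expMap p (s • v) = γ s := by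
  have h := expMap_eq (hγ.comp_mul s) (p := p) (v := s • v) (by simp [h0])
    ((velocity_comp_mul hγ s).trans (congrArg (s • ·) h1))
  simpa using h

/-- Where the exponential map is injective, all geodesics exist: the exponential map takes the
value `p` at vectors that do not generate one, and it takes this value at the origin. -/
lemma exists_geodesic_of_injOn {p : M} {D : Set (Eu n)} (h0 : 0 ∈ D)
    (hinj : InjOn (expMap (n := n) p) D) {v : Eu n} (hv : v ∈ D) :
    ∃ γ : ℝ → M, IsGeodesic (n := n) γ ∧ γ 0 = p ∧
      (mfderiv 𝓘(ℝ, ℝ) (𝓡 n) γ 0 (1 : ℝ) : Eu n) = v := by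
  by_contra h
  have h1 : expMap p v = p := by rw [expMap, dif_neg h]
  have h2 : v = 0 := hinj hv h0 (h1.trans (expMap_zero p).symm)
  subst h2
  refine h ⟨fun _ => p, isGeodesic_const p, rfl, ?_⟩
  rw [velocity_eq_deriv (isGeodesic_const p).1]
  simp only [deriv_const]
  rfl

/-! ### Normal coordinates -/

/-- The ball of radius `ρ` around the origin of the tangent space at `p`, as a set in `ℝⁿ`. -/
def nball (p : M) (ρ : ℝ) : Set (Eu n) := {v | ipM p v v < ρ ^ 2}

/-- The exponential map is a diffeomorphism from the ball of radius `ρ`. -/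
structure IsNormalRadius (p : M) (ρ : ℝ) : Prop where
  pos : 0 < ρ
  diffeo : ∀ v ∈ nball (n := n) p ρ, IsLocalDiffeomorphAt 𝓘(ℝ, Eu n) (𝓡 n) ∞ (expMap (n := n) p) v
  inj : InjOn (expMap (n := n) p) (nball (n := n) p ρ)

lemma enorm_tangent_lt {p : M} {ρ : ℝ} (h0 : 0 < ρ) (v : TangentSpace (𝓡 n) p)
    (hv : ipT (n := n) p v v < ρ ^ 2) : ‖v‖ₑ < ENNReal.ofReal ρ := by
  rw [← ofReal_norm]
  refine (ENNReal.ofReal_lt_ofReal_iff h0).2 ?_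
  rw [norm_eq_sqrt_real_inner, Real.sqrt_lt' h0]
  exact hv

lemma isNormalRadius_of_lt {p : M} {ρ : ℝ} (h0 : 0 < ρ)
    (h : ENNReal.ofReal ρ < injRadius n p) : IsNormalRadius (n := n) p ρ := by
  obtain ⟨r, ⟨hr1, hr2⟩, hr⟩ := lt_sSup_iff.1 h
  have hsub : ∀ v ∈ nball (n := n) p ρ, v ∈ tangentBall (n := n) p r := by
    intro v hv
    have hv' : ipT (n := n) p v v < ρ ^ 2 := by rw [← ipM_apply]; exact hv
    exact (enorm_tangent_lt h0 v hv').trans hr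
  exact ⟨h0, fun v hv => hr1 ⟨v, hsub v hv⟩, fun v hv w hw e => hr2 (hsub v hv) (hsub w hw) e⟩

lemma zero_mem_nball (p : M) {ρ : ℝ} (hρ : 0 < ρ) : (0 : Eu n) ∈ nball p ρ := by
  simp only [nball, mem_ofPred_eq, map_zero]
  positivity

lemma isOpen_nball (p : M) (ρ : ℝ) : IsOpen (nball (n := n) p ρ) := by
  refine isOpen_lt ?_ continuous_const
  fun_prop

lemma smul_mem_nball {p : M} {ρ : ℝ} {v : Eu n} (hv : v ∈ nball p ρ) {s : ℝ}
    (hs : s ∈ Icc (0 : ℝ) 1) : s • v ∈ nball p ρ := by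
  have h := (isInnerForm_ipM (n := n) p).nonneg v
  simp only [nball, mem_ofPred_eq, map_smul, smul_apply, smul_eq_mul] at *
  have : s * (s * ipM p v v) ≤ 1 * (1 * ipM p v v) := by
    gcongr
    · have := hs.1
      positivity
    · exact hs.2
    · exact hs.2
  linarith

namespace IsNormalRadius

variable {p : M} {ρ : ℝ}

lemma bijective_dM (h : IsNormalRadius (n := n) p ρ) {v : Eu n} (hv : v ∈ nball p ρ) :
    Function.Bijective (dM (n := n) (expMap (n := n) p) v) :=
  ((h.diffeo v hv).mfderivToContinuousLinearEquiv (by simp)).bijective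

lemma eventually_contMDiffAt (h : IsNormalRadius (n := n) p ρ) {v : Eu n} (hv : v ∈ nball p ρ) :
    ∀ᶠ z in 𝓝 v, ContMDiffAt 𝓘(ℝ, Eu n) (𝓡 n) ∞ (expMap (n := n) p) z := by
  filter_upwards [(isOpen_nball p ρ).mem_nhds hv] with z hz
  exact (h.diffeo z hz).contMDiffAt

lemma bijective_fderiv_chart (h : IsNormalRadius (n := n) p ρ) {v : Eu n} (hv : v ∈ nball p ρ)
    {q : M} (hq : expMap p v ∈ (extChartAt (𝓡 n) q).source) :
    Function.Bijective (fderiv ℝ (fun z => extChartAt (𝓡 n) q (expMap p z)) v) := by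
  have h1 := h.bijective_dM hv
  rw [dM_eq_comp q (h.diffeo v hv).contMDiffAt hq] at h1
  have h2 : Function.Injective
      (fderiv ℝ (fun z => extChartAt (𝓡 n) q (expMap p z)) v) := fun a b hab =>
    h1.1 (by simp only [ContinuousLinearMap.comp_apply, hab])
  exact ⟨h2, LinearMap.injective_iff_surjective.1 h2⟩

end IsNormalRadius

end Geodesics

/-! ### The metric in normal coordinates -/

section NormalCoordinates

set_option linter.unusedSectionVars false

variable {n : ℕ} {M : Type*} [EMetricSpace M] [ChartedSpace (Eu n) M] [IsManifold (𝓡 n) ∞ M]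
  [RiemannianBundle (fun x : M => TangentSpace (𝓡 n) x)]
  [IsContMDiffRiemannianBundle (𝓡 n) ∞ (Eu n) (fun x : M => TangentSpace (𝓡 n) x)]

/-- The metric in normal coordinates around `p`. -/
def nmet (p : M) (y : Eu n) : Eu n →L[ℝ] Eu n →L[ℝ] ℝ := matB (pb (n := n) (expMap (n := n) p) y)

/-- The Christoffel maps in normal coordinates around `p`. -/
def nchr (p : M) : Eu n → Eu n →L[ℝ] Eu n →L[ℝ] Eu n := chrMap (pb (n := n) (expMap (n := n) p))

/-- The exponential map at `p` in the chart around `q`. -/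
abbrev chexp (p q : M) : Eu n → Eu n := fun z => extChartAt (𝓡 n) q (expMap p z)

lemma nmet_symm (p : M) (z a b : Eu n) : nmet p z a b = nmet p z b a :=
  matB_symm (pb_symm _ _) a b

namespace IsNormalRadius

variable {p : M} {ρ : ℝ}

lemma isInnerForm_nmet (h : IsNormalRadius (n := n) p ρ) {v : Eu n} (hv : v ∈ nball p ρ) :
    IsInnerForm (nmet p v) :=
  isInnerForm_pb (h.bijective_dM hv).1

lemma contDiffAt_pb_exp (h : IsNormalRadius (n := n) p ρ) {v : Eu n} (hv : v ∈ nball p ρ)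
    (i j : Fin n) : ContDiffAt ℝ ∞ (fun z => pb (n := n) (expMap (n := n) p) z i j) v :=
  contDiffAt_pb (h.eventually_contMDiffAt hv) i j

lemma differentiableAt_nmet (h : IsNormalRadius (n := n) p ρ) {v : Eu n} (hv : v ∈ nball p ρ) :
    DifferentiableAt ℝ (nmet (n := n) p) v :=
  (contDiffAt_matB (h.contDiffAt_pb_exp hv)).differentiableAt (by simp)

lemma det_pb_exp_ne_zero (h : IsNormalRadius (n := n) p ρ) {v : Eu n} (hv : v ∈ nball p ρ) :
    (pb (n := n) (expMap (n := n) p) v).det ≠ 0 :=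
  (posDef_of_isInnerForm (h.isInnerForm_nmet hv)).det_pos.ne'

lemma differentiableAt_nchr (h : IsNormalRadius (n := n) p ρ) {v : Eu n} (hv : v ∈ nball p ρ) :
    DifferentiableAt ℝ (nchr (n := n) p) v :=
  (contDiffAt_chrMap (h.contDiffAt_pb_exp hv) (h.det_pb_exp_ne_zero hv)).differentiableAt (by simp)

lemma isChristoffelAt_nchr (h : IsNormalRadius (n := n) p ρ) {v : Eu n} (hv : v ∈ nball p ρ) :
    IsChristoffelAt (nmet (n := n) p) (nchr p v) v :=
  isChristoffelAt_chrMap (pb_symm _)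
    (fun i j => (h.contDiffAt_pb_exp hv i j).of_le (by simp)) (h.det_pb_exp_ne_zero hv)

lemma contDiffAt_chexp (h : IsNormalRadius (n := n) p ρ) {v : Eu n} (hv : v ∈ nball p ρ)
    {q : M} (hq : expMap p v ∈ (extChartAt (𝓡 n) q).source) :
    ContDiffAt ℝ ∞ (chexp p q) v :=
  contDiffAt_chart_comp q (h.diffeo v hv).contMDiffAt hq

lemma nmet_eq (h : IsNormalRadius (n := n) p ρ) {v : Eu n} (hv : v ∈ nball p ρ)
    {q : M} (hq : expMap p v ∈ (extChartAt (𝓡 n) q).source) (a b : Eu n) :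
    nmet p v a b = matB (metricCoord q (chexp p q v)) (fderiv ℝ (chexp p q) v a)
      (fderiv ℝ (chexp p q) v b) :=
  matB_pb_eq q (h.diffeo v hv).contMDiffAt hq a b

/-- The transformation law between normal coordinates and a chart. -/
lemma nchr_transform (h : IsNormalRadius (n := n) p ρ) {v : Eu n} (hv : v ∈ nball p ρ)
    {q : M} (hq : expMap p v ∈ (extChartAt (𝓡 n) q).source) (a b : Eu n) :
    fderiv ℝ (fderiv ℝ (chexp p q)) v a b
      + chrMap (metricCoord q) (chexp p q v) (fderiv ℝ (chexp p q) v a) (fderiv ℝ (chexp p q) v b)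
      = fderiv ℝ (chexp p q) v (nchr p v a b) := by
  have hy := (extChartAt (𝓡 n) q).map_source hq
  refine christoffel_transform (G := fun z => matB (metricCoord q z)) (h := nmet p)
    (fun z => matB_symm (metricCoord_symm q z)) ((h.contDiffAt_chexp hv hq).of_le (WithTop.coe_le_coe.2 le_top))
    (differentiableAt_metricCoord q hy) (h.differentiableAt_nmet hv) ?_
    (isChristoffelAt_metricCoord q hy) (h.isChristoffelAt_nchr hv)
    (isInnerForm_metricCoord q hy).nondegenerate (h.bijective_fderiv_chart hv hq).2 a b
  exact eventually_matB_pb_eq q (h.eventually_contMDiffAt hv) hq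

lemma exists_geodesic (h : IsNormalRadius (n := n) p ρ) {v : Eu n} (hv : v ∈ nball p ρ) :
    ∃ γ : ℝ → M, IsGeodesic (n := n) γ ∧ ∀ s, expMap p (s • v) = γ s := by
  obtain ⟨γ, h1, h2, h3⟩ := exists_geodesic_of_injOn (zero_mem_nball p h.pos) h.inj hv
  exact ⟨γ, h1, expMap_smul h1 h2 h3⟩

/-- Rays are geodesics in normal coordinates. -/
lemma nchr_ray (h : IsNormalRadius (n := n) p ρ) {v : Eu n} (hv : v ∈ nball p ρ) {s : ℝ}
    (hs : s • v ∈ nball p ρ) : nchr p (s • v) v v = 0 := by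
  obtain ⟨γ, hγ, hexp⟩ := h.exists_geodesic hv
  set q := expMap p (s • v) with hq0
  have hq : expMap p (s • v) ∈ (extChartAt (𝓡 n) q).source := mem_extChartAt_source q
  have hT := h.contDiffAt_chexp hs hq
  have hl : ∀ t : ℝ, HasDerivAt (fun t : ℝ => t • v) v t := fun t => by
    simpa using (hasDerivAt_id t).smul_const v
  have hnear : ∀ᶠ t in 𝓝 s, ContDiffAt ℝ ∞ (chexp p q) (t • v) := by
    have hc : ContinuousAt (fun t : ℝ => t • v) s := (hl s).continuousAt
    filter_upwards [hc.eventually ((isOpen_nball p ρ).mem_nhds hs),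
      hc.eventually (eventually_mem_source q (h.diffeo _ hs).contMDiffAt.continuousAt hq)]
      with t h1 h2
    exact h.contDiffAt_chexp h1 h2
  have hc : (fun t => extChartAt (𝓡 n) q (γ t)) = fun t => chexp p q (t • v) := by
    funext t; simp only [chexp, hexp]
  have hd1 : deriv (fun t => extChartAt (𝓡 n) q (γ t)) =ᶠ[𝓝 s]
      fun t => fderiv ℝ (chexp p q) (t • v) v := by
    filter_upwards [hnear] with t ht
    rw [hc]
    exact (HasFDerivAt.comp_hasDerivAt (l := chexp p q) t
      (ht.differentiableAt (by simp)).hasFDerivAt (hl t)).deriv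
  have hd2 : deriv (deriv (fun t => extChartAt (𝓡 n) q (γ t))) s
      = fderiv ℝ (fderiv ℝ (chexp p q)) (s • v) v v := by
    rw [hd1.deriv_eq]
    have e1 : HasDerivAt (fun t : ℝ => fderiv ℝ (chexp p q) (t • v))
        (fderiv ℝ (fderiv ℝ (chexp p q)) (s • v) v) s :=
      HasFDerivAt.comp_hasDerivAt (l := fderiv ℝ (chexp p q)) s
        (differentiableAt_fderiv (hT.of_le (WithTop.coe_le_coe.2 le_top))).hasFDerivAt (hl s)
    have e2 := e1.clm_apply (hasDerivAt_const s v)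
    rw [e2.deriv]; simp
  have hgeo := hγ.equation q (t := s) (by rw [← hexp]; exact hq)
  rw [hd2, hd1.self_of_nhds, ← hexp] at hgeo
  have htr := h.nchr_transform hs hq v v
  rw [hgeo, neg_add_cancel] at htr
  exact (h.bijective_fderiv_chart hs hq).1 (by rw [← htr, map_zero])

/-- The differential of the exponential map at the origin is the identity. It is computed on small
vectors, along the geodesics that they generate, and hence on all by linearity. -/
lemma dM_exp_zero (h : IsNormalRadius (n := n) p ρ) :
    dM (n := n) (expMap (n := n) p) 0 = ContinuousLinearMap.id ℝ (Eu n) := by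
  have h0 := zero_mem_nball (n := n) p h.pos
  have hq : expMap p (0 : Eu n) ∈ (extChartAt (𝓡 n) (expMap p (0 : Eu n))).source :=
    mem_extChartAt_source _
  rw [dM_eq_comp (expMap p (0 : Eu n)) (h.diffeo 0 h0).contMDiffAt hq, dM_chart_symm_self]
  have key : ∀ v ∈ nball (n := n) p ρ,
      fderiv ℝ (chexp p (expMap p (0 : Eu n))) 0 v = v := by
    intro v hv
    obtain ⟨γ, hγ, e0, e1⟩ := exists_geodesic_of_injOn h0 h.inj hv
    have hexp := expMap_smul hγ e0 e1
    have e2 : deriv (fun t => extChartAt (𝓡 n) (γ 0) (γ t)) 0 = v := by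
      rw [← velocity_eq_deriv hγ.1]; exact e1
    have hl : HasDerivAt (fun t : ℝ => t • v) v 0 := by
      simpa using (hasDerivAt_id (0 : ℝ)).smul_const v
    have hd : HasFDerivAt (chexp p (expMap p (0 : Eu n)))
        (fderiv ℝ (chexp p (expMap p (0 : Eu n))) 0) ((0 : ℝ) • v) := by
      rw [zero_smul]
      exact ((h.contDiffAt_chexp h0 hq).differentiableAt (by simp)).hasFDerivAt
    have e3 := (HasFDerivAt.comp_hasDerivAt (0 : ℝ) hd hl).deriv
    rw [← e3]
    refine Eq.trans ?_ e2
    congr 1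
    funext t
    simp only [Function.comp, chexp, hexp, expMap_zero, e0]
  ext1 v
  simp only [ContinuousLinearMap.id_comp, ContinuousLinearMap.id_apply]
  have ht : Tendsto (fun t : ℝ => t • v) (𝓝 0) (𝓝 0) := by
    have : ContinuousAt (fun t : ℝ => t • v) 0 := by fun_prop
    simpa [ContinuousAt] using this
  have h1 := (ht.eventually ((isOpen_nball (n := n) p ρ).mem_nhds h0)).filter_mono
    (nhdsWithin_le_nhds (s := {0}ᶜ))
  obtain ⟨t, ht, ht0⟩ := (h1.and self_mem_nhdsWithin).exists
  have h2 := key _ ht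
  rw [map_smul] at h2
  exact smul_right_injective _ ht0 h2

lemma nmet_zero (h : IsNormalRadius (n := n) p ρ) : nmet p (0 : Eu n) = ipM p := by
  ext a b
  rw [nmet, matB_pb, h.dM_exp_zero, expMap_zero]
  rfl

/-- The exponential map is a normal coordinate system in the sense of `IsNormalMetric`. -/
lemma isNormalMetric (h : IsNormalRadius (n := n) p ρ) {C : ℝ} (hC0 : 0 ≤ C)
    (hC : ∀ q : M, ∀ y ∈ (extChartAt (𝓡 n) q).target,
      tensorNorm (metricCoord q) (riemannTensor (metricCoord q)) y ≤ C) :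
    IsNormalMetric (nmet p) (nchr p) (nball (n := n) p ρ) C where
  isOpen := isOpen_nball p ρ
  star y hy s hs := smul_mem_nball hy hs
  symm := nmet_symm p
  inner y hy := h.isInnerForm_nmet hy
  diff y hy := h.differentiableAt_nmet hy
  diffΓ y hy := h.differentiableAt_nchr hy
  christoffel y hy := h.isChristoffelAt_nchr hy
  ray y hy s hs := h.nchr_ray hy (smul_mem_nball hy hs)
  K_nonneg := hC0
  curv_le y hy a v := by
    set q := expMap p y with hq0
    have hq : expMap p y ∈ (extChartAt (𝓡 n) q).source := mem_extChartAt_source q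
    have hyt := (extChartAt (𝓡 n) q).map_source hq
    have htr : ∀ᶠ z in 𝓝 y, ∀ a b, fderiv ℝ (fderiv ℝ (chexp p q)) z a b
        + chrMap (metricCoord q) (chexp p q z) (fderiv ℝ (chexp p q) z a)
          (fderiv ℝ (chexp p q) z b) = fderiv ℝ (chexp p q) z (nchr p z a b) := by
      filter_upwards [(isOpen_nball p ρ).mem_nhds hy,
        eventually_mem_source q (h.diffeo _ hy).contMDiffAt.continuousAt hq] with z h1 h2
      exact h.nchr_transform h1 h2
    have hΓ := (contDiffAt_chrMap_metricCoord q hyt).differentiableAt (by simp)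
    have hcurv := curv_transform ((h.contDiffAt_chexp hy hq).of_le (WithTop.coe_le_coe.2 le_top))
      hΓ (h.differentiableAt_nchr hy) htr
    have hb := curv_le_of_tensorNorm (metricCoord_symm q _) (isInnerForm_metricCoord q hyt) hΓ
      (hC q _ hyt) (fderiv ℝ (chexp p q) y a) (fderiv ℝ (chexp p q) y v)
    rw [hcurv] at hb
    rw [h.nmet_eq hy hq, h.nmet_eq hy hq, h.nmet_eq hy hq]
    exact hb

/-- Points in normal coordinates are at most as far away from the centre as their coordinates. -/
lemma edist_exp_le [IsRiemannianManifold (𝓡 n) M] (h : IsNormalRadius (n := n) p ρ) {C : ℝ}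
    (hm : IsNormalMetric (nmet p) (nchr p) (nball (n := n) p ρ) C)
    {v : Eu n} (hv : v ∈ nball p ρ) : edist p (expMap p v) ≤ ENNReal.ofReal √(ipM p v v) := by
  obtain ⟨γ, hγ, hexp⟩ := h.exists_geodesic hv
  rw [IsRiemannianManifold.out (I := 𝓡 n) p (expMap p v)]
  refine (Manifold.riemannianEDist_le_pathELength (γ := γ) (a := 0) (b := 1)
    ((hγ.1.of_le (by simp)).contMDiffOn) (by rw [← hexp, zero_smul, expMap_zero])
    (by rw [← hexp, one_smul]) zero_le_one).trans ?_
  rw [Manifold.pathELength_eq_lintegral_mfderiv_Icc]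
  have hspeed : ∀ t ∈ Icc (0 : ℝ) 1, ‖mfderiv 𝓘(ℝ, ℝ) (𝓡 n) γ t (1 : ℝ)‖ₑ
      = ENNReal.ofReal √(ipM p v v) := by
    intro t ht
    have hvel : (mfderiv 𝓘(ℝ, ℝ) (𝓡 n) γ t (1 : ℝ) : Eu n) = dM (n := n) (expMap (n := n) p) (t • v) v := by
      rw [velocity_eq_deriv hγ.1]
      have htv := smul_mem_nball hv ht
      have hq : expMap p (t • v) ∈ (extChartAt (𝓡 n) (expMap p (t • v))).source :=
        mem_extChartAt_source _
      rw [dM_eq_comp (expMap p (t • v)) (h.diffeo _ htv).contMDiffAt hq, dM_chart_symm_self]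
      have hl : HasDerivAt (fun t : ℝ => t • v) v t := by simpa using (hasDerivAt_id t).smul_const v
      have e3 := (HasFDerivAt.comp_hasDerivAt t
        ((h.contDiffAt_chexp htv hq).differentiableAt (by simp)).hasFDerivAt hl).deriv
      simp only [ContinuousLinearMap.id_comp]
      rw [← e3]
      congr 1
      funext s
      simp only [Function.comp, chexp, hexp]
    rw [← ofReal_norm, norm_eq_sqrt_real_inner]
    congr 2
    have e1 := hm.speed hv ht
    rw [h.nmet_zero, nmet, matB_pb, ← hvel, hexp, ipM_apply] at e1
    rw [ipM_apply]
    exact (ipM_apply (n := n) _ _ _).symm.trans e1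
  refine (setLIntegral_congr_fun measurableSet_Icc hspeed).le.trans ?_
  simp

/-! ### The inverse of the exponential map -/

end IsNormalRadius

/-- Normal coordinates of the points of the ball of radius `ρ` around `p`. -/
def ncoord (p : M) (ρ : ℝ) : M → Eu n := Function.invFunOn (expMap (n := n) p) (nball p ρ)

namespace IsNormalRadius

variable {p : M} {ρ : ℝ}

lemma ncoord_exp (h : IsNormalRadius (n := n) p ρ) {v : Eu n} (hv : v ∈ nball p ρ) :
    ncoord p ρ (expMap p v) = v :=
  h.inj (Function.invFunOn_mem ⟨v, hv, rfl⟩) hv (Function.invFunOn_eq ⟨v, hv, rfl⟩)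

lemma eventually_exp_ncoord (h : IsNormalRadius (n := n) p ρ) {v : Eu n} (hv : v ∈ nball p ρ) :
    ∀ᶠ q in 𝓝 (expMap p v), ncoord (n := n) p ρ q = (h.diffeo v hv).localInverse q ∧
      ncoord (n := n) p ρ q ∈ nball p ρ ∧ expMap p (ncoord (n := n) p ρ q) = q := by
  have hd := h.diffeo v hv
  have hcont := hd.localInverse_contMDiffAt.continuousAt
  have hv' : hd.localInverse (expMap p v) = v := hd.localInverse_left_inv hd.localInverse_mem_target
  have h1 : ∀ᶠ q in 𝓝 (expMap p v), hd.localInverse q ∈ nball p ρ := by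
    apply hcont.eventually
    rw [hv']
    exact (isOpen_nball p ρ).mem_nhds hv
  filter_upwards [h1, hd.localInverse_eventuallyEq_right] with q h2 h3
  have h4 : expMap p (hd.localInverse q) = q := h3
  have h5 : ncoord (n := n) p ρ q = hd.localInverse q := by
    conv_lhs => rw [← h4]
    exact h.ncoord_exp h2
  rw [h5]
  exact ⟨rfl, h2, h4⟩

lemma contMDiffAt_ncoord (h : IsNormalRadius (n := n) p ρ) {v : Eu n} (hv : v ∈ nball p ρ) :
    ContMDiffAt (𝓡 n) 𝓘(ℝ, Eu n) ∞ (ncoord (n := n) p ρ) (expMap p v) := by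
  refine (h.diffeo v hv).localInverse_contMDiffAt.congr_of_eventuallyEq ?_
  filter_upwards [h.eventually_exp_ncoord hv] with q hq
  exact hq.1

end IsNormalRadius

end NormalCoordinates

/-! ### Traces with respect to an inner product -/

section Traces

attribute [-instance] instNormedAddCommGroupOfRiemannianBundleOfIsTopologicalAddGroupOfContinuousConstSMulReal
  instInnerProductSpaceReal

variable {m : ℕ}

/-- The matrix of a linear map in the standard basis. -/
def matL (T : Eu m →L[ℝ] Eu m) : Matrix (Fin m) (Fin m) ℝ := Matrix.of fun i j => T (sb j) i

lemma det_matL (T : Eu m →L[ℝ] Eu m) : (matL T).det = T.det := by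
  have h := LinearMap.det_toMatrix (EuclideanSpace.basisFun (Fin m) ℝ).toBasis
    (T : Eu m →ₗ[ℝ] Eu m)
  rw [ContinuousLinearMap.det, ← h]
  congr 1

lemma sum_matL_smul_sb (T : Eu m →L[ℝ] Eu m) (j : Fin m) : ∑ i, matL T i j • sb i = T (sb j) :=
  sum_smul_sb _

lemma matB_comp_eq (H : Matrix (Fin m) (Fin m) ℝ) (T : Eu m →L[ℝ] Eu m) (i j : Fin m) :
    matB H (T (sb i)) (T (sb j)) = ((matL T).transpose * H * matL T) i j := by
  simp only [matB_apply, Matrix.mul_apply, Matrix.transpose_apply, matL, Matrix.of_apply,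
    Finset.sum_mul]
  rw [Finset.sum_comm]
  exact Finset.sum_congr rfl fun _ _ => Finset.sum_congr rfl fun _ _ => by ring

lemma eq_transpose_mul_mul {H H' : Matrix (Fin m) (Fin m) ℝ} {T : Eu m →L[ℝ] Eu m}
    (h : ∀ a b, matB H' a b = matB H (T a) (T b)) : H' = (matL T).transpose * H * matL T := by
  ext i j
  rw [← matB_comp_eq, ← h, matB_sb]

lemma det_eq_of_matB_eq {H H' : Matrix (Fin m) (Fin m) ℝ} {T : Eu m →L[ℝ] Eu m}
    (h : ∀ a b, matB H' a b = matB H (T a) (T b)) : H'.det = T.det ^ 2 * H.det := by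
  rw [eq_transpose_mul_mul h, Matrix.det_mul, Matrix.det_mul, Matrix.det_transpose, det_matL]
  ring

/-- `A` maps the standard basis to an orthonormal basis for the form with matrix `H`. -/
def IsFrame (H : Matrix (Fin m) (Fin m) ℝ) (A : Eu m →L[ℝ] Eu m) : Prop :=
  ∀ a b, matB H (A a) (A b) = inner ℝ a b

lemma matB_one (a b : Eu m) : matB (1 : Matrix (Fin m) (Fin m) ℝ) a b = inner ℝ a b := by
  rw [matB_apply, PiLp.inner_apply]
  refine Finset.sum_congr rfl fun i _ => ?_
  rw [Finset.sum_eq_single i]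
  · simp [mul_comm]
  · intro j _ hj; simp [Matrix.one_apply_ne hj.symm]
  · simp

open scoped MatrixOrder Matrix.Norms.L2Operator in
/-- Orthonormal frames exist: for a factorization `H = Bᵀ B`, the columns of `B⁻¹` are one. -/
lemma exists_isFrame {H : Matrix (Fin m) (Fin m) ℝ} (hH : IsInnerForm (matB H)) :
    ∃ A, IsFrame H A := by
  have hpos := posDef_of_isInnerForm hH
  obtain ⟨B, hB⟩ := CStarAlgebra.nonneg_iff_eq_star_mul_self.mp hpos.posSemidef.nonneg
  have hB' : H = B.transpose * B := by rw [hB]; rfl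
  have hdet : IsUnit B.det := by
    rw [isUnit_iff_ne_zero]
    intro h0
    apply hpos.det_pos.ne'
    rw [hB', Matrix.det_mul, h0, mul_zero]
  let A : Eu m →L[ℝ] Eu m := (Matrix.toEuclideanLin B⁻¹).toContinuousLinearMap
  have hA : matL A = B⁻¹ := by
    ext i j
    simp [matL, A, Matrix.toEuclideanLin]
  refine ⟨A, fun a b => ?_⟩
  have h1 : (matL A).transpose * H * matL A = 1 := by
    rw [hA, hB', Matrix.transpose_nonsing_inv, Matrix.mul_assoc, Matrix.mul_assoc,
      Matrix.mul_nonsing_inv _ hdet, Matrix.mul_one, Matrix.nonsing_inv_mul]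
    simpa using hdet
  have h2 := matB_of_form ((matB H).bilinearComp A A)
  have h3 : (Matrix.of fun i j => (matB H).bilinearComp A A (sb i) (sb j)) = 1 := by
    rw [← h1]
    ext i j
    exact matB_comp_eq H A i j
  rw [← matB_one, ← h3, h2]
  rfl

variable {H : Matrix (Fin m) (Fin m) ℝ} {A : Eu m →L[ℝ] Eu m}

lemma IsFrame.mul_eq_one (hA : IsFrame H A) : (matL A).transpose * H * matL A = 1 := by
  ext i j
  rw [← matB_comp_eq, hA, ← matB_one, matB_sb]

lemma IsFrame.det_eq (hA : IsFrame H A) : A.det ^ 2 * H.det = 1 := by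
  have h := congrArg Matrix.det hA.mul_eq_one
  rw [Matrix.det_mul, Matrix.det_mul, Matrix.det_transpose, det_matL, Matrix.det_one] at h
  linarith

lemma IsFrame.inv_eq (hA : IsFrame H A) : H⁻¹ = matL A * (matL A).transpose := by
  have h := hA.mul_eq_one
  rw [Matrix.mul_assoc] at h
  have h1 := mul_eq_one_comm.1 h
  rw [Matrix.mul_assoc] at h1
  exact Matrix.inv_eq_right_inv h1

/-- The trace of a bilinear map with respect to the inner product with matrix `H`. -/
def trB {W : Type*} [AddCommGroup W] [Module ℝ W] (H : Matrix (Fin m) (Fin m) ℝ)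
    (B : Eu m →ₗ[ℝ] Eu m →ₗ[ℝ] W) : W := ∑ i, ∑ j, H⁻¹ i j • B (sb i) (sb j)

lemma IsFrame.trB_eq {W : Type*} [AddCommGroup W] [Module ℝ W] (hA : IsFrame H A)
    (B : Eu m →ₗ[ℝ] Eu m →ₗ[ℝ] W) : trB H B = ∑ k, B (A (sb k)) (A (sb k)) := by
  have h : ∀ k, B (A (sb k)) (A (sb k)) = ∑ i, ∑ j, (matL A i k * matL A j k) • B (sb i) (sb j) := by
    intro k
    rw [← sum_matL_smul_sb A k]
    simp only [map_sum, map_smul, LinearMap.sum_apply, LinearMap.smul_apply, Finset.smul_sum,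
      smul_smul]
    rw [Finset.sum_comm]
    simp only [mul_comm]
  simp only [h, trB, hA.inv_eq, Matrix.mul_apply, Matrix.transpose_apply, Finset.sum_smul]
  rw [Finset.sum_comm (s := Finset.univ (α := Fin m)) (t := Finset.univ (α := Fin m))
    (f := fun k i => ∑ j, (matL A i k * matL A j k) • B (sb i) (sb j))]
  exact Finset.sum_congr rfl fun i _ => Finset.sum_comm

/-- The trace does not depend on the coordinates. -/
lemma trB_transform {W : Type*} [AddCommGroup W] [Module ℝ W] {H H' : Matrix (Fin m) (Fin m) ℝ}
    (hH' : IsInnerForm (matB H')) {T : Eu m →L[ℝ] Eu m}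
    (h : ∀ a b, matB H' a b = matB H (T a) (T b)) {B B' : Eu m →ₗ[ℝ] Eu m →ₗ[ℝ] W}
    (hB : ∀ a b, B' a b = B (T a) (T b)) : trB H' B' = trB H B := by
  obtain ⟨A, hA⟩ := exists_isFrame hH'
  have hTA : IsFrame H (T.comp A) := fun a b => by
    rw [← hA a b, h]; rfl
  rw [hA.trB_eq, hTA.trB_eq]
  exact Finset.sum_congr rfl fun k _ => hB _ _

end Traces

/-! ### The Laplace operator of an immersed manifold -/

/-- The Hessian as a bilinear map. -/
def hessL {m : ℕ} (Γ : Eu m →L[ℝ] Eu m →L[ℝ] Eu m) (ψ : Eu m → ℝ) (y : Eu m) :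
    Eu m →ₗ[ℝ] Eu m →ₗ[ℝ] ℝ :=
  LinearMap.mk₂ ℝ (hess Γ ψ y)
    (fun a b c => by simp only [hess, map_add, add_apply]; ring)
    (fun t a b => by simp only [hess, map_smul, smul_apply, smul_eq_mul]; ring)
    (fun a b c => by simp only [hess, map_add]; ring)
    (fun t a b => by simp only [hess, map_smul, smul_eq_mul]; ring)

section Immersions

set_option linter.unusedSectionVars false

variable {n m : ℕ} {M : Type*} [EMetricSpace M] [ChartedSpace (Eu n) M] [IsManifold (𝓡 n) ∞ M]
  [RiemannianBundle (fun x : M => TangentSpace (𝓡 n) x)]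
  {S : Type*} [TopologicalSpace S] [ChartedSpace (Eu m) S] [IsManifold (𝓡 m) ∞ S]

/-- The inverse of the chart around `x`. -/
abbrev cs (x : S) : Eu m → S := (extChartAt (𝓡 m) x).symm

/-- The change of coordinates from the chart around `x` to the chart around `x'`. -/
abbrev trans (x x' : S) : Eu m → Eu m := fun u => extChartAt (𝓡 m) x' (cs x u)

lemma cs_self (x : S) : cs (m := m) x (extChartAt (𝓡 m) x x) = x := extChartAt_to_inv x

lemma pullback_eq (f : S → M) (x : S) (u : Eu m) :
    pullbackMetric (n := n) f x u = pb (n := n) (f ∘ cs x) u := pullbackMetric_eq_pb f x u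

/-- The Laplacian of `v` in the coordinates given by the chart around `x`. -/
def laplC (f : S → M) (x : S) (v : S → ℝ) (u : Eu m) : ℝ :=
  trB (pullbackMetric (n := n) f x u)
    (hessL (chrMap (pullbackMetric (n := n) f x) u) (fun z => v (cs x z)) u)

/-- The Laplacian of `v` for the metric induced by `f`. -/
def lapl (f : S → M) (v : S → ℝ) (x : S) : ℝ :=
  laplC (n := n) (m := m) f x v (extChartAt (𝓡 m) x x)

lemma contMDiffAt_cs (x : S) {u : Eu m} (hu : u ∈ (extChartAt (𝓡 m) x).target) :
    ContMDiffAt 𝓘(ℝ, Eu m) (𝓡 m) ∞ (cs x) u :=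
  (contMDiffOn_extChartAt_symm x).contMDiffAt ((isOpen_extChartAt_target x).mem_nhds hu)

lemma contMDiffAt_comp_cs {f : S → M} (hf : ContMDiff (𝓡 m) (𝓡 n) ∞ f) (x : S) {u : Eu m}
    (hu : u ∈ (extChartAt (𝓡 m) x).target) :
    ContMDiffAt 𝓘(ℝ, Eu m) (𝓡 n) ∞ (f ∘ cs x) u :=
  hf.contMDiffAt.comp u (contMDiffAt_cs x hu)

lemma eventually_contMDiffAt_comp_cs {f : S → M} (hf : ContMDiff (𝓡 m) (𝓡 n) ∞ f) (x : S)
    {u : Eu m} (hu : u ∈ (extChartAt (𝓡 m) x).target) :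
    ∀ᶠ z in 𝓝 u, ContMDiffAt 𝓘(ℝ, Eu m) (𝓡 n) ∞ (f ∘ cs x) z := by
  filter_upwards [(isOpen_extChartAt_target x).mem_nhds hu] with z hz
  exact contMDiffAt_comp_cs hf x hz

lemma contDiffAt_comp_cs {k : WithTop ℕ∞} {v : S → ℝ} (x : S) {u : Eu m}
    (hu : u ∈ (extChartAt (𝓡 m) x).target)
    (hv : ContMDiffAt (𝓡 m) 𝓘(ℝ, ℝ) k v (cs x u)) (hk : k ≤ (∞ : WithTop ℕ∞)) :
    ContDiffAt ℝ k (fun z => v (cs x z)) u :=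
  (hv.comp u ((contMDiffAt_cs x hu).of_le hk)).contDiffAt

lemma contDiffAt_trans (x x' : S) {u : Eu m} (hu : u ∈ (extChartAt (𝓡 m) x).target)
    (hx' : cs x u ∈ (extChartAt (𝓡 m) x').source) : ContDiffAt ℝ ∞ (trans x x') u := by
  rw [extChartAt_source] at hx'
  exact ((contMDiffAt_extChartAt' hx').comp u (contMDiffAt_cs x hu)).contDiffAt

lemma eventually_cs_trans (x x' : S) {u : Eu m} (hu : u ∈ (extChartAt (𝓡 m) x).target)
    (hx' : cs x u ∈ (extChartAt (𝓡 m) x').source) :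
    ∀ᶠ z in 𝓝 u, z ∈ (extChartAt (𝓡 m) x).target ∧ cs x z ∈ (extChartAt (𝓡 m) x').source ∧
      cs x' (trans x x' z) = cs x z := by
  filter_upwards [(isOpen_extChartAt_target x).mem_nhds hu,
    (contMDiffAt_cs x hu).continuousAt.eventually ((isOpen_extChartAt_source x').mem_nhds hx')]
    with z h1 h2
  exact ⟨h1, h2, (extChartAt (𝓡 m) x').left_inv h2⟩

variable {f : S → M}

lemma injective_dM_cs (x : S) {u : Eu m} (hu : u ∈ (extChartAt (𝓡 m) x).target) :
    Function.Injective (dM (n := m) (cs x) u) := by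
  have : IsManifold (𝓡 m) 1 S := IsManifold.of_le (n := ∞) (by simp)
  have h := isInvertible_mfderivWithin_extChartAt_symm (I := 𝓡 m) hu
  have h2 := h.injective
  simp only [modelWithCornersSelf_coe, range_id, mfderivWithin_univ] at h2
  exact h2

lemma IsSmoothImmersion.injective_dM (hf : IsSmoothImmersion (n := n) (m := m) f) (x : S)
    {u : Eu m} (hu : u ∈ (extChartAt (𝓡 m) x).target) :
    Function.Injective (dM (n := n) (f ∘ cs x) u) := by
  have h0 : MDifferentiableAt (𝓡 m) (𝓡 n) f (cs x u) := hf.1.mdifferentiableAt (by simp)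
  have h1 := mfderiv_comp (I := 𝓘(ℝ, Eu m)) u h0 ((contMDiffAt_cs x hu).mdifferentiableAt (by simp))
  have h2 : ∀ a, dM (n := n) (f ∘ cs x) u a
      = mfderiv (𝓡 m) (𝓡 n) f (cs x u) (dM (n := m) (cs x) u a) := fun a =>
    congrArg (fun L => L a) h1
  have h3 : Function.Injective (mfderiv (𝓡 m) (𝓡 n) f (cs x u)) := hf.2 _
  have h4 := injective_dM_cs x hu
  intro a b hab
  rw [h2, h2] at hab
  exact h4 (h3 hab)

lemma IsSmoothImmersion.isInnerForm (hf : IsSmoothImmersion (n := n) (m := m) f) (x : S) {u : Eu m}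
    (hu : u ∈ (extChartAt (𝓡 m) x).target) :
    IsInnerForm (matB (pullbackMetric (n := n) f x u)) := by
  rw [pullback_eq]
  refine isInnerForm_pb ?_
  exact hf.injective_dM x hu

variable [IsContMDiffRiemannianBundle (𝓡 n) ∞ (Eu n) (fun x : M => TangentSpace (𝓡 n) x)]

lemma IsSmoothImmersion.contDiffAt_metric (hf : IsSmoothImmersion (n := n) (m := m) f) (x : S)
    {u : Eu m} (hu : u ∈ (extChartAt (𝓡 m) x).target) (i j : Fin m) :
    ContDiffAt ℝ ∞ (fun z => pullbackMetric (n := n) f x z i j) u := by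
  have h : pullbackMetric (n := n) f x = pb (n := n) (f ∘ cs (m := m) x) :=
    funext fun u => pullback_eq f x u
  rw [h]
  exact contDiffAt_pb (eventually_contMDiffAt_comp_cs hf.1 x hu) i j

lemma IsSmoothImmersion.det_pos (hf : IsSmoothImmersion (n := n) (m := m) f) (x : S) {u : Eu m}
    (hu : u ∈ (extChartAt (𝓡 m) x).target) : 0 < (pullbackMetric (n := n) f x u).det :=
  (posDef_of_isInnerForm (hf.isInnerForm x hu)).det_pos

lemma pullbackMetric_symm (f : S → M) (x : S) (z : Eu m) (i j : Fin m) :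
    pullbackMetric (n := n) f x z i j = pullbackMetric (n := n) f x z j i := by
  rw [pullback_eq]; exact pb_symm _ _ _ _

lemma IsSmoothImmersion.isChristoffelAt (hf : IsSmoothImmersion (n := n) (m := m) f) (x : S)
    {u : Eu m} (hu : u ∈ (extChartAt (𝓡 m) x).target) :
    IsChristoffelAt (fun z => matB (pullbackMetric (n := n) f x z))
      (chrMap (pullbackMetric (n := n) f x) u) u :=
  isChristoffelAt_chrMap (pullbackMetric_symm f x)
    (fun i j => (hf.contDiffAt_metric x hu i j).of_le (by simp)) (hf.det_pos x hu).ne'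

lemma IsSmoothImmersion.differentiableAt_metric (hf : IsSmoothImmersion (n := n) (m := m) f)
    (x : S) {u : Eu m} (hu : u ∈ (extChartAt (𝓡 m) x).target) :
    DifferentiableAt ℝ (fun z => matB (pullbackMetric (n := n) f x z)) u :=
  (contDiffAt_matB (hf.contDiffAt_metric x hu)).differentiableAt (by simp)

/-- The induced metrics in two charts are related by the change of coordinates. -/
lemma matB_pullback_trans (hf : IsSmoothImmersion (n := n) (m := m) f) (x x' : S) {u : Eu m}
    (hu : u ∈ (extChartAt (𝓡 m) x).target) (hx' : cs x u ∈ (extChartAt (𝓡 m) x').source)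
    (a b : Eu m) : matB (pullbackMetric (n := n) f x u) a b
      = matB (pullbackMetric (n := n) f x' (trans x x' u)) (fderiv ℝ (trans x x') u a)
        (fderiv ℝ (trans x x') u b) := by
  have ht := (extChartAt (𝓡 m) x').map_source hx'
  have h1 : f ∘ cs x =ᶠ[𝓝 u] (f ∘ cs x') ∘ trans x x' := by
    filter_upwards [eventually_cs_trans x x' hu hx'] with z hz
    simp only [Function.comp]; rw [hz.2.2]
  have h2 : cs x' (trans x x' u) = cs x u := (extChartAt (𝓡 m) x').left_inv hx'
  rw [pullback_eq, pullback_eq, matB_pb, matB_pb, dM_congr h1,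
    dM_comp ((contMDiffAt_comp_cs hf.1 x' ht).mdifferentiableAt (by simp))
      ((contDiffAt_trans x x' hu hx').differentiableAt (by simp))]
  simp only [Function.comp_apply]
  rw [h2]
  rfl

lemma det_pullback_trans (hf : IsSmoothImmersion (n := n) (m := m) f) (x x' : S) {u : Eu m}
    (hu : u ∈ (extChartAt (𝓡 m) x).target) (hx' : cs x u ∈ (extChartAt (𝓡 m) x').source) :
    (pullbackMetric (n := n) f x u).det = (fderiv ℝ (trans x x') u).det ^ 2
      * (pullbackMetric (n := n) f x' (trans x x' u)).det :=
  det_eq_of_matB_eq (matB_pullback_trans hf x x' hu hx')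

lemma surjective_fderiv_trans (hf : IsSmoothImmersion (n := n) (m := m) f) (x x' : S) {u : Eu m}
    (hu : u ∈ (extChartAt (𝓡 m) x).target) (hx' : cs x u ∈ (extChartAt (𝓡 m) x').source) :
    Function.Surjective (fderiv ℝ (trans x x') u) := by
  have hinj : Function.Injective (fderiv ℝ (trans x x') u : Eu m →ₗ[ℝ] Eu m) := by
    rw [← LinearMap.ker_eq_bot, LinearMap.ker_eq_bot']
    intro a ha
    by_contra h0
    have h1 := (hf.isInnerForm x hu).pos a h0
    rw [matB_pullback_trans hf x x' hu hx'] at h1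
    have ha' : fderiv ℝ (trans x x') u a = 0 := ha
    rw [ha', map_zero] at h1
    exact lt_irrefl _ h1
  exact LinearMap.injective_iff_surjective.1 hinj

/-- The Laplacian does not depend on the chart. -/
lemma laplC_trans (hf : IsSmoothImmersion (n := n) (m := m) f) (x x' : S) {v : S → ℝ} {u : Eu m}
    (hu : u ∈ (extChartAt (𝓡 m) x).target) (hx' : cs x u ∈ (extChartAt (𝓡 m) x').source)
    (hv : ContMDiffAt (𝓡 m) 𝓘(ℝ, ℝ) 2 v (cs x u)) :
    laplC (n := n) f x v u = laplC (n := n) f x' v (trans x x' u) := by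
  have ht := (extChartAt (𝓡 m) x').map_source hx'
  have hT := (contDiffAt_trans x x' hu hx').of_le (m := 2) (WithTop.coe_le_coe.2 le_top)
  have h2 : cs x' (trans x x' u) = cs x u := (extChartAt (𝓡 m) x').left_inv hx'
  have hpb : ∀ᶠ z in 𝓝 u, ∀ a b, matB (pullbackMetric (n := n) f x z) a b
      = matB (pullbackMetric (n := n) f x' (trans x x' z)) (fderiv ℝ (trans x x') z a)
        (fderiv ℝ (trans x x') z b) := by
    filter_upwards [eventually_cs_trans x x' hu hx'] with z hz a b
    exact matB_pullback_trans hf x x' hz.1 hz.2.1 a b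
  have hchr := christoffel_transform (G := fun z => matB (pullbackMetric (n := n) f x' z))
    (h := fun z => matB (pullbackMetric (n := n) f x z))
    (fun z => matB_symm (pullbackMetric_symm f x' z)) hT
    (hf.differentiableAt_metric x' ht) (hf.differentiableAt_metric x hu) hpb
    (hf.isChristoffelAt x' ht) (hf.isChristoffelAt x hu) (hf.isInnerForm x' ht).nondegenerate
    (surjective_fderiv_trans hf x x' hu hx')
  have hv' : ContDiffAt ℝ 2 (fun z => v (cs x' z)) (trans x x' u) :=
    contDiffAt_comp_cs x' ht (by rw [h2]; exact hv) (WithTop.coe_le_coe.2 le_top)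
  have heq : (fun z => v (cs x z)) =ᶠ[𝓝 u] fun z => v (cs x' (trans x x' z)) := by
    filter_upwards [eventually_cs_trans x x' hu hx'] with z hz
    rw [hz.2.2]
  refine trB_transform (hf.isInnerForm x hu) (matB_pullback_trans hf x x' hu hx') fun a b => ?_
  have h3 := hess_comp (ψ := fun z => v (cs x' z)) (chrMap (pullbackMetric (n := n) f x')
    (trans x x' u)) (chrMap (pullbackMetric (n := n) f x) u) hT hv' a b
  rw [hchr, sub_self, map_zero, add_zero] at h3
  change hess _ (fun z => v (cs x z)) u a b = hess _ _ _ _ _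
  rw [← h3, hess, hess, heq.fderiv_eq (𝕜 := ℝ), (heq.fderiv (𝕜 := ℝ)).fderiv_eq (𝕜 := ℝ)]

lemma lapl_eq (hf : IsSmoothImmersion (n := n) (m := m) f) {x x' : S} {v : S → ℝ}
    (hx' : x ∈ (extChartAt (𝓡 m) x').source) (hv : ContMDiffAt (𝓡 m) 𝓘(ℝ, ℝ) 2 v x) :
    lapl (n := n) (m := m) f v x = laplC (n := n) f x' v (extChartAt (𝓡 m) x' x) := by
  have h := laplC_trans hf x x' (v := v) (mem_extChartAt_target (I := 𝓡 m) x)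
    (by rw [cs_self]; exact hx') (by rw [cs_self]; exact hv)
  rw [lapl, h]
  simp only [trans, cs_self]

end Immersions

/-! ### The Laplacian of a surface in divergence form -/

section Divergence

attribute [-instance] instNormedAddCommGroupOfRiemannianBundleOfIsTopologicalAddGroupOfContinuousConstSMulReal
  instInnerProductSpaceReal

lemma integral_fderiv_eq_zero {m : ℕ} {g : Eu m → ℝ} (hg : ContDiff ℝ 1 g) (hc : HasCompactSupport g)
    (a : Eu m) : ∫ x, fderiv ℝ g x a = 0 := by
  have hd : Continuous fun x => fderiv ℝ g x a :=
    (hg.continuous_fderiv one_ne_zero).clm_apply continuous_const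
  have hdc : HasCompactSupport fun x => fderiv ℝ g x a := hc.fderiv_apply ℝ a
  have h := integral_mul_fderiv_eq_neg_fderiv_mul_of_integrable (μ := (volume : Measure (Eu m)))
    (f := fun _ => (1 : ℝ)) (g := g) (v := a) (by simp)
    (by simpa using hd.integrable_of_hasCompactSupport hdc)
    (by simpa using hg.continuous.integrable_of_hasCompactSupport hc)
    (fun x _ => differentiableAt_const _)
    (fun x _ => (hg.differentiable one_ne_zero) x)
  simpa using h

lemma pderiv_div_sqrt {e d : Eu 2 → ℝ} {y : Eu 2} (he : DifferentiableAt ℝ e y)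
    (hd : DifferentiableAt ℝ d y) (h0 : 0 < d y) (i : Fin 2) :
    pderiv i (fun z => e z / √(d z)) y
      = √(d y) * (pderiv i e y / d y - e y * pderiv i d y / (2 * d y ^ 2)) := by
  have hs : 0 < √(d y) := Real.sqrt_pos.2 h0
  have h1 := he.hasFDerivAt.mul
    (HasDerivAt.comp_hasFDerivAt y (hasDerivAt_inv hs.ne') (hd.hasFDerivAt.sqrt h0.ne'))
  have hdiv : (fun z => e z / √(d z)) = fun z => e z * ((fun t => t⁻¹) ∘ fun z => √(d z)) z := by
    funext z; simp [div_eq_mul_inv]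
  have hsq : d y = √(d y) ^ 2 := (Real.sq_sqrt h0.le).symm
  have h2 : fderiv ℝ (fun z => e z * ((fun t => t⁻¹) ∘ fun z => √(d z)) z) y = _ := h1.fderiv
  rw [pderiv, hdiv, h2, pderiv, pderiv]
  simp only [smul_apply, add_apply, smul_eq_mul, Function.comp_apply]
  generalize √(d y) = s at *
  rw [hsq]
  field_simp
  ring

lemma pderiv_det {g : Eu 2 → Matrix (Fin 2) (Fin 2) ℝ} {y : Eu 2}
    (hg : ∀ i j, DifferentiableAt ℝ (fun z => g z i j) y) (hs : ∀ z i j, g z i j = g z j i)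
    (i : Fin 2) : pderiv i (fun z => (g z).det) y
      = pderiv i (fun z => g z 0 0) y * g y 1 1 + g y 0 0 * pderiv i (fun z => g z 1 1) y
        - 2 * g y 0 1 * pderiv i (fun z => g z 0 1) y := by
  have h : (fun z => (g z).det) = fun z => g z 0 0 * g z 1 1 - g z 0 1 * g z 0 1 := by
    funext z; rw [Matrix.det_fin_two, hs z 1 0]
  have h1 := ((hg 0 0).hasFDerivAt.mul (hg 1 1).hasFDerivAt).sub
    ((hg 0 1).hasFDerivAt.mul (hg 0 1).hasFDerivAt)
  rw [h]
  simp only [pderiv]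
  have h2 : fderiv ℝ (fun z => g z 0 0 * g z 1 1 - g z 0 1 * g z 0 1) y = _ := h1.fderiv
  rw [h2]
  simp only [smul_apply, sub_apply, add_apply, smul_eq_mul]
  ring

lemma inv_fin_two_symm {A : Matrix (Fin 2) (Fin 2) ℝ} (hs : ∀ i j, A i j = A j i) :
    A⁻¹ 0 0 = A 1 1 / A.det ∧ A⁻¹ 0 1 = - A 0 1 / A.det ∧ A⁻¹ 1 0 = - A 0 1 / A.det ∧
      A⁻¹ 1 1 = A 0 0 / A.det := by
  rw [Matrix.inv_def, Matrix.adjugate_fin_two]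
  simp [hs 1 0]
  refine ⟨?_, ?_, ?_⟩ <;> ring

/-- The inverse metric multiplied by the area density. -/
def densInv (g : Eu 2 → Matrix (Fin 2) (Fin 2) ℝ) (i j : Fin 2) (z : Eu 2) : ℝ :=
  √((g z).det) * (g z)⁻¹ i j

/-- `∂ᵢ(√d gⁱʲ) = -√d gᵏˡ Γʲₖₗ`. -/
lemma sum_pderiv_densInv {g : Eu 2 → Matrix (Fin 2) (Fin 2) ℝ} {y : Eu 2}
    (hg : ∀ i j, DifferentiableAt ℝ (fun z => g z i j) y) (hs : ∀ z i j, g z i j = g z j i)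
    (h0 : 0 < (g y).det) (j : Fin 2) :
    ∑ i, pderiv i (densInv g i j) y
      = - √((g y).det) * ∑ k, ∑ l, (g y)⁻¹ k l * christoffel g y j k l := by
  have hdet : DifferentiableAt ℝ (fun z => (g z).det) y := by
    have h : (fun z => (g z).det) = fun z => g z 0 0 * g z 1 1 - g z 0 1 * g z 1 0 := by
      funext z; rw [Matrix.det_fin_two]
    rw [h]
    exact ((hg 0 0).mul (hg 1 1)).sub ((hg 0 1).mul (hg 1 0))
  have hev : ∀ᶠ z in 𝓝 y, 0 < (g z).det := hdet.continuousAt.eventually (lt_mem_nhds h0)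
  have hmain : ∀ (e : Eu 2 → ℝ), DifferentiableAt ℝ e y → ∀ i j,
      (∀ z, (g z)⁻¹ i j = e z / (g z).det) → pderiv i (densInv g i j) y
      = √((g y).det) * (pderiv i e y / (g y).det
        - e y * pderiv i (fun z => (g z).det) y / (2 * (g y).det ^ 2)) := by
    intro e he i j h
    rw [← pderiv_div_sqrt he hdet h0]
    have : densInv g i j =ᶠ[𝓝 y] fun z => e z / √((g z).det) := by
      filter_upwards [hev] with z hz
      rw [densInv, h]
      have hs := Real.sqrt_pos.2 hz
      have hsq : (g z).det = √((g z).det) ^ 2 := (Real.sq_sqrt hz.le).symm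
      generalize √((g z).det) = s at *
      rw [hsq]
      field_simp
    rw [pderiv, pderiv, this.fderiv_eq (𝕜 := ℝ)]
  have hneg : ∀ i, pderiv i (fun z => - g z 0 1) y = - pderiv i (fun z => g z 0 1) y := by
    intro i
    have h1 : fderiv ℝ (fun z => - g z 0 1) y = _ := (hg 0 1).hasFDerivAt.neg.fderiv
    rw [pderiv, h1]; rfl
  have e00 := hmain (fun z => g z 1 1) (hg 1 1) 0 0 fun z => (inv_fin_two_symm (hs z)).1
  have e01 := hmain (fun z => - g z 0 1) (hg 0 1).neg 0 1 fun z => (inv_fin_two_symm (hs z)).2.1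
  have e10 := hmain (fun z => - g z 0 1) (hg 0 1).neg 1 0 fun z => (inv_fin_two_symm (hs z)).2.2.1
  have e11 := hmain (fun z => g z 0 0) (hg 0 0) 1 1 fun z => (inv_fin_two_symm (hs z)).2.2.2
  obtain ⟨i00, i01, i10, i11⟩ := inv_fin_two_symm (hs y)
  have hs10 : (fun z => g z 1 0) = fun z => g z 0 1 := funext fun z => hs z 1 0
  have hdv : (g y).det = g y 0 0 * g y 1 1 - g y 0 1 * g y 0 1 := by
    rw [Matrix.det_fin_two, hs y 1 0]
  rw [neg_mul, ← mul_neg]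
  rw [hneg, pderiv_det hg hs] at e01 e10
  rw [pderiv_det hg hs] at e00 e11
  fin_cases j
  · simp only [Fin.sum_univ_two, Fin.zero_eta, e00, e10, christoffel, i00, i01, i10, i11, hs10]
    rw [← mul_add]
    congr 1
    rw [hdv] at h0 ⊢
    have := h0.ne'
    field_simp
    ring
  · simp only [Fin.sum_univ_two, Fin.mk_one, e01, e11, christoffel, i00, i01, i10, i11, hs10]
    rw [← mul_add]
    congr 1
    rw [hdv] at h0 ⊢
    have := h0.ne'
    field_simp
    ring

lemma pderiv_eq_zero_of_eventuallyEq {ψ : Eu 2 → ℝ} {y : Eu 2} (h : ψ =ᶠ[𝓝 y] 0) (i : Fin 2) :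
    pderiv i ψ y = 0 := by
  rw [pderiv, h.fderiv_eq (𝕜 := ℝ)]
  simp

lemma fderiv_apply_eq_sum (ψ : Eu 2 → ℝ) (y c : Eu 2) :
    fderiv ℝ ψ y c = ∑ k, c k * pderiv k ψ y := by
  conv_lhs => rw [← sum_smul_sb c]
  simp [pderiv]

section Field

variable {g : Eu 2 → Matrix (Fin 2) (Fin 2) ℝ} {ψ : Eu 2 → ℝ}

/-- The gradient of `ψ` multiplied by the area density. -/
def densGrad (g : Eu 2 → Matrix (Fin 2) (Fin 2) ℝ) (ψ : Eu 2 → ℝ) (i : Fin 2) (z : Eu 2) : ℝ :=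
  ∑ j, densInv g i j z * pderiv j ψ z

lemma contDiffAt_densInv {y : Eu 2} (hg : ∀ i j, ContDiffAt ℝ ∞ (fun z => g z i j) y)
    (h0 : 0 < (g y).det) (i j : Fin 2) : ContDiffAt ℝ ∞ (densInv g i j) y :=
  ((contDiffAt_det hg).sqrt h0.ne').mul (contDiffAt_inv hg h0.ne' i j)

lemma contDiffAt_densGrad {y : Eu 2} (hg : ∀ i j, ContDiffAt ℝ ∞ (fun z => g z i j) y)
    (h0 : 0 < (g y).det) (hψ : ContDiffAt ℝ 2 ψ y) (i : Fin 2) :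
    ContDiffAt ℝ 1 (densGrad g ψ i) y :=
  ContDiffAt.sum fun j _ => ((contDiffAt_densInv hg h0 i j).of_le (by simp)).mul
    ((hψ.fderiv_right (m := 1) (by norm_num)).clm_apply contDiffAt_const)

/-- The Laplacian in divergence form. -/
lemma sum_pderiv_densGrad {y : Eu 2} (hg : ∀ i j, ContDiffAt ℝ ∞ (fun z => g z i j) y)
    (hs : ∀ z i j, g z i j = g z j i) (h0 : 0 < (g y).det) (hψ : ContDiffAt ℝ 2 ψ y) :
    ∑ i, pderiv i (densGrad g ψ i) y
      = √((g y).det) * trB (g y) (hessL (chrMap g y) ψ y) := by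
  have h1 : ∀ i, pderiv i (densGrad g ψ i) y = ∑ j, (densInv g i j y
      * fderiv ℝ (fderiv ℝ ψ) y (sb i) (sb j) + pderiv j ψ y * pderiv i (densInv g i j) y) := by
    intro i
    have hj : ∀ j, HasFDerivAt (fun z => densInv g i j z * pderiv j ψ z)
        (densInv g i j y • fderiv ℝ (fun z => fderiv ℝ ψ z (sb j)) y
          + pderiv j ψ y • fderiv ℝ (densInv g i j) y) y := fun j =>
      (((contDiffAt_densInv hg h0 i j).differentiableAt (by simp)).hasFDerivAt).mul
        (((differentiableAt_fderiv hψ).clm_apply (differentiableAt_const _)).hasFDerivAt)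
    have h2 := (HasFDerivAt.fun_sum fun j (_ : j ∈ Finset.univ) => hj j).fderiv
    have h3 : pderiv i (densGrad g ψ i) y
        = fderiv ℝ (fun z => ∑ j, densInv g i j z * pderiv j ψ z) y (sb i) := rfl
    rw [h3, h2, sum_apply]
    refine Finset.sum_congr rfl fun j _ => ?_
    have h4 : fderiv ℝ (fun z => fderiv ℝ ψ z (sb j)) y (sb i)
        = fderiv ℝ (fderiv ℝ ψ) y (sb i) (sb j) := by
      rw [((differentiableAt_fderiv hψ).hasFDerivAt.clm_apply (hasFDerivAt_const (sb j) y)).fderiv]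
      simp
    simp only [add_apply, smul_apply, smul_eq_mul, h4]
    rfl
  have h5 : ∑ i, ∑ j, pderiv j ψ y * pderiv i (densInv g i j) y
      = - √((g y).det) * ∑ i, ∑ j, (g y)⁻¹ i j * fderiv ℝ ψ y (chrMap g y (sb i) (sb j)) := by
    rw [Finset.sum_comm]
    simp only [← Finset.mul_sum]
    simp only [sum_pderiv_densInv (fun i j => (hg i j).differentiableAt (by simp)) hs h0,
      fderiv_apply_eq_sum ψ y (chrMap g y _ _), chrMap_sb, Fin.sum_univ_two]
    ring
  simp only [h1, Finset.sum_add_distrib, h5, densInv]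
  simp only [trB, hessL, LinearMap.mk₂_apply, hess, smul_eq_mul, mul_sub, Finset.sum_sub_distrib,
    Finset.mul_sum]
  simp only [mul_assoc, neg_mul, Finset.sum_neg_distrib]
  ring

/-- The integral of the Laplacian of a function with compact support in a chart vanishes. -/
lemma integral_laplacian_eq_zero {T : Set (Eu 2)} (hT : IsOpen T)
    (hg : ∀ y ∈ T, ∀ i j, ContDiffAt ℝ ∞ (fun z => g z i j) y)
    (hs : ∀ z i j, g z i j = g z j i) (h0 : ∀ y ∈ T, 0 < (g y).det)
    (hψ : ∀ y ∈ T, ContDiffAt ℝ 2 ψ y) (hψT : tsupport ψ ⊆ T) (hc : HasCompactSupport ψ) :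
    ∫ y in T, √((g y).det) * trB (g y) (hessL (chrMap g y) ψ y) = 0 := by
  have hoff : ∀ i, ∀ y ∉ tsupport ψ, densGrad g ψ i =ᶠ[𝓝 y] 0 := by
    intro i y hy
    have : (tsupport ψ)ᶜ ∈ 𝓝 y := (isClosed_tsupport ψ).isOpen_compl.mem_nhds hy
    filter_upwards [this] with z hz
    have hz' : ψ =ᶠ[𝓝 z] 0 := notMem_tsupport_iff_eventuallyEq.1 hz
    simp [densGrad, pderiv_eq_zero_of_eventuallyEq hz']
  have hX : ∀ i, ContDiff ℝ 1 (densGrad g ψ i) := by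
    intro i
    rw [contDiff_iff_contDiffAt]
    intro y
    by_cases hy : y ∈ T
    · exact contDiffAt_densGrad (hg y hy) (h0 y hy) (hψ y hy) i
    · exact contDiffAt_const.congr_of_eventuallyEq (hoff i y fun h => hy (hψT h))
  have hXc : ∀ i, HasCompactSupport (densGrad g ψ i) := by
    intro i
    refine HasCompactSupport.intro' hc (isClosed_tsupport ψ) fun y hy => ?_
    exact (hoff i y hy).self_of_nhds
  have h1 : ∫ y, ∑ i, pderiv i (densGrad g ψ i) y = 0 := by
    rw [integral_finsetSum]
    · exact Finset.sum_eq_zero fun i _ => integral_fderiv_eq_zero (hX i) (hXc i) _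
    · intro i _
      have hd : Continuous (pderiv i (densGrad g ψ i)) :=
        ((hX i).continuous_fderiv one_ne_zero).clm_apply continuous_const
      exact hd.integrable_of_hasCompactSupport
        (HasCompactSupport.fderiv_apply (𝕜 := ℝ) (hXc i) (sb i))
  have h2 : ∫ y in T, ∑ i, pderiv i (densGrad g ψ i) y = ∫ y, ∑ i, pderiv i (densGrad g ψ i) y :=
    setIntegral_eq_integral_of_forall_compl_eq_zero fun y hy => Finset.sum_eq_zero fun i _ =>
      pderiv_eq_zero_of_eventuallyEq (hoff i y fun h => hy (hψT h)) i
  rw [← h1, ← h2]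
  refine setIntegral_congr_fun hT.measurableSet fun y hy => ?_
  exact (sum_pderiv_densGrad (hg y hy) hs (h0 y hy) (hψ y hy)).symm

end Field

end Divergence

/-! ### The area measure in charts -/

section AreaMeasure

set_option linter.unusedSectionVars false

variable {n m : ℕ} {M : Type*} [EMetricSpace M] [ChartedSpace (Eu n) M] [IsManifold (𝓡 n) ∞ M]
  [RiemannianBundle (fun x : M => TangentSpace (𝓡 n) x)]
  [IsContMDiffRiemannianBundle (𝓡 n) ∞ (Eu n) (fun x : M => TangentSpace (𝓡 n) x)]
  {S : Type*} [TopologicalSpace S] [ChartedSpace (Eu m) S] [IsManifold (𝓡 m) ∞ S]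
  [MeasurableSpace S] [BorelSpace S] {f : S → M}

/-- The area density in the chart around `x`. -/
def dens (f : S → M) (x : S) (u : Eu m) : ℝ := √((pullbackMetric (n := n) f x u).det)

lemma continuousOn_cs (x : S) : ContinuousOn (cs (m := m) x) (extChartAt (𝓡 m) x).target :=
  continuousOn_extChartAt_symm x

lemma measurableSet_target (x : S) : MeasurableSet (extChartAt (𝓡 m) x).target :=
  (isOpen_extChartAt_target x).measurableSet

lemma measurableSet_target_inter (x : S) {A : Set S} (hA : MeasurableSet A) :
    MeasurableSet ((extChartAt (𝓡 m) x).target ∩ cs x ⁻¹' A) := by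
  classical
  have h := (continuousOn_cs (m := m) x).measurable_piecewise
    (g := fun _ => x) continuousOn_const (measurableSet_target x)
  have h2 := (measurableSet_target (m := m) x).inter (h hA)
  convert h2 using 1
  ext u
  refine and_congr_right fun hu => ?_
  rw [mem_preimage, mem_preimage, piecewise_eq_of_mem _ _ _ hu]

lemma aemeasurable_cs (x : S) (μ : Measure (Eu m)) :
    AEMeasurable (cs (m := m) x) (μ.restrict (extChartAt (𝓡 m) x).target) := by
  classical
  refine ⟨_, (continuousOn_cs (m := m) x).measurable_piecewise
    (g := fun _ => x) continuousOn_const (measurableSet_target x), ?_⟩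
  filter_upwards [ae_restrict_mem (measurableSet_target x)] with u hu
  exact (piecewise_eq_of_mem _ _ _ hu).symm

lemma chartAreaMeasure_apply (f : S → M) (x : S) {A : Set S} (hA : MeasurableSet A) :
    chartAreaMeasure (n := n) (m := m) f x A
      = ∫⁻ u in (extChartAt (𝓡 m) x).target ∩ cs x ⁻¹' A, ENNReal.ofReal (dens (n := n) f x u) := by
  have hms := measurableSet_target_inter (m := m) x hA
  rw [chartAreaMeasure, Measure.map_apply_of_aemeasurable (aemeasurable_cs x _) hA,
    Measure.restrict_apply₀ ((aemeasurable_cs x _).nullMeasurableSet_preimage hA), inter_comm,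
    withDensity_apply _ hms]
  rfl

lemma IsSmoothImmersion.continuousOn_dens (hf : IsSmoothImmersion (n := n) (m := m) f) (x : S) :
    ContinuousOn (dens (n := n) f x) (extChartAt (𝓡 m) x).target := fun _ hu =>
  (Real.continuous_sqrt.continuousAt.comp
    (contDiffAt_det (hf.contDiffAt_metric x hu)).continuousAt).continuousWithinAt

lemma measurableSet_source (x : S) : MeasurableSet (extChartAt (𝓡 m) x).source :=
  (isOpen_extChartAt_source x).measurableSet

lemma dens_trans (hf : IsSmoothImmersion (n := n) (m := m) f) (x x' : S) {u : Eu m}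
    (hu : u ∈ (extChartAt (𝓡 m) x).target) (hx' : cs x u ∈ (extChartAt (𝓡 m) x').source) :
    dens (n := n) f x u
      = |(fderiv ℝ (trans x x') u).det| * dens (n := n) f x' (trans x x' u) := by
  rw [dens, det_pullback_trans hf x x' hu hx', Real.sqrt_mul (sq_nonneg _), Real.sqrt_sq_eq_abs,
    dens]

/-- The area measures of two charts agree where the charts overlap. -/
lemma chartAreaMeasure_le (hf : IsSmoothImmersion (n := n) (m := m) f) (x x' : S) {A : Set S}
    (hA : MeasurableSet A) (hAx' : A ⊆ (extChartAt (𝓡 m) x').source) :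
    chartAreaMeasure (n := n) (m := m) f x A ≤ chartAreaMeasure (n := n) (m := m) f x' A := by
  rw [chartAreaMeasure_apply f x hA, chartAreaMeasure_apply f x' hA]
  set E := (extChartAt (𝓡 m) x).target ∩ cs x ⁻¹' A with hE
  have hEm : MeasurableSet E := measurableSet_target_inter x hA
  have hinj : InjOn (trans (m := m) x x') E := by
    intro u hu w hw huw
    have h1 := (extChartAt (𝓡 m) x').injOn (hAx' hu.2) (hAx' hw.2) huw
    have h2 := congrArg (extChartAt (𝓡 m) x) h1
    rwa [(extChartAt (𝓡 m) x).right_inv hu.1, (extChartAt (𝓡 m) x).right_inv hw.1] at h2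
  have hcv := lintegral_image_eq_lintegral_abs_det_fderiv_mul volume hEm
    (fun u hu => (((contDiffAt_trans x x' hu.1 (hAx' hu.2)).differentiableAt
      (by simp)).hasFDerivAt.hasFDerivWithinAt)) hinj
    (fun w => ENNReal.ofReal (dens (n := n) f x' w))
  calc ∫⁻ u in E, ENNReal.ofReal (dens (n := n) f x u)
      = ∫⁻ u in E, ENNReal.ofReal |(fderiv ℝ (trans x x') u).det|
        * ENNReal.ofReal (dens (n := n) f x' (trans x x' u)) := by
        refine setLIntegral_congr_fun hEm fun u hu => ?_
        rw [← ENNReal.ofReal_mul (abs_nonneg _), ← dens_trans hf x x' hu.1 (hAx' hu.2)]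
    _ = ∫⁻ w in trans x x' '' E, ENNReal.ofReal (dens (n := n) f x' w) := hcv.symm
    _ ≤ _ := by
      refine lintegral_mono_set ?_
      rintro _ ⟨u, hu, rfl⟩
      refine ⟨(extChartAt (𝓡 m) x').map_source (hAx' hu.2), ?_⟩
      have : cs x' (trans x x' u) = cs x u := (extChartAt (𝓡 m) x').left_inv (hAx' hu.2)
      rw [mem_preimage, this]
      exact hu.2

lemma chartAreaMeasure_le_areaMeasure (f : S → M) (x : S) :
    chartAreaMeasure (n := n) (m := m) f x ≤ areaMeasure (n := n) (m := m) f :=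
  le_iSup (fun x => chartAreaMeasure (n := n) (m := m) f x) x

lemma chartAreaMeasure_restrict (f : S → M) (x : S) :
    (chartAreaMeasure (n := n) (m := m) f x).restrict (extChartAt (𝓡 m) x).source
      = chartAreaMeasure (n := n) (m := m) f x := by
  refine Measure.restrict_eq_self_of_ae_mem ?_
  rw [ae_iff]
  change chartAreaMeasure (n := n) (m := m) f x (extChartAt (𝓡 m) x).sourceᶜ = 0
  rw [chartAreaMeasure_apply f x (measurableSet_source x).compl]
  have : (extChartAt (𝓡 m) x).target ∩ cs x ⁻¹' (extChartAt (𝓡 m) x).sourceᶜ = ∅ := by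
    ext u
    simp only [mem_inter_iff, mem_preimage, mem_compl_iff, mem_empty_iff_false, iff_false, not_and,
      not_not]
    exact fun hu => (extChartAt (𝓡 m) x).map_target hu
  rw [this]
  simp

/-- On the domain of a chart the area measure is the area measure of that chart. -/
lemma areaMeasure_restrict (hf : IsSmoothImmersion (n := n) (m := m) f) (x : S) :
    (areaMeasure (n := n) (m := m) f).restrict (extChartAt (𝓡 m) x).source
      = chartAreaMeasure (n := n) (m := m) f x := by
  have hms := measurableSet_source (m := m) x
  apply le_antisymm
  · have hle : areaMeasure (n := n) (m := m) f
        ≤ chartAreaMeasure (n := n) (m := m) f x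
          + (⊤ : Measure S).restrict (extChartAt (𝓡 m) x).sourceᶜ := by
      refine iSup_le fun y => ?_
      rw [← Measure.restrict_add_restrict_compl (μ := chartAreaMeasure (n := n) (m := m) f y) hms]
      refine add_le_add ?_ (Measure.restrict_mono le_rfl le_top)
      refine Measure.le_iff.2 fun A hA => ?_
      rw [Measure.restrict_apply hA]
      exact (chartAreaMeasure_le hf y x (hA.inter hms) inter_subset_right).trans
        (measure_mono inter_subset_left)
    refine (Measure.restrict_mono le_rfl hle).trans ?_
    rw [Measure.restrict_add, chartAreaMeasure_restrict, Measure.restrict_restrict hms]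
    simp
  · rw [← chartAreaMeasure_restrict]
    exact Measure.restrict_mono le_rfl (chartAreaMeasure_le_areaMeasure f x)

/-- Integrals over the domain of a chart in coordinates. -/
lemma setIntegral_areaMeasure (hf : IsSmoothImmersion (n := n) (m := m) f) (x : S) {F : S → ℝ}
    (hF : Measurable F) : ∫ y in (extChartAt (𝓡 m) x).source, F y ∂(areaMeasure (n := n) (m := m) f)
      = ∫ u in (extChartAt (𝓡 m) x).target, dens (n := n) f x u * F (cs x u) := by
  rw [areaMeasure_restrict hf, chartAreaMeasure, integral_map (aemeasurable_cs x _)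
    hF.aestronglyMeasurable, restrict_withDensity (measurableSet_target x),
    integral_withDensity_eq_integral_toReal_smul₀]
  · refine setIntegral_congr_fun (measurableSet_target x) fun u hu => ?_
    simp only [smul_eq_mul]
    rw [ENNReal.toReal_ofReal (Real.sqrt_nonneg _)]
    rfl
  · exact (((hf.continuousOn_dens x).aemeasurable (measurableSet_target x))).ennreal_ofReal
  · exact Eventually.of_forall fun _ => ENNReal.ofReal_lt_top

end AreaMeasure

/-! ### The divergence theorem on a closed surface -/

section HessianLemmas

attribute [-instance] instNormedAddCommGroupOfRiemannianBundleOfIsTopologicalAddGroupOfContinuousConstSMulReal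
  instInnerProductSpaceReal

variable {m : ℕ}

lemma hess_congr (Γ : Eu m →L[ℝ] Eu m →L[ℝ] Eu m) {ψ ψ' : Eu m → ℝ} {y : Eu m}
    (h : ψ =ᶠ[𝓝 y] ψ') : hessL Γ ψ y = hessL Γ ψ' y := by
  ext a b
  simp only [hessL, LinearMap.mk₂_apply, hess]
  rw [h.fderiv_eq (𝕜 := ℝ), (h.fderiv (𝕜 := ℝ)).fderiv_eq (𝕜 := ℝ)]

lemma trB_hessL_zero (H : Matrix (Fin m) (Fin m) ℝ) (Γ : Eu m →L[ℝ] Eu m →L[ℝ] Eu m) (y : Eu m) :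
    trB H (hessL Γ (fun _ => 0) y) = 0 := by
  simp [trB, hessL, hess]

lemma trB_hessL_add (H : Matrix (Fin m) (Fin m) ℝ) (Γ : Eu m →L[ℝ] Eu m →L[ℝ] Eu m)
    {ψ ψ' : Eu m → ℝ} {y : Eu m} (h : ContDiffAt ℝ 2 ψ y) (h' : ContDiffAt ℝ 2 ψ' y) :
    trB H (hessL Γ (fun z => ψ z + ψ' z) y) = trB H (hessL Γ ψ y) + trB H (hessL Γ ψ' y) := by
  have hev : ∀ {φ : Eu m → ℝ}, ContDiffAt ℝ 2 φ y → ∀ᶠ z in 𝓝 y, DifferentiableAt ℝ φ z :=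
    fun hφ => (hφ.eventually (by simp)).mono fun z hz => hz.differentiableAt (by norm_num)
  have h1 : fderiv ℝ (fun z => ψ z + ψ' z) =ᶠ[𝓝 y] fun z => fderiv ℝ ψ z + fderiv ℝ ψ' z := by
    filter_upwards [hev h, hev h'] with z hz hz'
    exact fderiv_fun_add hz hz'
  have h2 : fderiv ℝ (fun z => fderiv ℝ ψ z + fderiv ℝ ψ' z) y
      = fderiv ℝ (fderiv ℝ ψ) y + fderiv ℝ (fderiv ℝ ψ') y :=
    fderiv_fun_add (differentiableAt_fderiv h) (differentiableAt_fderiv h')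
  simp only [trB, hessL, LinearMap.mk₂_apply, hess, h1.fderiv_eq (𝕜 := ℝ), h2, h1.self_of_nhds,
    add_apply, smul_eq_mul, ← Finset.sum_add_distrib]
  exact Finset.sum_congr rfl fun i _ => Finset.sum_congr rfl fun j _ => by ring

lemma continuousAt_trB_hessL {g : Eu m → Matrix (Fin m) (Fin m) ℝ} {y : Eu m} {ψ : Eu m → ℝ}
    (hg : ∀ i j, ContDiffAt ℝ ∞ (fun z => g z i j) y) (h0 : (g y).det ≠ 0)
    (h : ContDiffAt ℝ 2 ψ y) :
    ContinuousAt (fun z => trB (g z) (hessL (chrMap g z) ψ z)) y := by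
  simp only [trB, hessL, LinearMap.mk₂_apply, hess, smul_eq_mul]
  have h1 : ContDiffAt ℝ 1 (fderiv ℝ ψ) y := h.fderiv_right (m := 1) (by norm_num)
  have h2 : ContDiffAt ℝ 0 (fderiv ℝ (fderiv ℝ ψ)) y := h1.fderiv_right (m := 0) (by norm_num)
  have h3 := (contDiffAt_chrMap hg h0).continuousAt
  refine tendsto_finsetSum _ fun i _ => tendsto_finsetSum _ fun j _ => ?_
  exact (contDiffAt_inv hg h0 i j).continuousAt.mul
    (((h2.continuousAt.clm_apply continuousAt_const).clm_apply continuousAt_const).sub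
      (h1.continuousAt.clm_apply
        ((h3.clm_apply continuousAt_const).clm_apply continuousAt_const)))

end HessianLemmas

section DivergenceTheorem

set_option linter.unusedSectionVars false

variable {n : ℕ} {M : Type*} [EMetricSpace M] [ChartedSpace (Eu n) M] [IsManifold (𝓡 n) ∞ M]
  [RiemannianBundle (fun x : M => TangentSpace (𝓡 n) x)]
  [IsContMDiffRiemannianBundle (𝓡 n) ∞ (Eu n) (fun x : M => TangentSpace (𝓡 n) x)]
  {S : Type*} [TopologicalSpace S] [ChartedSpace (Eu 2) S] [IsManifold (𝓡 2) ∞ S]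
  {f : S → M}

lemma two_le_infty : (2 : WithTop ℕ∞) ≤ (∞ : WithTop ℕ∞) := WithTop.coe_le_coe.2 le_top

lemma continuous_lapl (hf : IsSmoothImmersion (n := n) (m := 2) f) {v : S → ℝ}
    (hv : ContMDiff (𝓡 2) 𝓘(ℝ, ℝ) 2 v) : Continuous (lapl (n := n) (m := 2) f v) := by
  rw [continuous_iff_continuousAt]
  intro x
  have hx := mem_extChartAt_source (I := 𝓡 2) x
  have hxt := mem_extChartAt_target (I := 𝓡 2) x
  have h1 : lapl (n := n) (m := 2) f v
      =ᶠ[𝓝 x] fun y => laplC (n := n) f x v (extChartAt (𝓡 2) x y) := by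
    filter_upwards [(isOpen_extChartAt_source (I := 𝓡 2) x).mem_nhds hx] with y hy
    exact lapl_eq hf hy hv.contMDiffAt
  refine ContinuousAt.congr ?_ h1.symm
  have h2 : ContinuousAt (laplC (n := n) f x v) (extChartAt (𝓡 2) x x) :=
    continuousAt_trB_hessL (hf.contDiffAt_metric x hxt) (hf.det_pos x hxt).ne'
      (contDiffAt_comp_cs x hxt hv.contMDiffAt two_le_infty)
  exact ContinuousAt.comp (f := extChartAt (𝓡 2) x) h2 (continuousAt_extChartAt x)

lemma lapl_add {v w : S → ℝ}
    (hv : ContMDiff (𝓡 2) 𝓘(ℝ, ℝ) 2 v) (hw : ContMDiff (𝓡 2) 𝓘(ℝ, ℝ) 2 w) (x : S) :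
    lapl (n := n) (m := 2) f (fun y => v y + w y) x
      = lapl (n := n) (m := 2) f v x + lapl (n := n) (m := 2) f w x := by
  have hxt := mem_extChartAt_target (I := 𝓡 2) x
  exact trB_hessL_add _ _ (contDiffAt_comp_cs x hxt hv.contMDiffAt two_le_infty)
    (contDiffAt_comp_cs x hxt hw.contMDiffAt two_le_infty)

variable [T2Space S] [CompactSpace S] [MeasurableSpace S] [BorelSpace S]

/-- The integral of the Laplacian vanishes for functions supported in the domain of a chart. -/
lemma integral_lapl_eq_zero_of_tsupport (hf : IsSmoothImmersion (n := n) (m := 2) f) {v : S → ℝ}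
    (hv : ContMDiff (𝓡 2) 𝓘(ℝ, ℝ) 2 v) (x : S)
    (hvx : tsupport v ⊆ (extChartAt (𝓡 2) x).source) :
    ∫ y, lapl (n := n) (m := 2) f v y ∂(areaMeasure (n := n) (m := 2) f) = 0 := by
  classical
  set T := (extChartAt (𝓡 2) x).target with hT
  have hTo : IsOpen T := isOpen_extChartAt_target x
  have hoff : ∀ y ∉ (extChartAt (𝓡 2) x).source, lapl (n := n) (m := 2) f v y = 0 := by
    intro y hy
    have h1 : v =ᶠ[𝓝 y] 0 := notMem_tsupport_iff_eventuallyEq.1 fun h => hy (hvx h)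
    have hyt := mem_extChartAt_target (I := 𝓡 2) y
    have h2 : (fun z => v (cs y z)) =ᶠ[𝓝 (extChartAt (𝓡 2) y y)] fun _ => 0 := by
      have h3 := (contMDiffAt_cs y hyt).continuousAt.tendsto
      rw [cs_self] at h3
      exact h3.eventually h1
    rw [lapl, laplC, hess_congr _ h2, trB_hessL_zero]
  rw [← setIntegral_eq_integral_of_forall_compl_eq_zero hoff,
    setIntegral_areaMeasure hf x (continuous_lapl hf hv).measurable]
  set ψ : Eu 2 → ℝ := T.indicator fun u => v (cs x u) with hψ
  have hψeq : ∀ u ∈ T, (fun z => v (cs x z)) =ᶠ[𝓝 u] ψ := by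
    intro u hu
    filter_upwards [hTo.mem_nhds hu] with z hz
    rw [hψ, indicator_of_mem hz]
  -- The support is the image of a compact set under the chart.
  set L := extChartAt (𝓡 2) x '' tsupport v with hL
  have hLc : IsCompact L := (isClosed_tsupport v).isCompact.image_of_continuousOn
    ((continuousOn_extChartAt x).mono hvx)
  have hLT : L ⊆ T := by
    rintro _ ⟨y, hy, rfl⟩
    exact (extChartAt (𝓡 2) x).map_source (hvx hy)
  have hsupp : tsupport ψ ⊆ L := by
    refine closure_minimal (fun u hu => ?_) hLc.isClosed
    have huT : u ∈ T := by
      by_contra h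
      exact hu (indicator_of_notMem h _)
    have hv0 : v (cs x u) ≠ 0 := by
      have := hu
      rwa [Function.mem_support, hψ, indicator_of_mem huT] at this
    exact ⟨cs x u, subset_tsupport v hv0, (extChartAt (𝓡 2) x).right_inv huT⟩
  have h0 := integral_laplacian_eq_zero hTo
    (g := pullbackMetric (n := n) f x) (ψ := ψ)
    (fun y hy => hf.contDiffAt_metric x hy) (pullbackMetric_symm f x)
    (fun y hy => hf.det_pos x hy)
    (fun y hy => (contDiffAt_comp_cs x hy hv.contMDiffAt two_le_infty).congr_of_eventuallyEq
      (hψeq y hy).symm)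
    (hsupp.trans hLT) (HasCompactSupport.intro hLc fun y hy =>
      image_eq_zero_of_notMem_tsupport fun h => hy (hsupp h))
  rw [← h0]
  refine setIntegral_congr_fun hTo.measurableSet fun u hu => ?_
  have hs : cs x u ∈ (extChartAt (𝓡 2) x).source := (extChartAt (𝓡 2) x).map_target hu
  rw [lapl_eq hf hs hv.contMDiffAt, (extChartAt (𝓡 2) x).right_inv hu, laplC,
    hess_congr _ (hψeq u hu), dens]

/-- The integral of the Laplacian of a function on a closed surface vanishes. -/
theorem integral_lapl_eq_zero (hf : IsSmoothImmersion (n := n) (m := 2) f)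
    (hfin : area n 2 f ≠ ⊤) {v : S → ℝ} (hv : ContMDiff (𝓡 2) 𝓘(ℝ, ℝ) 2 v) :
    ∫ y, lapl (n := n) (m := 2) f v y ∂(areaMeasure (n := n) (m := 2) f) = 0 := by
  have hfm : IsFiniteMeasure (areaMeasure (n := n) (m := 2) f) := ⟨lt_top_iff_ne_top.2 hfin⟩
  obtain ⟨χ, hχ⟩ := SmoothPartitionOfUnity.exists_isSubordinate_chartAt_source (𝓡 2) S
  have hfinite := χ.locallyFinite.finite_nonempty_of_compact
  set s := hfinite.toFinset with hs
  have hsum : ∀ y, v y = ∑ i ∈ s, χ i y * v y := by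
    intro y
    rw [← Finset.sum_mul, ← finsum_eq_sum_of_support_subset, χ.sum_eq_one (mem_univ y), one_mul]
    intro i hi
    rw [hs, Finite.coe_toFinset]
    exact ⟨y, hi⟩
  have hχv : ∀ i, ContMDiff (𝓡 2) 𝓘(ℝ, ℝ) 2 fun y => χ i y * v y := fun i =>
    ((χ i).contMDiff.of_le two_le_infty).mul hv
  have hzero : ∀ i, ∫ y, lapl (n := n) (m := 2) f (fun y => χ i y * v y) y
      ∂(areaMeasure (n := n) (m := 2) f) = 0 := by
    intro i
    refine integral_lapl_eq_zero_of_tsupport hf (hχv i) i ?_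
    rw [extChartAt_source]
    exact (tsupport_mul_subset_left (f := χ i) (g := v)).trans (hχ i)
  have key : ∀ t : Finset S, ContMDiff (𝓡 2) 𝓘(ℝ, ℝ) 2 (fun y => ∑ i ∈ t, χ i y * v y) ∧
      ∫ y, lapl (n := n) (m := 2) f (fun y => ∑ i ∈ t, χ i y * v y) y
        ∂(areaMeasure (n := n) (m := 2) f) = 0 := by
    classical
    intro t
    induction t using Finset.induction_on with
    | empty =>
      refine ⟨by simpa using contMDiff_const, ?_⟩
      have : ∀ y, lapl (n := n) (m := 2) f (fun _ => 0) y = 0 := fun y => trB_hessL_zero _ _ _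
      simp [this]
    | insert i t hi ih =>
      have e : (fun y => ∑ j ∈ insert i t, χ j y * v y)
          = fun y => χ i y * v y + ∑ j ∈ t, χ j y * v y := by
        funext y; rw [Finset.sum_insert hi]
      rw [e]
      refine ⟨(hχv i).add ih.1, ?_⟩
      have hint : ∀ {w : S → ℝ}, ContMDiff (𝓡 2) 𝓘(ℝ, ℝ) 2 w →
          Integrable (lapl (n := n) (m := 2) f w) (areaMeasure (n := n) (m := 2) f) := fun hw =>
        (continuous_lapl hf hw).integrable_of_hasCompactSupport (HasCompactSupport.of_compactSpace _)
      simp only [lapl_add (hχv i) ih.1]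
      rw [integral_add (hint (hχv i)) (hint ih.1), hzero i, ih.2, add_zero]
  have := (key s).2
  simpa only [← hsum] using this

end DivergenceTheorem

/-! ### The radial weight -/

section Weight

lemma hasDerivAt_max_zero_sq (x : ℝ) : HasDerivAt (fun t : ℝ => max 0 t ^ 2) (2 * max 0 x) x := by
  rcases lt_trichotomy x 0 with h | h | h
  · have : (fun t : ℝ => max 0 t ^ 2) =ᶠ[𝓝 x] fun _ => 0 := by
      filter_upwards [gt_mem_nhds h] with t ht
      simp [max_eq_left ht.le]
    rw [max_eq_left h.le, mul_zero]
    exact (hasDerivAt_const x (0 : ℝ)).congr_of_eventuallyEq this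
  · subst h
    rw [max_self, mul_zero, hasDerivAt_iff_isLittleO]
    simp only [max_self, sub_zero, smul_zero, ne_eq, OfNat.ofNat_ne_zero, not_false_eq_true,
      zero_pow]
    have h1 : (fun t : ℝ => max 0 t ^ 2) =O[𝓝 0] fun t : ℝ => t ^ 2 := by
      refine Asymptotics.isBigO_of_le _ fun t => ?_
      rw [Real.norm_of_nonneg (sq_nonneg _), Real.norm_of_nonneg (sq_nonneg _)]
      rcases le_total 0 t with h | h
      · rw [max_eq_right h]
      · rw [max_eq_left h]; nlinarith [sq_nonneg t]
    exact h1.trans_isLittleO (Asymptotics.isLittleO_pow_id one_lt_two)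
  · have : (fun t : ℝ => max 0 t ^ 2) =ᶠ[𝓝 x] fun t => t ^ 2 := by
      filter_upwards [lt_mem_nhds h] with t ht
      simp [max_eq_right ht.le]
    rw [max_eq_right h.le]
    refine HasDerivAt.congr_of_eventuallyEq ?_ this
    simpa using hasDerivAt_pow 2 x

/-- A cut-off factor, vanishing for `u ≥ R`. -/
def cutoff (R ε u : ℝ) : ℝ := max 0 (1 - (u + ε) / (R + ε))

/-- The weight `(1 - (u + ε) / (R + ε))₊² / (u + ε)`, a regularisation of `1 / u` which is cut off
at `u = R`; the maximum in the denominator only serves to define it for all `u`. -/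
def weight (R ε u : ℝ) : ℝ := cutoff R ε u ^ 2 / max (u + ε) (ε / 2)

/-- The derivative of `weight`. -/
def weight' (R ε u : ℝ) : ℝ :=
  -(2 * cutoff R ε u / ((R + ε) * (u + ε))) - cutoff R ε u ^ 2 / (u + ε) ^ 2

/-- The antiderivative of `weight` which vanishes for `u ≥ R`. -/
def primitive (R ε u : ℝ) : ℝ := ∫ t in R..u, weight R ε t

variable {R ε : ℝ}

lemma cutoff_nonneg (u : ℝ) : 0 ≤ cutoff R ε u := le_max_left _ _

lemma cutoff_eq_zero (hR : 0 < R) (hε : 0 < ε) {u : ℝ} (hu : R ≤ u) : cutoff R ε u = 0 := by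
  rw [cutoff, max_eq_left]
  have : 1 ≤ (u + ε) / (R + ε) := by rw [le_div_iff₀ (by positivity)]; linarith
  linarith

lemma continuous_cutoff : Continuous (cutoff R ε) := by
  unfold cutoff; fun_prop

lemma continuous_weight (hε : 0 < ε) : Continuous (weight R ε) := by
  refine (continuous_cutoff.pow 2).div (by fun_prop) fun u => ?_
  have : ε / 2 ≤ max (u + ε) (ε / 2) := le_max_right _ _
  positivity

lemma weight_nonneg (hε : 0 < ε) (u : ℝ) : 0 ≤ weight R ε u := by
  have : ε / 2 ≤ max (u + ε) (ε / 2) := le_max_right _ _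
  unfold weight
  positivity

lemma weight_eq {u : ℝ} (hu : -(ε / 2) < u) : weight R ε u = cutoff R ε u ^ 2 / (u + ε) := by
  rw [weight, max_eq_left (by linarith)]

lemma hasDerivAt_primitive (hε : 0 < ε) (u : ℝ) :
    HasDerivAt (primitive R ε) (weight R ε u) u :=
  have hc := continuous_weight (R := R) hε
  intervalIntegral.integral_hasDerivAt_right (hc.intervalIntegrable _ _)
    hc.aestronglyMeasurable.stronglyMeasurableAtFilter hc.continuousAt

lemma hasDerivAt_weight (hε : 0 < ε) {u : ℝ} (hu : -(ε / 2) < u) :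
    HasDerivAt (weight R ε) (weight' R ε u) u := by
  have hs : 0 < u + ε := by linarith
  have h1 : HasDerivAt (fun t : ℝ => 1 - (t + ε) / (R + ε)) (-(1 / (R + ε))) u :=
    (((hasDerivAt_id u).add_const ε).div_const (R + ε)).const_sub 1
  have h2 : HasDerivAt (fun t => cutoff R ε t ^ 2) (2 * cutoff R ε u * -(1 / (R + ε))) u :=
    HasDerivAt.comp (h₂ := fun t : ℝ => max 0 t ^ 2) u (hasDerivAt_max_zero_sq _) h1
  have h3 := h2.div ((hasDerivAt_id u).add_const ε) hs.ne'
  have h4 : weight R ε =ᶠ[𝓝 u] fun t => cutoff R ε t ^ 2 / (t + ε) := by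
    filter_upwards [lt_mem_nhds hu] with t ht
    exact weight_eq ht
  refine (h3.congr_of_eventuallyEq h4).congr_deriv ?_
  rw [weight']
  simp only [id]
  field_simp

lemma contDiffAt_primitive (hR : 0 < R) (hε : 0 < ε) {u : ℝ} (hu : -(ε / 2) < u) :
    ContDiffAt ℝ 2 (primitive R ε) u := by
  have ho : IsOpen (Ioi (-(ε / 2))) := isOpen_Ioi
  have hd : deriv (primitive R ε) = weight R ε := funext fun t => (hasDerivAt_primitive hε t).deriv
  have hw : ContDiffOn ℝ 1 (weight R ε) (Ioi (-(ε / 2))) := by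
    have : (1 : WithTop ℕ∞) = 0 + 1 := by norm_num
    rw [this, contDiffOn_succ_iff_deriv_of_isOpen ho]
    refine ⟨fun t ht => (hasDerivAt_weight hε ht).differentiableAt.differentiableWithinAt,
      by simp, ?_⟩
    rw [contDiffOn_zero]
    have hc : ContinuousOn (weight' R ε) (Ioi (-(ε / 2))) := by
      have h1 := (continuous_cutoff (R := R) (ε := ε)).continuousOn (s := Ioi (-(ε / 2)))
      have h0 : ∀ t ∈ Ioi (-(ε / 2)), t + ε ≠ 0 := fun t ht => by
        have : -(ε / 2) < t := ht
        linarith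
      refine ((h1.const_mul 2).div (by fun_prop) fun t ht => ?_).neg.sub
        ((h1.pow 2).div (by fun_prop) fun t ht => ?_)
      · exact mul_ne_zero (by positivity) (h0 t ht)
      · exact pow_ne_zero _ (h0 t ht)
    exact hc.congr fun t ht => (hasDerivAt_weight hε ht).deriv
  have h : ContDiffOn ℝ (1 + 1) (primitive R ε) (Ioi (-(ε / 2))) := by
    rw [contDiffOn_succ_iff_deriv_of_isOpen ho, hd]
    exact ⟨fun t _ => (hasDerivAt_primitive hε t).differentiableAt.differentiableWithinAt,
      by simp, hw⟩
  have h2 := h.contDiffAt (ho.mem_nhds hu)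
  rwa [one_add_one_eq_two] at h2

lemma primitive_eq_zero (hR : 0 < R) (hε : 0 < ε) {u : ℝ} (hu : R ≤ u) : primitive R ε u = 0 := by
  have : EqOn (weight R ε) (fun _ => 0) (uIcc R u) := fun t ht => by
    rw [uIcc_of_le hu] at ht
    simp [weight, cutoff_eq_zero hR hε ht.1]
  rw [primitive, intervalIntegral.integral_congr this]
  simp

/-- The inequality behind the monotonicity formula. Here `u` is half the squared distance to the
centre, `N` the length of the normal part of the position vector and `h` the length of the mean
curvature vector. The main terms `2 w + 2 u w'` cancel up to the regularisation, and the normal part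
is absorbed by completing the square. -/
lemma weight_inequality (hR : 0 < R) (hε : 0 < ε) (hεR : 3 * ε ≤ R) {u K N h : ℝ} (hu : 0 ≤ u)
    (hK : 0 ≤ K) :
    (if u < ε then 1 / (8 * ε) else 0) ≤
      2 * weight R ε u * (1 - 2 * K * u) + weight' R ε u * (2 * u - N ^ 2) - weight R ε u * (N * h)
        + (if u < R then 4 / R + 4 * K + h ^ 2 / 4 else 0) := by
  have hs : 0 < u + ε := by linarith
  have ha : 0 < R + ε := by linarith
  rw [weight_eq (by linarith), weight']
  rcases lt_or_ge u R with huR | huR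
  swap
  · rw [cutoff_eq_zero hR hε huR, if_neg (by linarith), if_neg (by linarith)]
    simp
  rw [if_pos huR]
  have hg0 : 0 ≤ cutoff R ε u := cutoff_nonneg u
  have hge : cutoff R ε u = 1 - (u + ε) / (R + ε) := by
    rw [cutoff, max_eq_right]
    have : (u + ε) / (R + ε) ≤ 1 := by rw [div_le_one ha]; linarith
    linarith
  have hg1 : cutoff R ε u ≤ 1 := by
    have : 0 ≤ (u + ε) / (R + ε) := by positivity
    linarith
  have hghalf : u < ε → 1 / 2 ≤ cutoff R ε u := by
    intro h1
    have : (u + ε) / (R + ε) ≤ 1 / 2 := by rw [div_le_iff₀ ha]; linarith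
    linarith
  clear hge
  generalize cutoff R ε u = g at *
  set s := u + ε with hsdef
  have hus : u = s - ε := by linarith
  have e1 : 2 * (g ^ 2 / s) * (1 - 2 * K * u) + (-(2 * g / ((R + ε) * s)) - g ^ 2 / s ^ 2)
      * (2 * u - N ^ 2) - g ^ 2 / s * (N * h)
      = 2 * ε * (g / s) ^ 2 - 4 * g / (R + ε) + 4 * g * ε / ((R + ε) * s)
        - 4 * K * (g ^ 2 * (u / s)) + 2 * g / ((R + ε) * s) * N ^ 2
        + ((g / s * N - g * h / 2) ^ 2 - g ^ 2 * h ^ 2 / 4) := by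
    rw [hus]; field_simp; ring
  have hg2 : g ^ 2 ≤ 1 := by nlinarith
  have e2 : 4 * g / (R + ε) ≤ 4 / R := by
    rw [div_le_div_iff₀ ha hR]; nlinarith
  have e3 : 4 * K * (g ^ 2 * (u / s)) ≤ 4 * K := by
    have h1 : u / s ≤ 1 := by rw [div_le_one hs]; linarith
    have h2 : 0 ≤ u / s := by positivity
    have h3 : g ^ 2 * (u / s) ≤ 1 := mul_le_one₀ hg2 h2 h1
    nlinarith
  have e4 : 0 ≤ 4 * g * ε / ((R + ε) * s) := by positivity
  have e5 : 0 ≤ 2 * g / ((R + ε) * s) * N ^ 2 := by positivity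
  have e6 : g ^ 2 * h ^ 2 / 4 ≤ h ^ 2 / 4 := by nlinarith [sq_nonneg h]
  have e7 : (if u < ε then 1 / (8 * ε) else 0) ≤ 2 * ε * (g / s) ^ 2 := by
    split_ifs with h1
    · have h2 : 1 / (4 * ε) ≤ g / s := by
        rw [div_le_div_iff₀ (by positivity) hs]
        have := hghalf h1
        nlinarith
      calc 1 / (8 * ε) = 2 * ε * (1 / (4 * ε)) ^ 2 := by field_simp; norm_num
        _ ≤ 2 * ε * (g / s) ^ 2 := by gcongr
    · positivity
  rw [e1]
  nlinarith [sq_nonneg (g / s * N - g * h / 2)]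

end Weight

/-! ### The Laplacian of a radial function on a surface -/

section Radial

attribute [-instance] instNormedAddCommGroupOfRiemannianBundleOfIsTopologicalAddGroupOfContinuousConstSMulReal
  instInnerProductSpaceReal

variable {m : ℕ} {E E' : Type*} [NormedAddCommGroup E] [NormedSpace ℝ E]
  [NormedAddCommGroup E'] [NormedSpace ℝ E']

/-- The second fundamental form of `F` with respect to the connections with Christoffel maps `Γh` on
the domain and `Γ` on the target. -/
def secFF {E'' : Type*} [NormedAddCommGroup E''] [NormedSpace ℝ E'']
    (Γ : E →L[ℝ] E →L[ℝ] E) (Γh : E'' →L[ℝ] E'' →L[ℝ] E'') (F : E'' → E) (u a b : E'') : E :=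
  fderiv ℝ (fderiv ℝ F) u a b + Γ (fderiv ℝ F u a) (fderiv ℝ F u b) - fderiv ℝ F u (Γh a b)

/-- The second fundamental form after a change of coordinates in the target. -/
lemma secFF_comp {E'' : Type*} [NormedAddCommGroup E''] [NormedSpace ℝ E''] {F : E'' → E}
    {T : E → E'} {u : E''} {Γ : E →L[ℝ] E →L[ℝ] E}
    {Γ' : E' →L[ℝ] E' →L[ℝ] E'} (Γh : E'' →L[ℝ] E'' →L[ℝ] E'') (hF : ContDiffAt ℝ 2 F u)
    (hT : ContDiffAt ℝ 2 T (F u))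
    (htr : ∀ a b, fderiv ℝ (fderiv ℝ T) (F u) a b + Γ' (fderiv ℝ T (F u) a) (fderiv ℝ T (F u) b)
      = fderiv ℝ T (F u) (Γ a b)) (a b : E'') :
    secFF Γ' Γh (fun z => T (F z)) u a b = fderiv ℝ T (F u) (secFF Γ Γh F u a b) := by
  have h1 : ∀ c, fderiv ℝ (fun z => T (F z)) u c = fderiv ℝ T (F u) (fderiv ℝ F u c) := by
    intro c
    have := fderiv_comp u (hT.differentiableAt (by norm_num)) (hF.differentiableAt (by norm_num))
    simp only [Function.comp_def] at this
    rw [this]; rfl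
  rw [secFF, sndFDeriv_comp hF hT, h1, h1, h1, secFF, map_sub, map_add, ← htr]
  abel

/-- The Hessian of a function of a function. -/
lemma hess_comp_real (Γ : E →L[ℝ] E →L[ℝ] E) {U : E → ℝ} {Φ w : ℝ → ℝ} {w' : ℝ} {y : E}
    (hU : ContDiffAt ℝ 2 U y) (hΦ : ∀ t, HasDerivAt Φ (w t) t) (hw : HasDerivAt w w' (U y))
    (a b : E) : hess Γ (fun z => Φ (U z)) y a b
      = w (U y) * hess Γ U y a b + w' * (fderiv ℝ U y a * fderiv ℝ U y b) := by
  have h1 : fderiv ℝ (fun z => Φ (U z)) =ᶠ[𝓝 y] fun z => w (U z) • fderiv ℝ U z := by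
    filter_upwards [hU.eventually (by simp)] with z hz
    exact (HasDerivAt.comp_hasFDerivAt (h₂ := Φ) z (hΦ (U z))
      (hz.differentiableAt (by norm_num)).hasFDerivAt).fderiv
  have h2 : HasFDerivAt (fun z => w (U z)) (w' • fderiv ℝ U y) y :=
    HasDerivAt.comp_hasFDerivAt (h₂ := w) y hw (hU.differentiableAt (by norm_num)).hasFDerivAt
  have h3 := h2.fun_smul (differentiableAt_fderiv hU).hasFDerivAt
  rw [hess, h1.fderiv_eq (𝕜 := ℝ), h3.fderiv, h1.self_of_nhds, hess]
  simp
  ring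

/-- The component of `y` normal to an orthonormal family, and its product with a vector normal to
the family. -/
lemma normal_part {B : E →L[ℝ] E →L[ℝ] ℝ} (hB : IsInnerForm B) {τ : Fin m → E}
    (hτ : ∀ i j, B (τ i) (τ j) = if i = j then 1 else 0) (y H : E) (hH : ∀ i, B H (τ i) = 0) :
    ∃ N : ℝ, N ^ 2 = B y y - ∑ i, B y (τ i) ^ 2 ∧ -(N * √(B H H)) ≤ B y H := by
  set c := ∑ i, B y (τ i) • τ i with hc
  have h1 : ∀ z, B z c = ∑ i, B y (τ i) * B z (τ i) := fun z => by simp [hc]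
  have h2 : B y c = ∑ i, B y (τ i) ^ 2 := by
    rw [h1]; exact Finset.sum_congr rfl fun i _ => by ring
  have h3 : B c c = ∑ i, B y (τ i) ^ 2 := by
    rw [h1]
    refine Finset.sum_congr rfl fun i _ => ?_
    rw [hB.symm c, h1, Finset.sum_eq_single i]
    · rw [hτ, if_pos rfl]; ring
    · intro j _ hj; rw [hτ, if_neg hj.symm, mul_zero]
    · simp
  have hsub : ∀ z, B (y - c) z = B y z - B c z := fun z => by rw [map_sub B]; rfl
  have h4 : B (y - c) (y - c) = B y y - ∑ i, B y (τ i) ^ 2 := by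
    rw [hsub, map_sub, map_sub, hB.symm c y, h2, h3]; ring
  have h5 : B c H = 0 := by
    rw [hB.symm, h1]
    exact Finset.sum_eq_zero fun i _ => by rw [hH, mul_zero]
  refine ⟨√(B (y - c) (y - c)), by rw [Real.sq_sqrt (hB.nonneg _), h4], ?_⟩
  have h6 := (abs_le.1 (hB.abs_le (y - c) H)).1
  rwa [hsub H, h5, sub_zero] at h6

/-- The Hessian of half the squared distance to the centre in normal coordinates. -/
lemma hess_half_sq {B : E →L[ℝ] E →L[ℝ] ℝ} (hB : ∀ a b, B a b = B b a)
    (Γ : E →L[ℝ] E →L[ℝ] E) (y a b : E) :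
    (fderiv ℝ (fun z => B z z / 2) y a = B y a) ∧
      hess Γ (fun z => B z z / 2) y a b = B a b - B y (Γ a b) := by
  have h1 : ∀ z, HasFDerivAt (fun z => B z z / 2) (B z) z := by
    intro z
    have h := ((B.hasFDerivAt (x := z)).clm_apply (hasFDerivAt_id z)).mul_const (1 / 2 : ℝ)
    refine HasFDerivAt.congr_fderiv (h.congr_of_eventuallyEq (.of_forall fun t => ?_)) ?_
    · simp [div_eq_mul_inv]
    · ext c
      simp [hB c z]
      ring
  have h2 : fderiv ℝ (fun z => B z z / 2) = fun z => B z := funext fun z => (h1 z).fderiv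
  refine ⟨by rw [h2], ?_⟩
  have h3 : fderiv ℝ (fun z => B z) y = B := B.fderiv
  rw [hess, h2, h3]

lemma contDiff_half_sq (B : E →L[ℝ] E →L[ℝ] ℝ) : ContDiff ℝ 2 fun z => B z z / 2 :=
  (B.contDiff.clm_apply contDiff_id).div_const 2

/-- The mean curvature vector in coordinates, for an orthonormal frame `A`. -/
def meanVec (Γ : E →L[ℝ] E →L[ℝ] E) (Γh : Eu 2 →L[ℝ] Eu 2 →L[ℝ] Eu 2) (F : Eu 2 → E) (u : Eu 2)
    (A : Eu 2 →L[ℝ] Eu 2) : E := ∑ k, secFF Γ Γh F u (A (sb k)) (A (sb k))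

/-- A lower bound for the Laplacian of a radial function on a surface, in terms of the normal part
of the position vector and the mean curvature. -/
lemma radial_laplacian_ge {G : E → E →L[ℝ] E →L[ℝ] ℝ} {Γ : E → E →L[ℝ] E →L[ℝ] E} {D : Set E}
    {K : ℝ} (hm : IsNormalMetric G Γ D K) {F : Eu 2 → E} {u : Eu 2} (hD : F u ∈ D)
    (hK : K * G 0 (F u) (F u) ≤ 1) {g : Eu 2 → Matrix (Fin 2) (Fin 2) ℝ}
    {Γh : Eu 2 →L[ℝ] Eu 2 →L[ℝ] Eu 2} (hF : ContDiffAt ℝ 2 F u)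
    (hg : DifferentiableAt ℝ (fun z => matB (g z)) u)
    (hpb : ∀ᶠ z in 𝓝 u, ∀ a b, matB (g z) a b = G (F z) (fderiv ℝ F z a) (fderiv ℝ F z b))
    (hΓh : IsChristoffelAt (fun z => matB (g z)) Γh u) {A : Eu 2 →L[ℝ] Eu 2} (hA : IsFrame (g u) A)
    {Φ w : ℝ → ℝ} {w' : ℝ} (hΦ2 : ContDiffAt ℝ 2 Φ (G 0 (F u) (F u) / 2))
    (hΦ : ∀ t, HasDerivAt Φ (w t) t) (hw : HasDerivAt w w' (G 0 (F u) (F u) / 2))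
    (hw0 : 0 ≤ w (G 0 (F u) (F u) / 2)) :
    ∃ N : ℝ, 2 * w (G 0 (F u) (F u) / 2) * (1 - 2 * K * (G 0 (F u) (F u) / 2))
        + w' * (2 * (G 0 (F u) (F u) / 2) - N ^ 2)
        - w (G 0 (F u) (F u) / 2) * (N * √(G (F u) (meanVec (Γ (F u)) Γh F u A)
          (meanVec (Γ (F u)) Γh F u A)))
      ≤ trB (g u) (hessL Γh (fun z => Φ (G 0 (F z) (F z) / 2)) u) := by
  set y := F u with hy
  have hB := hm.inner y hD
  set τ : Fin 2 → E := fun k => fderiv ℝ F u (A (sb k)) with hτ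
  have hτo : ∀ i j, G y (τ i) (τ j) = if i = j then 1 else 0 := by
    intro i j
    rw [← hpb.self_of_nhds, hA, ← matB_one, matB_sb, Matrix.one_apply]
  have hII : ∀ a b c, G y (secFF (Γ y) Γh F u a b) (fderiv ℝ F u c) = 0 := by
    intro a b c
    have := inner_covariant_sndFDeriv (h := fun z => matB (g z)) hm.symm hF (hm.diff y hD) hg hpb
      (hm.christoffel y hD) hΓh a b c
    rw [secFF, map_sub, sub_apply, this, sub_self]
  have hH : ∀ i, G y (meanVec (Γ y) Γh F u A) (τ i) = 0 := by
    intro i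
    rw [meanVec, map_sum, sum_apply]
    exact Finset.sum_eq_zero fun k _ => hII _ _ _
  obtain ⟨N, hN, hNH⟩ := normal_part hB hτo y _ hH
  refine ⟨N, ?_⟩
  have hsym0 := hm.symm 0
  have hU := (contDiff_half_sq (G 0)).contDiffAt (x := y)
  have hψ : ContDiffAt ℝ 2 (fun z => Φ (G 0 z z / 2)) y := hΦ2.comp (g := Φ) y hU
  have hdψ : ∀ c, fderiv ℝ (fun z => Φ (G 0 z z / 2)) y c = w (G 0 y y / 2) * G 0 y c := by
    intro c
    have := (HasDerivAt.comp_hasFDerivAt (h₂ := Φ) y (hΦ _)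
      (hU.differentiableAt (by norm_num)).hasFDerivAt).fderiv
    simp only [Function.comp_def] at this
    rw [this, smul_apply, smul_eq_mul, (hess_half_sq hsym0 (Γ y) y c c).1]
  have hterm : ∀ k, hessL Γh (fun z => Φ (G 0 (F z) (F z) / 2)) u (A (sb k)) (A (sb k))
      = w (G 0 y y / 2) * (G 0 (τ k) (τ k) - G 0 y (Γ y (τ k) (τ k))) + w' * G 0 y (τ k) ^ 2
        + w (G 0 y y / 2) * G 0 y (secFF (Γ y) Γh F u (A (sb k)) (A (sb k))) := by
    intro k
    have h1 := hess_comp (ψ := fun z => Φ (G 0 z z / 2)) (Γ y) Γh hF hψ (A (sb k)) (A (sb k))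
    rw [hess_comp_real (Γ y) hU hΦ hw, (hess_half_sq hsym0 (Γ y) y _ _).2,
      (hess_half_sq hsym0 (Γ y) y _ 0).1, hdψ] at h1
    rw [hessL, LinearMap.mk₂_apply, h1, secFF]
    ring
  rw [hA.trB_eq]
  simp only [hterm, Finset.sum_add_distrib, ← Finset.mul_sum]
  have hlow : 2 * (1 - K * G 0 y y) ≤ ∑ k, (G 0 (τ k) (τ k) - G 0 y (Γ y (τ k) (τ k))) := by
    have h1 : ∀ k, 1 - K * G 0 y y ≤ G 0 (τ k) (τ k) - G 0 y (Γ y (τ k) (τ k)) := fun k => by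
      have := hm.hess_radial_ge hD hK (τ k)
      rwa [hτo, if_pos rfl, mul_one] at this
    rw [Fin.sum_univ_two]
    linarith [h1 0, h1 1]
  have hmean : ∑ k, G 0 y (secFF (Γ y) Γh F u (A (sb k)) (A (sb k)))
      = G y y (meanVec (Γ y) Γh F u A) := by
    rw [hm.gauss hD, meanVec, map_sum]
  have hN' : ∑ k, G 0 y (τ k) ^ 2 = 2 * (G 0 y y / 2) - N ^ 2 := by
    rw [hN, hm.gauss hD]
    simp only [hm.gauss hD]
    ring
  rw [hmean, hN']
  nlinarith [mul_le_mul_of_nonneg_left hlow hw0, mul_le_mul_of_nonneg_left hNH hw0]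

end Radial

/-! ### The mean curvature vector -/

section Frames

attribute [-instance] instNormedAddCommGroupOfRiemannianBundleOfIsTopologicalAddGroupOfContinuousConstSMulReal
  instInnerProductSpaceReal

variable {m : ℕ} {H : Matrix (Fin m) (Fin m) ℝ} {A : Eu m →L[ℝ] Eu m}

lemma IsFrame.surjective (hA : IsFrame H A) : Function.Surjective A := by
  have hinj : Function.Injective (A : Eu m →ₗ[ℝ] Eu m) := by
    rw [← LinearMap.ker_eq_bot, LinearMap.ker_eq_bot']
    intro a ha
    have ha' : A a = 0 := ha
    have h := hA a a
    rw [ha', map_zero] at h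
    exact inner_self_eq_zero.1 h.symm
  exact LinearMap.injective_iff_surjective.1 hinj

lemma IsFrame.sum_smul (hA : IsFrame H A) (c : Eu m) :
    ∑ l, matB H c (A (sb l)) • A (sb l) = c := by
  obtain ⟨b, rfl⟩ := hA.surjective c
  have : ∀ l, matB H (A b) (A (sb l)) = b l := fun l => by
    rw [hA, EuclideanSpace.inner_single_right]; simp
  simp only [this]
  conv_rhs => rw [← sum_smul_sb b]
  simp

end Frames

section MeanCurvature

set_option linter.unusedSectionVars false

variable {n : ℕ} {M : Type*} [EMetricSpace M] [ChartedSpace (Eu n) M] [IsManifold (𝓡 n) ∞ M]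
  [RiemannianBundle (fun x : M => TangentSpace (𝓡 n) x)]
  [IsContMDiffRiemannianBundle (𝓡 n) ∞ (Eu n) (fun x : M => TangentSpace (𝓡 n) x)]
  {S : Type*} [TopologicalSpace S] [ChartedSpace (Eu 2) S] [IsManifold (𝓡 2) ∞ S]
  {f : S → M}

/-- The map `f` in the charts around `x` and `q`. -/
abbrev inCharts (f : S → M) (x : S) (q : M) : Eu 2 → Eu n :=
  fun z => extChartAt (𝓡 n) q (f (cs x z))

/-- The mean curvature vector, in the chart around `f x`, is the trace of the second fundamental
form. -/
lemma meanCurvatureVector_eq (hf : IsSmoothImmersion (n := n) (m := 2) f) (x : S)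
    {A : Eu 2 →L[ℝ] Eu 2}
    (hA : IsFrame (pullbackMetric (n := n) f x (extChartAt (𝓡 2) x x)) A) (k : Fin n) :
    meanCurvatureVector (n := n) (m := 2) f x k
      = meanVec (chrMap (metricCoord (f x)) (extChartAt (𝓡 n) (f x) (f x)))
          (chrMap (pullbackMetric (n := n) f x) (extChartAt (𝓡 2) x x))
          (inCharts (n := n) f x (f x)) (extChartAt (𝓡 2) x x) A k := by
  set q := f x with hq
  set u := extChartAt (𝓡 2) x x with hu
  set F : Eu 2 → Eu n := inCharts (n := n) f x q with hF
  have hut : u ∈ (extChartAt (𝓡 2) x).target := mem_extChartAt_target x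
  have hsrc : (f ∘ cs x) u ∈ (extChartAt (𝓡 n) q).source := by
    simp only [Function.comp, hu, cs_self]
    exact mem_extChartAt_source q
  have hFu : F u = extChartAt (𝓡 n) q q := by
    simp only [hF, inCharts, hu, cs_self, hq]
  have hyt : F u ∈ (extChartAt (𝓡 n) q).target := by rw [hFu]; exact mem_extChartAt_target q
  have hFd : ContDiffAt ℝ ∞ F u := contDiffAt_chart_comp q (contMDiffAt_comp_cs hf.1 x hut) hsrc
  have hF2 := hFd.of_le two_le_infty
  set g := metricCoord (n := n) q (F u) with hg
  set Γ := chrMap (metricCoord (n := n) q) (F u) with hΓ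
  set H := pullbackMetric (n := n) f x u with hH
  set Γh := chrMap (pullbackMetric (n := n) f x) u with hΓh
  rw [← hFu]
  have hpb : ∀ᶠ z in 𝓝 u, ∀ a b, matB (pullbackMetric (n := n) f x z) a b
      = matB (metricCoord q (F z)) (fderiv ℝ F z a) (fderiv ℝ F z b) := by
    simp only [pullback_eq]
    exact eventually_matB_pb_eq q (eventually_contMDiffAt_comp_cs hf.1 x hut) hsrc
  have hpbu := hpb.self_of_nhds
  have hII : ∀ a b c, matB g (secFF Γ Γh F u a b) (fderiv ℝ F u c) = 0 := by
    intro a b c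
    have := inner_covariant_sndFDeriv (G := fun z => matB (metricCoord (n := n) q z))
      (h := fun z => matB (pullbackMetric (n := n) f x z))
      (fun z => matB_symm (metricCoord_symm q z)) hF2
      (differentiableAt_metricCoord q hyt) (hf.differentiableAt_metric x hut) hpb
      (isChristoffelAt_metricCoord q hyt) (hf.isChristoffelAt x hut) a b c
    rw [secFF, map_sub, sub_apply, this, sub_self]
  -- the trace of the covariant second derivative
  set V : Eu n := meanVec Γ Γh F u A + fderiv ℝ F u (∑ l, Γh (A (sb l)) (A (sb l))) with hV
  have hpd : ∀ i, pderiv i F u = fderiv ℝ F u (sb i) := fun i => rfl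
  have hpd2 : ∀ i j, pderiv i (pderiv j F) u = fderiv ℝ (fderiv ℝ F) u (sb i) (sb j) := by
    intro i j
    have h1 := (differentiableAt_fderiv hF2).hasFDerivAt.clm_apply (hasFDerivAt_const (sb j) u)
    have h2 : pderiv i (pderiv j F) u = fderiv ℝ (fun z => fderiv ℝ F z (sb j)) u (sb i) := rfl
    rw [h2, h1.fderiv]
    simp
  have hVk : ∀ k, traceHessian (n := n) (m := 2) f x k = V k := by
    intro k
    let B : Eu 2 →ₗ[ℝ] Eu 2 →ₗ[ℝ] ℝ := LinearMap.mk₂ ℝ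
      (fun a b => (fderiv ℝ (fderiv ℝ F) u a b + Γ (fderiv ℝ F u a) (fderiv ℝ F u b)) k)
      (fun a b c => by simp only [map_add, add_apply, PiLp.add_apply]; ring)
      (fun t a b => by
        simp only [map_smul, smul_apply, PiLp.add_apply, PiLp.smul_apply, smul_eq_mul]; ring)
      (fun a b c => by simp only [map_add, PiLp.add_apply]; ring)
      (fun t a b => by
        simp only [map_smul, PiLp.add_apply, PiLp.smul_apply, smul_eq_mul]; ring)
    have h1 : traceHessian (n := n) (m := 2) f x k = trB H B := by
      simp only [traceHessian, trB, smul_eq_mul]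
      refine Finset.sum_congr rfl fun i _ => Finset.sum_congr rfl fun j _ => ?_
      congr 1
      simp only [B, LinearMap.mk₂_apply, PiLp.add_apply]
      rw [chrMap_apply, ← hpd2, ← hpd, ← hpd]
      rfl
    have h2 : ∀ l, B (A (sb l)) (A (sb l)) = (secFF Γ Γh F u (A (sb l)) (A (sb l))
        + fderiv ℝ F u (Γh (A (sb l)) (A (sb l)))) k := by
      intro l
      simp only [B, LinearMap.mk₂_apply, secFF, sub_add_cancel]
    rw [h1, hA.trB_eq, hV, meanVec, map_sum, ← Finset.sum_add_distrib]
    simp [h2]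
  have hVt : ∀ l, matB g V (fderiv ℝ F u (A (sb l)))
      = matB H (∑ l, Γh (A (sb l)) (A (sb l))) (A (sb l)) := by
    intro l
    rw [hpbu, hV, map_add, add_apply, meanVec, map_sum (matB g), sum_apply,
      Finset.sum_eq_zero fun k _ => hII _ _ _, zero_add]
  let C : Eu 2 →ₗ[ℝ] Eu 2 →ₗ[ℝ] ℝ := LinearMap.mk₂ ℝ
    (fun a b => matB g V (fderiv ℝ F u b) * fderiv ℝ F u a k)
    (fun a b c => by simp only [map_add, PiLp.add_apply]; ring)
    (fun t a b => by simp only [map_smul, PiLp.smul_apply, smul_eq_mul]; ring)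
    (fun a b c => by simp only [map_add]; ring)
    (fun t a b => by simp only [map_smul, smul_eq_mul]; ring)
  have h3 : meanCurvatureVector (n := n) (m := 2) f x k = V k - trB H C := by
    simp only [meanCurvatureVector, trB, smul_eq_mul, hVk]
    congr 1
    refine Finset.sum_congr rfl fun i _ => Finset.sum_congr rfl fun j _ => ?_
    rw [mul_assoc]
    congr 1
    simp only [C, LinearMap.mk₂_apply]
    rw [matB_apply]
    rfl
  have h4 : trB H C = fderiv ℝ F u (∑ l, Γh (A (sb l)) (A (sb l))) k := by
    rw [hA.trB_eq]
    conv_rhs => rw [← hA.sum_smul (∑ l, Γh (A (sb l)) (A (sb l))), map_sum]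
    simp only [C, LinearMap.mk₂_apply, hVt, map_smul]
    simp
  rw [h3, h4, hV, PiLp.add_apply, add_sub_cancel_right]

lemma meanCurvatureSq_eq (hf : IsSmoothImmersion (n := n) (m := 2) f) (x : S)
    {A : Eu 2 →L[ℝ] Eu 2}
    (hA : IsFrame (pullbackMetric (n := n) f x (extChartAt (𝓡 2) x x)) A) {V : Eu n}
    (hV : V = meanVec (chrMap (metricCoord (f x)) (extChartAt (𝓡 n) (f x) (f x)))
          (chrMap (pullbackMetric (n := n) f x) (extChartAt (𝓡 2) x x))
          (inCharts (n := n) f x (f x)) (extChartAt (𝓡 2) x x) A) :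
    meanCurvatureSq (n := n) (m := 2) f x
      = matB (metricCoord (f x) (extChartAt (𝓡 n) (f x) (f x))) V V := by
  rw [meanCurvatureSq, matB_apply, hV]
  simp only [meanCurvatureVector_eq hf x hA]

end MeanCurvature

/-! ### A radial test function -/

lemma secFF_congr {E E' : Type*} [NormedAddCommGroup E] [NormedSpace ℝ E]
    [NormedAddCommGroup E'] [NormedSpace ℝ E'] (Γ : E →L[ℝ] E →L[ℝ] E)
    (Γh : E' →L[ℝ] E' →L[ℝ] E') {F F' : E' → E} {u : E'} (h : F =ᶠ[𝓝 u] F') (a b : E') :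
    secFF Γ Γh F u a b = secFF Γ Γh F' u a b := by
  rw [secFF, secFF, h.fderiv_eq (𝕜 := ℝ), (h.fderiv (𝕜 := ℝ)).fderiv_eq (𝕜 := ℝ)]

section TestFunction

set_option linter.unusedSectionVars false

variable {n : ℕ} {M : Type*} [EMetricSpace M] [ChartedSpace (Eu n) M] [IsManifold (𝓡 n) ∞ M]
  [RiemannianBundle (fun x : M => TangentSpace (𝓡 n) x)]
  [IsContMDiffRiemannianBundle (𝓡 n) ∞ (Eu n) (fun x : M => TangentSpace (𝓡 n) x)]

/-- Half the squared length of a vector in the tangent space at `p`. -/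
def hsq (p : M) (v : Eu n) : ℝ := ipM p v v / 2

lemma hsq_nonneg (p : M) (v : Eu n) : 0 ≤ hsq p v :=
  div_nonneg ((isInnerForm_ipM p).nonneg v) (by norm_num)

open Classical in
/-- The function which is `primitive R ε` of half the squared distance to `p`, and vanishes outside
the normal ball of radius `ρ`. -/
def radial (p : M) (ρ R ε : ℝ) (q : M) : ℝ :=
  if q ∈ expMap (n := n) p '' nball p ρ then primitive R ε (hsq p (ncoord (n := n) p ρ q)) else 0

lemma isCompact_hsq_le (p : M) (R : ℝ) : IsCompact {v : Eu n | hsq p v ≤ R} := by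
  obtain ⟨A, hA⟩ := exists_isFrame (isInnerForm_ipM (n := n) p)
  have hsub : {v : Eu n | hsq p v ≤ R} ⊆ A '' Metric.closedBall 0 √(2 * R) := by
    intro v hv
    obtain ⟨b, rfl⟩ := hA.surjective v
    refine ⟨b, ?_, rfl⟩
    have h1 : ipM p (A b) (A b) = ‖b‖ ^ 2 := (hA b b).trans (real_inner_self_eq_norm_sq b)
    have h2 : ipM p (A b) (A b) / 2 ≤ R := hv
    rw [mem_closedBall_zero_iff]
    apply Real.le_sqrt_of_sq_le
    linarith
  refine ((isCompact_closedBall (0 : Eu n) _).image A.continuous).of_isClosed_subset ?_ hsub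
  refine isClosed_le ?_ continuous_const
  exact (((ipM (n := n) p).continuous.clm_apply continuous_id).div_const 2)

namespace IsNormalRadius

variable {p : M} {ρ R ε : ℝ}

lemma radial_exp (h : IsNormalRadius (n := n) p ρ) {v : Eu n} (hv : v ∈ nball p ρ) :
    radial (n := n) p ρ R ε (expMap p v) = primitive R ε (hsq p v) := by
  rw [radial, if_pos ⟨v, hv, rfl⟩, h.ncoord_exp hv]

lemma radial_eventually (h : IsNormalRadius (n := n) p ρ) {v : Eu n} (hv : v ∈ nball p ρ) :
    radial (n := n) p ρ R ε =ᶠ[𝓝 (expMap p v)]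
      fun q => primitive R ε (hsq p (ncoord (n := n) p ρ q)) := by
  filter_upwards [h.eventually_exp_ncoord hv] with q hq
  rw [radial, if_pos ⟨_, hq.2.1, hq.2.2⟩]

lemma radial_eventually_zero (h : IsNormalRadius (n := n) p ρ) (hR : 0 < R) (hε : 0 < ε)
    (hRρ : 2 * R < ρ ^ 2) {q : M} (hq : q ∉ expMap (n := n) p '' nball p ρ) :
    radial (n := n) p ρ R ε =ᶠ[𝓝 q] fun _ => 0 := by
  have hsub : {v : Eu n | hsq p v ≤ R} ⊆ nball p ρ := fun v hv => by
    have h1 : ipM p v v / 2 ≤ R := hv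
    change ipM p v v < ρ ^ 2
    linarith
  have hcomp : IsCompact (expMap (n := n) p '' {v : Eu n | hsq p v ≤ R}) :=
    (isCompact_hsq_le p R).image_of_continuousOn fun v hv =>
      (h.diffeo v (hsub hv)).contMDiffAt.continuousAt.continuousWithinAt
  have hnot : q ∉ expMap (n := n) p '' {v : Eu n | hsq p v ≤ R} := fun hq' =>
    hq (image_mono hsub hq')
  filter_upwards [hcomp.isClosed.isOpen_compl.mem_nhds hnot] with z hz
  by_cases hzi : z ∈ expMap (n := n) p '' nball p ρ
  · obtain ⟨v, hv, rfl⟩ := hzi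
    rw [h.radial_exp hv]
    refine primitive_eq_zero hR hε (le_of_not_ge fun hle => hz ⟨v, hle, rfl⟩)
  · rw [radial, if_neg hzi]

lemma contDiffAt_primitive_hsq (hR : 0 < R) (hε : 0 < ε) (v : Eu n) :
    ContDiffAt ℝ 2 (fun z => primitive R ε (hsq p z)) v :=
  (contDiffAt_primitive hR hε (by linarith [hsq_nonneg p v])).comp v
    (contDiff_half_sq (ipM (n := n) p)).contDiffAt

/-- The test function is of class `C²` across the edge of the normal ball: it vanishes near the edge. -/
lemma contMDiff_radial (h : IsNormalRadius (n := n) p ρ) (hR : 0 < R) (hε : 0 < ε)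
    (hRρ : 2 * R < ρ ^ 2) : ContMDiff (𝓡 n) 𝓘(ℝ, ℝ) 2 (radial (n := n) p ρ R ε) := by
  intro q
  by_cases hq : q ∈ expMap (n := n) p '' nball p ρ
  · obtain ⟨v, hv, rfl⟩ := hq
    refine ContMDiffAt.congr_of_eventuallyEq ?_ (h.radial_eventually hv)
    exact ((contDiffAt_primitive_hsq hR hε _).contMDiffAt).comp (expMap p v)
      ((h.contMDiffAt_ncoord hv).of_le two_le_infty)
  · exact contMDiffAt_const.congr_of_eventuallyEq (h.radial_eventually_zero hR hε hRρ hq)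

end IsNormalRadius

section Surface

variable {S : Type*} [TopologicalSpace S] [ChartedSpace (Eu 2) S] [IsManifold (𝓡 2) ∞ S]
  {f : S → M} {p : M} {ρ R ε K : ℝ}

/-- The points which `f` maps to the normal ball around `p` of radius `√(2 R)`. -/
def preball (f : S → M) (p : M) (ρ R : ℝ) : Set S :=
  {x | ∃ v ∈ nball (n := n) p ρ, expMap p v = f x ∧ hsq p v < R}

lemma mem_preball_iff (h : IsNormalRadius (n := n) p ρ) {x : S} {v : Eu n} (hv : v ∈ nball p ρ)
    (hx : expMap p v = f x) : x ∈ preball (n := n) f p ρ R ↔ hsq p v < R := by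
  constructor
  · rintro ⟨v', hv', hx', hR⟩
    rwa [← h.inj hv' hv (hx'.trans hx.symm)]
  · exact fun hR => ⟨v, hv, hx, hR⟩

/-- `f` in normal coordinates around `p` and the chart around `x`. -/
abbrev inNormal (f : S → M) (x : S) (p : M) (ρ : ℝ) : Eu 2 → Eu n :=
  fun z => ncoord (n := n) p ρ (f (cs x z))

lemma contDiffAt_inNormal (hf : IsSmoothImmersion (n := n) (m := 2) f)
    (h : IsNormalRadius (n := n) p ρ) (x : S) {u : Eu 2} (hu : u ∈ (extChartAt (𝓡 2) x).target)
    {v : Eu n} (hv : v ∈ nball p ρ) (hx : expMap p v = f (cs x u)) :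
    ContDiffAt ℝ ∞ (inNormal (n := n) f x p ρ) u := by
  have h1 := h.contMDiffAt_ncoord hv
  rw [hx] at h1
  exact (h1.comp u (contMDiffAt_comp_cs hf.1 x hu)).contDiffAt

lemma eventually_inNormal (hf : IsSmoothImmersion (n := n) (m := 2) f)
    (h : IsNormalRadius (n := n) p ρ) (x : S) {u : Eu 2} (hu : u ∈ (extChartAt (𝓡 2) x).target)
    {v : Eu n} (hv : v ∈ nball p ρ) (hx : expMap p v = f (cs x u)) :
    ∀ᶠ z in 𝓝 u, z ∈ (extChartAt (𝓡 2) x).target ∧ inNormal (n := n) f x p ρ z ∈ nball p ρ ∧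
      expMap p (inNormal (n := n) f x p ρ z) = f (cs x z) := by
  have h1 := h.eventually_exp_ncoord hv
  rw [hx] at h1
  filter_upwards [(isOpen_extChartAt_target x).mem_nhds hu,
    (contMDiffAt_comp_cs hf.1 x hu).continuousAt.eventually h1] with z hz1 hz2
  exact ⟨hz1, hz2.2⟩

/-- The induced metric in normal coordinates. -/
lemma matB_pullback_inNormal (hf : IsSmoothImmersion (n := n) (m := 2) f)
    (h : IsNormalRadius (n := n) p ρ) (x : S) {u : Eu 2} (hu : u ∈ (extChartAt (𝓡 2) x).target)
    {v : Eu n} (hv : v ∈ nball p ρ) (hx : expMap p v = f (cs x u)) (a b : Eu 2) :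
    matB (pullbackMetric (n := n) f x u) a b = nmet p (inNormal (n := n) f x p ρ u)
      (fderiv ℝ (inNormal (n := n) f x p ρ) u a) (fderiv ℝ (inNormal (n := n) f x p ρ) u b) := by
  have hv' : inNormal (n := n) f x p ρ u = v := by simp only [inNormal, ← hx, h.ncoord_exp hv]
  have h1 : f ∘ cs x =ᶠ[𝓝 u] expMap (n := n) p ∘ inNormal (n := n) f x p ρ := by
    filter_upwards [eventually_inNormal hf h x hu hv hx] with z hz
    exact hz.2.2.symm
  rw [pullback_eq, nmet, matB_pb, matB_pb, dM_congr h1, dM_comp]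
  · simp only [Function.comp_apply, hv', hx]
    rfl
  · rw [hv']
    exact (h.diffeo v hv).contMDiffAt.mdifferentiableAt (by simp)
  · exact (contDiffAt_inNormal hf h x hu hv hx).differentiableAt (by simp)

/-- The mean curvature may be computed in normal coordinates, which are not one of the charts of
the manifold that enter its definition. -/
lemma meanCurvatureSq_inNormal (hf : IsSmoothImmersion (n := n) (m := 2) f)
    (h : IsNormalRadius (n := n) p ρ) (x : S) {v : Eu n} (hv : v ∈ nball p ρ)
    (hx : expMap p v = f x) {A : Eu 2 →L[ℝ] Eu 2}
    (hA : IsFrame (pullbackMetric (n := n) f x (extChartAt (𝓡 2) x x)) A) {V : Eu n}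
    (hV : V = meanVec (nchr p v) (chrMap (pullbackMetric (n := n) f x) (extChartAt (𝓡 2) x x))
      (inNormal (n := n) f x p ρ) (extChartAt (𝓡 2) x x) A) :
    meanCurvatureSq (n := n) (m := 2) f x = nmet p v V V := by
  have hut : extChartAt (𝓡 2) x x ∈ (extChartAt (𝓡 2) x).target := mem_extChartAt_target x
  set u := extChartAt (𝓡 2) x x with hu
  have hx' : expMap p v = f (cs x u) := by rw [hu, cs_self, hx]
  have hFu : inNormal (n := n) f x p ρ u = v := by simp only [inNormal, ← hx', h.ncoord_exp hv]
  have hq : expMap p v ∈ (extChartAt (𝓡 n) (f x)).source := by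
    rw [hx]; exact mem_extChartAt_source (f x)
  have hT : chexp p (f x) v = extChartAt (𝓡 n) (f x) (f x) := by simp only [chexp, hx]
  have hT2 := (h.contDiffAt_chexp hv hq).of_le two_le_infty
  have heq : inCharts (n := n) f x (f x)
      =ᶠ[𝓝 u] fun z => chexp p (f x) (inNormal (n := n) f x p ρ z) := by
    filter_upwards [eventually_inNormal hf h x hut hv hx'] with z hz
    simp only [inCharts, chexp]
    rw [hz.2.2]
  have hmean : meanVec (chrMap (metricCoord (f x)) (chexp p (f x) v))
      (chrMap (pullbackMetric (n := n) f x) u) (inCharts (n := n) f x (f x)) u A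
      = fderiv ℝ (chexp p (f x)) v V := by
    rw [hV, meanVec, meanVec, map_sum]
    refine Finset.sum_congr rfl fun k _ => ?_
    rw [secFF_congr _ _ heq]
    have := secFF_comp (F := inNormal (n := n) f x p ρ) (T := chexp p (f x)) (u := u)
      (Γ := nchr p v) (Γ' := chrMap (metricCoord (f x)) (chexp p (f x) v))
      (chrMap (pullbackMetric (n := n) f x) u)
      ((contDiffAt_inNormal hf h x hut hv hx').of_le two_le_infty) (by rw [hFu]; exact hT2)
      (fun a b => by rw [hFu]; exact h.nchr_transform hv hq a b) (A (sb k)) (A (sb k))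
    rw [this, hFu]
  rw [meanCurvatureSq_eq hf x hA rfl, ← hT, hmean, h.nmet_eq hv hq]

/-- The pointwise inequality for the Laplacian of the radial test function. -/
lemma lapl_radial_ge (hf : IsSmoothImmersion (n := n) (m := 2) f)
    (h : IsNormalRadius (n := n) p ρ)
    (hm : IsNormalMetric (nmet p) (nchr p) (nball (n := n) p ρ) K) (hKρ : K * ρ ^ 2 ≤ 1)
    (hR : 0 < R) (hRρ : 2 * R < ρ ^ 2) (hε : 0 < ε) (hεR : 3 * ε ≤ R) (x : S) :
    (preball (n := n) f p ρ ε).indicator (fun _ => 1 / (8 * ε)) x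
      ≤ lapl (n := n) (m := 2) f (fun y => radial (n := n) p ρ R ε (f y)) x
        + (preball (n := n) f p ρ R).indicator
          (fun y => 4 / R + 4 * K + meanCurvatureSq (n := n) (m := 2) f y / 4) x := by
  classical
  have hut : extChartAt (𝓡 2) x x ∈ (extChartAt (𝓡 2) x).target := mem_extChartAt_target x
  by_cases himg : f x ∈ expMap (n := n) p '' nball p ρ
  swap
  · have hnot : ∀ r, x ∉ preball (n := n) f p ρ r := fun r ⟨v, hv, hx, _⟩ => himg ⟨v, hv, hx⟩
    rw [indicator_of_notMem (hnot _), indicator_of_notMem (hnot _), add_zero]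
    have h1 := h.radial_eventually_zero hR hε hRρ himg
    have h2 : (fun z => radial (n := n) p ρ R ε (f (cs x z)))
        =ᶠ[𝓝 (extChartAt (𝓡 2) x x)] fun _ => 0 := by
      have h3 := (contMDiffAt_comp_cs hf.1 x hut).continuousAt.tendsto
      rw [Function.comp_apply, cs_self] at h3
      exact h3.eventually h1
    rw [lapl, laplC, hess_congr _ h2, trB_hessL_zero]
  obtain ⟨v, hv, hx⟩ := himg
  set u := extChartAt (𝓡 2) x x with hu
  have hx' : expMap p v = f (cs x u) := by rw [hu, cs_self, hx]
  set F := inNormal (n := n) f x p ρ with hF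
  have hFu : F u = v := by simp only [hF, inNormal, ← hx', h.ncoord_exp hv]
  have hev := eventually_inNormal hf h x hut hv hx'
  have h0 : ∀ w : Eu n, nmet p 0 w w / 2 = hsq p w := fun w => by rw [h.nmet_zero, hsq]
  have hlap : lapl (n := n) (m := 2) f (fun y => radial (n := n) p ρ R ε (f y)) x
      = trB (pullbackMetric (n := n) f x u) (hessL (chrMap (pullbackMetric (n := n) f x) u)
        (fun z => primitive R ε (nmet p 0 (F z) (F z) / 2)) u) := by
    rw [lapl, laplC]
    congr 1
    refine hess_congr _ ?_
    filter_upwards [hev] with z hz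
    rw [h0, ← h.radial_exp hz.2.1, hz.2.2]
  obtain ⟨A, hA⟩ := exists_isFrame (hf.isInnerForm x hut)
  have hpb : ∀ᶠ z in 𝓝 u, ∀ a b, matB (pullbackMetric (n := n) f x z) a b
      = nmet p (F z) (fderiv ℝ F z a) (fderiv ℝ F z b) := by
    filter_upwards [hev] with z hz a b
    exact matB_pullback_inNormal hf h x hz.1 hz.2.1 hz.2.2 a b
  have hvρ : ipM p v v < ρ ^ 2 := hv
  obtain ⟨N, hN⟩ := radial_laplacian_ge (g := pullbackMetric (n := n) f x) hm
    (F := F) (u := u) (by rw [hFu]; exact hv)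
    (by rw [hFu, h.nmet_zero]; nlinarith [hm.K_nonneg])
    ((contDiffAt_inNormal hf h x hut hv hx').of_le two_le_infty)
    (hf.differentiableAt_metric x hut) hpb (hf.isChristoffelAt x hut) hA
    (Φ := primitive R ε) (w := weight R ε) (w' := weight' R ε (nmet p 0 (F u) (F u) / 2))
    (by rw [h0]; exact contDiffAt_primitive hR hε (by linarith [hsq_nonneg p (F u)]))
    (hasDerivAt_primitive hε)
    (by rw [h0]; exact hasDerivAt_weight hε (by linarith [hsq_nonneg p (F u)]))
    (weight_nonneg hε _)
  rw [← hlap, hFu, h0] at hN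
  have hH := meanCurvatureSq_inNormal hf h x hv hx hA rfl
  rw [← hH] at hN
  have hHn : 0 ≤ meanCurvatureSq (n := n) (m := 2) f x := by
    rw [hH]; exact (h.isInnerForm_nmet hv).nonneg _
  have hw := weight_inequality hR hε hεR (K := K) (N := N)
    (h := √(meanCurvatureSq (n := n) (m := 2) f x)) (hsq_nonneg p v) hm.K_nonneg
  rw [Real.sq_sqrt hHn] at hw
  simp only [indicator_apply, mem_preball_iff h hv hx]
  linarith

end Surface

end TestFunction

/-! ### The lower bound for area and mean curvature in a ball -/

section Monotonicity

set_option linter.unusedSectionVars false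

variable {n : ℕ} {M : Type*} [EMetricSpace M] [ChartedSpace (Eu n) M] [IsManifold (𝓡 n) ∞ M]
  [RiemannianBundle (fun x : M => TangentSpace (𝓡 n) x)]
  [IsContMDiffRiemannianBundle (𝓡 n) ∞ (Eu n) (fun x : M => TangentSpace (𝓡 n) x)]
  {S : Type*} [TopologicalSpace S] [ChartedSpace (Eu 2) S] [IsManifold (𝓡 2) ∞ S]
  {f : S → M} {p : M} {ρ R K : ℝ}

lemma isOpen_preball (hf : IsSmoothImmersion (n := n) (m := 2) f)
    (h : IsNormalRadius (n := n) p ρ) : IsOpen (preball (n := n) f p ρ R) := by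
  rw [isOpen_iff_mem_nhds]
  rintro x ⟨v, hv, hx, hR⟩
  have hc := (h.contMDiffAt_ncoord hv).continuousAt
  have h1 : ∀ᶠ q in 𝓝 (expMap (n := n) p v), hsq p (ncoord (n := n) p ρ q) < R := by
    have h2 : ContinuousAt (fun w : Eu n => hsq p w) (ncoord (n := n) p ρ (expMap p v)) :=
      (contDiff_half_sq (ipM (n := n) p)).continuous.continuousAt
    refine (ContinuousAt.comp (f := ncoord (n := n) p ρ) h2 hc).eventually (gt_mem_nhds ?_)
    simpa only [Function.comp_apply, h.ncoord_exp hv] using hR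
  have h3 := h.eventually_exp_ncoord hv
  rw [hx] at h1 h3
  have hfc := hf.1.continuous.continuousAt (x := x)
  filter_upwards [hfc.eventually h1, hfc.eventually h3] with y hy1 hy2
  exact ⟨_, hy2.2.1, hy2.2.2, hy1⟩

/-- A smooth map whose differential at `0` is isometric is nearly isometric near `0`. -/
lemma eventually_form_le {B : Eu n →L[ℝ] Eu n →L[ℝ] ℝ} (hB : IsInnerForm B) {φ : Eu 2 → Eu n}
    {L : Eu 2 →L[ℝ] Eu n} (hφ : HasFDerivAt φ L 0) (h0 : φ 0 = 0)
    (hL : ∀ w, B (L w) (L w) = ‖w‖ ^ 2) : ∀ᶠ w in 𝓝 0, B (φ w) (φ w) ≤ 3 * ‖w‖ ^ 2 := by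
  set c : ℝ := 1 / (2 * (‖B‖ + 1)) with hc
  have hc0 : 0 < c := by positivity
  have h1 := hφ.isLittleO.def hc0
  simp only [h0, sub_zero] at h1
  filter_upwards [h1] with w hw
  obtain ⟨e, he⟩ : ∃ e, e = φ w - L w := ⟨_, rfl⟩
  rw [← he] at hw
  have h2 : φ w = L w + e := by rw [he]; abel
  have h3 : B e e ≤ ‖B‖ * ‖e‖ * ‖e‖ := (le_abs_self _).trans (B.le_opNorm₂ e e)
  have h4 : 0 ≤ B (L w - e) (L w - e) := hB.nonneg _
  have hsub : B (L w - e) (L w - e) = B (L w) (L w) - 2 * B (L w) e + B e e := by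
    have : ∀ z, B (L w - e) z = B (L w) z - B e z := fun z => by rw [map_sub B]; rfl
    rw [this, map_sub, map_sub, hB.symm e (L w)]; ring
  have hadd : B (φ w) (φ w) = B (L w) (L w) + 2 * B (L w) e + B e e := by
    have : ∀ z, B (L w + e) z = B (L w) z + B e z := fun z => by rw [map_add B]; rfl
    rw [h2, this, map_add, map_add, hB.symm e (L w)]; ring
  have h5 : ‖B‖ * ‖e‖ * ‖e‖ ≤ ‖B‖ * (c * ‖w‖) * (c * ‖w‖) := by gcongr
  have h6 : 2 * (‖B‖ * c * c) ≤ 1 := by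
    have h7 : (‖B‖ + 1) * c = 1 / 2 := by rw [hc]; field_simp
    have h8 : c ≤ 1 / 2 := by
      rw [← h7]; nlinarith [norm_nonneg B]
    nlinarith [norm_nonneg B]
  have h9 : 2 * (‖B‖ * (c * ‖w‖) * (c * ‖w‖)) ≤ ‖w‖ ^ 2 := by nlinarith [sq_nonneg ‖w‖]
  rw [hL] at hsub hadd
  linarith

variable [T2Space S] [CompactSpace S] [MeasurableSpace S] [BorelSpace S]

/-- Small balls of the surface have at least a fixed multiple of the Euclidean area. -/
lemma exists_le_area_preball (hf : IsSmoothImmersion (n := n) (m := 2) f) (x : S)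
    (h : IsNormalRadius (n := n) (f x) ρ) {ε₀ : ℝ} (hε₀ : 0 < ε₀) :
    ∃ ε, 0 < ε ∧ ε ≤ ε₀ ∧
      ENNReal.ofReal ε ≤ areaMeasure (n := n) (m := 2) f (preball (n := n) f (f x) ρ ε) := by
  set p := f x with hp
  set u := extChartAt (𝓡 2) x x with hu
  have hut : u ∈ (extChartAt (𝓡 2) x).target := mem_extChartAt_target x
  have hv := zero_mem_nball (n := n) p h.pos
  have hx : expMap p (0 : Eu n) = f (cs x u) := by rw [hu, cs_self, expMap_zero]
  set F := inNormal (n := n) f x p ρ with hF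
  have hFu : F u = 0 := by simp only [hF, inNormal, ← hx, h.ncoord_exp hv]
  have hFd := contDiffAt_inNormal hf h x hut hv hx
  obtain ⟨A, hA⟩ := exists_isFrame (hf.isInnerForm x hut)
  set ℓ : Eu 2 → Eu 2 := fun w => u + A w with hℓ
  have hℓ0 : ℓ 0 = u := by simp [hℓ]
  have hℓc : Continuous ℓ := by fun_prop
  have hℓd : HasFDerivAt ℓ A 0 := A.hasFDerivAt.const_add u
  have hφ : HasFDerivAt (fun w => F (ℓ w)) ((fderiv ℝ F u).comp A) 0 := by
    refine HasFDerivAt.comp (g := F) (f := ℓ) 0 ?_ hℓd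
    rw [hℓ0]
    exact (hFd.differentiableAt (by simp)).hasFDerivAt
  have hform : ∀ᶠ w in 𝓝 0, ipM p (F (ℓ w)) (F (ℓ w)) ≤ 3 * ‖w‖ ^ 2 := by
    refine eventually_form_le (isInnerForm_ipM p) hφ (by rw [hℓ0, hFu]) fun w => ?_
    rw [← real_inner_self_eq_norm_sq, ← hA w w, matB_pullback_inNormal hf h x hut hv hx]
    change _ = nmet p (F u) _ _
    rw [hFu, h.nmet_zero]
    rfl
  have hdens0 : 0 < dens (n := n) f x u := Real.sqrt_pos.2 (hf.det_pos x hut)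
  have hdens : ∀ᶠ z in 𝓝 u, dens (n := n) f x u / 2 ≤ dens (n := n) f x z := by
    have := ((hf.continuousOn_dens x).continuousAt
      ((isOpen_extChartAt_target x).mem_nhds hut)).eventually (lt_mem_nhds (half_lt_self hdens0))
    exact this.mono fun z hz => hz.le
  have htend : Tendsto ℓ (𝓝 0) (𝓝 u) := by
    have := hℓc.continuousAt (x := 0); rwa [ContinuousAt, hℓ0] at this
  have hall := (hform.and (htend.eventually hdens)).and
    (htend.eventually (eventually_inNormal hf h x hut hv hx))
  obtain ⟨δ, hδ, hball⟩ := Metric.eventually_nhds_iff_ball.1 hall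
  set r := min δ √(2 * ε₀ / 3) with hr
  have hr0 : 0 < r := lt_min hδ (Real.sqrt_pos.2 (by positivity))
  have hrsq : r ^ 2 ≤ 2 * ε₀ / 3 := by
    have h1 : r ≤ √(2 * ε₀ / 3) := min_le_right _ _
    calc r ^ 2 ≤ √(2 * ε₀ / 3) ^ 2 := by gcongr
      _ = 2 * ε₀ / 3 := Real.sq_sqrt (by positivity)
  refine ⟨3 / 2 * r ^ 2, by positivity, by linarith, ?_⟩
  set Q := preball (n := n) f p ρ (3 / 2 * r ^ 2) with hQ
  have hQm : MeasurableSet Q := (isOpen_preball hf h).measurableSet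
  have hb : ∀ w ∈ Metric.ball (0 : Eu 2) r, ℓ w ∈ (extChartAt (𝓡 2) x).target ∩ cs x ⁻¹' Q ∧
      dens (n := n) f x u / 2 ≤ dens (n := n) f x (ℓ w) := by
    intro w hw
    obtain ⟨⟨h1, h2⟩, h3, h4, h5⟩ := hball w (Metric.ball_subset_ball (min_le_left _ _) hw)
    refine ⟨⟨h3, _, h4, h5, ?_⟩, h2⟩
    rw [mem_ball_zero_iff] at hw
    have h6 : ‖w‖ ^ 2 < r ^ 2 := by gcongr
    change ipM p (F (ℓ w)) (F (ℓ w)) / 2 < _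
    linarith
  have himg : ℓ '' Metric.ball 0 r = (fun z => u + z) '' (A '' Metric.ball 0 r) := by
    rw [image_image]
  have hvol : volume (ℓ '' Metric.ball 0 r)
      = ENNReal.ofReal |A.det| * (ENNReal.ofReal r ^ 2 * ENNReal.ofReal Real.pi) := by
    rw [himg, image_add_left, measure_preimage_add, Measure.addHaar_image_continuousLinearMap,
      EuclideanSpace.volume_ball_fin_two]
  have hinj : Function.Injective A := by
    have := hA.surjective
    exact (LinearMap.injective_iff_surjective (f := (A : Eu 2 →ₗ[ℝ] Eu 2))).2 this
  have hms : MeasurableSet (ℓ '' Metric.ball 0 r) :=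
    measurableSet_ball.image_of_continuousOn_injOn hℓc.continuousOn fun w _ w' _ hww' =>
      hinj (add_left_cancel hww')
  have hdet : dens (n := n) f x u * |A.det| = 1 := by
    have h1 := hA.det_eq
    rw [dens, ← Real.sqrt_sq_eq_abs, ← Real.sqrt_mul (hf.det_pos x hut).le, mul_comm, h1,
      Real.sqrt_one]
  calc ENNReal.ofReal (3 / 2 * r ^ 2)
      ≤ ENNReal.ofReal (dens (n := n) f x u / 2)
        * (ENNReal.ofReal |A.det| * (ENNReal.ofReal r ^ 2 * ENNReal.ofReal Real.pi)) := by
        rw [← ENNReal.ofReal_pow hr0.le, ← ENNReal.ofReal_mul (by positivity),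
          ← ENNReal.ofReal_mul (by positivity), ← ENNReal.ofReal_mul (by positivity)]
        apply ENNReal.ofReal_le_ofReal
        have e : dens (n := n) f x u / 2 * (|A.det| * (r ^ 2 * Real.pi))
            = (dens (n := n) f x u * |A.det|) * (r ^ 2 * Real.pi) / 2 := by ring
        rw [e, hdet]
        nlinarith [Real.pi_gt_three, sq_nonneg r]
    _ = ∫⁻ _ in ℓ '' Metric.ball 0 r, ENNReal.ofReal (dens (n := n) f x u / 2) := by
        rw [setLIntegral_const, hvol]
    _ ≤ ∫⁻ z in ℓ '' Metric.ball 0 r, ENNReal.ofReal (dens (n := n) f x z) := by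
        refine setLIntegral_mono' hms ?_
        rintro _ ⟨w, hw, rfl⟩
        exact ENNReal.ofReal_le_ofReal (hb w hw).2
    _ ≤ ∫⁻ z in (extChartAt (𝓡 2) x).target ∩ cs x ⁻¹' Q, ENNReal.ofReal (dens (n := n) f x z) := by
        refine lintegral_mono_set ?_
        rintro _ ⟨w, hw, rfl⟩
        exact (hb w hw).1
    _ = chartAreaMeasure (n := n) (m := 2) f x Q := (chartAreaMeasure_apply f x hQm).symm
    _ ≤ areaMeasure (n := n) (m := 2) f Q := chartAreaMeasure_le_areaMeasure f x Q

lemma lintegral_ofReal_eq_of_integral_eq_zero {X : Type*} [MeasurableSpace X] {μ : Measure X}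
    {L : X → ℝ} (hL : Integrable L μ) (h0 : ∫ x, L x ∂μ = 0) :
    ∫⁻ x, ENNReal.ofReal (L x) ∂μ = ∫⁻ x, ENNReal.ofReal (-L x) ∂μ ∧
      ∫⁻ x, ENNReal.ofReal (L x) ∂μ ≠ ⊤ := by
  rw [integral_eq_lintegral_pos_part_sub_lintegral_neg_part hL, sub_eq_zero] at h0
  have h1 : ∫⁻ x, ENNReal.ofReal (L x) ∂μ ≠ ⊤ := hL.lintegral_lt_top.ne
  have h2 : ∫⁻ x, ENNReal.ofReal (-L x) ∂μ ≠ ⊤ := hL.neg.lintegral_lt_top.ne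
  exact ⟨(ENNReal.toReal_eq_toReal_iff' h1 h2).1 h0, h1⟩

/-- The integrated form of the inequality for the radial test function. -/
lemma le_lintegral_preball (hf : IsSmoothImmersion (n := n) (m := 2) f) (hfin : area n 2 f ≠ ⊤)
    (x : S) (h : IsNormalRadius (n := n) (f x) ρ)
    (hm : IsNormalMetric (nmet (f x)) (nchr (f x)) (nball (n := n) (f x) ρ) K)
    (hKρ : K * ρ ^ 2 ≤ 1) (hR : 0 < R) (hRρ : 2 * R < ρ ^ 2) :
    ENNReal.ofReal (1 / 8) ≤ ∫⁻ y in preball (n := n) f (f x) ρ R,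
      ENNReal.ofReal (4 / R + 4 * K + meanCurvatureSq (n := n) (m := 2) f y / 4)
        ∂(areaMeasure (n := n) (m := 2) f) := by
  set μ := areaMeasure (n := n) (m := 2) f with hμ
  have hfm : IsFiniteMeasure μ := ⟨lt_top_iff_ne_top.2 hfin⟩
  obtain ⟨ε, hε, hεR, harea⟩ := exists_le_area_preball hf x h (ε₀ := R / 3) (by positivity)
  set L := lapl (n := n) (m := 2) f (fun y => radial (n := n) (f x) ρ R ε (f y)) with hL
  have hv : ContMDiff (𝓡 2) 𝓘(ℝ, ℝ) 2 fun y => radial (n := n) (f x) ρ R ε (f y) :=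
    (h.contMDiff_radial hR hε hRρ).comp (hf.1.of_le two_le_infty)
  have hLc : Continuous L := continuous_lapl hf hv
  have hLi : Integrable L μ :=
    hLc.integrable_of_hasCompactSupport (HasCompactSupport.of_compactSpace _)
  obtain ⟨hpn, hfinL⟩ := lintegral_ofReal_eq_of_integral_eq_zero hLi
    (integral_lapl_eq_zero hf hfin hv)
  have hmε : MeasurableSet (preball (n := n) f (f x) ρ ε) := (isOpen_preball hf h).measurableSet
  have hmR : MeasurableSet (preball (n := n) f (f x) ρ R) := (isOpen_preball hf h).measurableSet
  set b : S → ℝ := fun y => 4 / R + 4 * K + meanCurvatureSq (n := n) (m := 2) f y / 4 with hb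
  have hpt : ∀ y, (preball (n := n) f (f x) ρ ε).indicator
        (fun _ => ENNReal.ofReal (1 / (8 * ε))) y + ENNReal.ofReal (-L y)
      ≤ ENNReal.ofReal (L y)
        + (preball (n := n) f (f x) ρ R).indicator (fun y => ENNReal.ofReal (b y)) y := by
    intro y
    have h1 := lapl_radial_ge hf h hm hKρ hR hRρ hε (by linarith) y
    change _ ≤ L y + (preball (n := n) f (f x) ρ R).indicator b y at h1
    have e1 : (preball (n := n) f (f x) ρ ε).indicator (fun _ => ENNReal.ofReal (1 / (8 * ε))) y
        = ENNReal.ofReal ((preball (n := n) f (f x) ρ ε).indicator (fun _ => 1 / (8 * ε)) y) := by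
      by_cases hy : y ∈ preball (n := n) f (f x) ρ ε <;> simp [hy]
    have e2 : (preball (n := n) f (f x) ρ R).indicator (fun y => ENNReal.ofReal (b y)) y
        = ENNReal.ofReal ((preball (n := n) f (f x) ρ R).indicator b y) := by
      by_cases hy : y ∈ preball (n := n) f (f x) ρ R <;> simp [hy]
    have ha0 : 0 ≤ (preball (n := n) f (f x) ρ ε).indicator (fun _ => 1 / (8 * ε)) y :=
      indicator_nonneg (fun _ _ => by positivity) y
    rw [e1, e2]
    generalize (preball (n := n) f (f x) ρ ε).indicator (fun _ => 1 / (8 * ε)) y = a at *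
    generalize (preball (n := n) f (f x) ρ R).indicator b y = c at *
    rcases le_total 0 (L y) with h2 | h2
    · rw [ENNReal.ofReal_of_nonpos (by linarith : -L y ≤ 0), add_zero]
      exact (ENNReal.ofReal_le_ofReal h1).trans ENNReal.ofReal_add_le
    · rw [ENNReal.ofReal_of_nonpos h2, zero_add, ← ENNReal.ofReal_add ha0 (by linarith)]
      exact ENNReal.ofReal_le_ofReal (by linarith)
  have hint := lintegral_mono (μ := μ) hpt
  rw [lintegral_add_left (measurable_const.indicator hmε),
    lintegral_add_left hLc.measurable.ennreal_ofReal, lintegral_indicator hmε,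
    lintegral_indicator hmR, setLIntegral_const, ← hpn, add_comm] at hint
  have hint2 := ENNReal.le_of_add_le_add_left hfinL hint
  refine le_trans ?_ hint2
  calc ENNReal.ofReal (1 / 8) = ENNReal.ofReal (1 / (8 * ε)) * ENNReal.ofReal ε := by
        rw [← ENNReal.ofReal_mul (by positivity)]
        congr 1
        field_simp
    _ ≤ _ := by gcongr

/-- A ball of radius `r` around a point of the surface contains a definite amount of area, in terms
of `r²`, or of Willmore energy. -/
theorem le_lintegral_ball [IsRiemannianManifold (𝓡 n) M]
    (hf : IsSmoothImmersion (n := n) (m := 2) f) (hfin : area n 2 f ≠ ⊤)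
    (x : S) (h : IsNormalRadius (n := n) (f x) ρ)
    (hm : IsNormalMetric (nmet (f x)) (nchr (f x)) (nball (n := n) (f x) ρ) K)
    (hKρ : K * ρ ^ 2 ≤ 1) {r : ℝ} (hr : 0 < r) (hrρ : r < ρ) :
    ENNReal.ofReal (1 / 8) ≤ ∫⁻ y in {y | edist (f x) (f y) < ENNReal.ofReal r},
      ENNReal.ofReal (12 / r ^ 2 + meanCurvatureSq (n := n) (m := 2) f y / 4)
        ∂(areaMeasure (n := n) (m := 2) f) := by
  have hr2 : r ^ 2 < ρ ^ 2 := by gcongr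
  refine (le_lintegral_preball hf hfin x h hm hKρ (R := r ^ 2 / 2) (by positivity)
    (by linarith)).trans ?_
  have hsub : preball (n := n) f (f x) ρ (r ^ 2 / 2)
      ⊆ {y | edist (f x) (f y) < ENNReal.ofReal r} := by
    rintro y ⟨v, hv, hy, hlt⟩
    have h1 := h.edist_exp_le hm hv
    rw [hy] at h1
    refine lt_of_le_of_lt h1 ((ENNReal.ofReal_lt_ofReal_iff hr).2 ?_)
    rw [Real.sqrt_lt' hr]
    have h2 : ipM (f x) v v / 2 < r ^ 2 / 2 := hlt
    linarith
  refine (lintegral_mono_set hsub).trans (lintegral_mono fun y => ENNReal.ofReal_le_ofReal ?_)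
  have h3 : K ≤ 1 / r ^ 2 := by
    rw [le_div_iff₀ (by positivity)]
    nlinarith [hm.K_nonneg]
  have h4 : 4 / (r ^ 2 / 2) + 4 * (1 / r ^ 2) = 12 / r ^ 2 := by field_simp; norm_num
  linarith

end Monotonicity

/-! ### Disjoint balls along the surface -/

section Covering

set_option linter.unusedSectionVars false

variable {X Y : Type*} [TopologicalSpace X] [ConnectedSpace X] [EMetricSpace Y]

/-- Points in a connected image have finite distance, as being at finite distance from a given point
is an open and closed condition. -/
lemma edist_ne_top_of_connected {f : X → Y} (hf : Continuous f) (a b : X) :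
    edist (f a) (f b) ≠ ⊤ := by
  have hopen : ∀ s : Set X, (∀ y ∈ s, ∀ z, edist (f y) (f z) < 1 → z ∈ s) → IsOpen s := by
    intro s hs
    rw [isOpen_iff_mem_nhds]
    intro y hy
    have hc : Continuous fun z => edist (f y) (f z) := continuous_const.edist hf
    have : ∀ᶠ z in 𝓝 y, edist (f y) (f z) < 1 :=
      hc.continuousAt.eventually (gt_mem_nhds (by simp))
    exact this.mono fun z hz => hs y hy z hz
  have hclopen : IsClopen {y | edist (f a) (f y) ≠ ⊤} := by
    constructor
    · refine ⟨hopen _ fun y hy z hz hz' => hy ?_⟩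
      refine ne_top_of_le_ne_top ?_ (edist_triangle (f a) (f z) (f y))
      rw [edist_comm (f z)]
      exact ENNReal.add_ne_top.2 ⟨hz', (hz.trans ENNReal.one_lt_top).ne⟩
    · refine hopen _ fun y hy z hz => ?_
      refine ne_top_of_le_ne_top ?_ (edist_triangle (f a) (f y) (f z))
      exact ENNReal.add_ne_top.2 ⟨hy, (hz.trans ENNReal.one_lt_top).ne⟩
  have huniv := hclopen.eq_univ ⟨a, by simp⟩
  have : b ∈ {y | edist (f a) (f y) ≠ ⊤} := by rw [huniv]; exact mem_univ b
  exact this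

/-- If each ball of radius `r` around a point of a connected set carries at least the integral `c`,
then the diameter is at most `2 r / c` times the total integral. -/
lemma edist_le_of_le_lintegral_ball [MeasurableSpace X] [BorelSpace X] {f : X → Y}
    (hf : Continuous f) {μ : Measure X} {b : X → ℝ≥0∞} {r c I : ℝ} (hr : 0 < r) (hc : 0 < c)
    (hI : ∫⁻ y, b y ∂μ ≤ ENNReal.ofReal I) (hI0 : 0 ≤ I)
    (hball : ∀ x, ENNReal.ofReal c
      ≤ ∫⁻ y in {y | edist (f x) (f y) < ENNReal.ofReal r}, b y ∂μ) (p q : X) :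
    edist (f p) (f q) ≤ ENNReal.ofReal (2 * r * I / c) := by
  have hfin := edist_ne_top_of_connected hf
  set d : X → ℝ := fun y => (edist (f p) (f y)).toReal with hd
  have hdc : Continuous d := by
    rw [continuous_iff_continuousAt]
    intro y
    have h1 : Continuous fun z => edist (f p) (f z) := continuous_const.edist hf
    exact (ENNReal.tendsto_toReal (hfin p y)).comp h1.continuousAt
  have hdp : d p = 0 := by simp [hd]
  have hrange : ∀ t ∈ Icc 0 (d q), ∃ y, d y = t := fun t ht =>
    mem_range_of_exists_le_of_exists_ge hdc ⟨p, hdp.le.trans ht.1⟩ ⟨q, ht.2⟩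
  set N := ⌊d q / (2 * r)⌋₊ with hN
  have hdq : 0 ≤ d q := ENNReal.toReal_nonneg
  have hk : ∀ k : Fin (N + 1), ∃ y, d y = 2 * r * k := by
    intro k
    refine hrange _ ⟨by positivity, ?_⟩
    have h1 : ((k : ℕ) : ℝ) ≤ N := by exact_mod_cast Nat.lt_succ_iff.1 k.2
    have h2 : (N : ℝ) ≤ d q / (2 * r) := Nat.floor_le (by positivity)
    have h3 := h1.trans h2
    rw [le_div_iff₀ (by positivity)] at h3
    linarith
  choose y hy using hk
  set B : Fin (N + 1) → Set X := fun k => {z | edist (f (y k)) (f z) < ENNReal.ofReal r} with hB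
  have hBm : ∀ k, MeasurableSet (B k) := fun k =>
    (isOpen_lt (continuous_const.edist hf) continuous_const).measurableSet
  have hdisj : Pairwise (Function.onFun Disjoint B) := by
    intro j k hjk
    rw [Function.onFun, Set.disjoint_left]
    intro z hj hk
    have hlt : ∀ l, z ∈ B l → |d (y l) - d z| < r := by
      intro l hl
      have h1 : (edist (f (y l)) (f z)).toReal < r := by
        rw [← ENNReal.toReal_ofReal hr.le]
        exact (ENNReal.toReal_lt_toReal (hfin _ _) ENNReal.ofReal_ne_top).2 hl
      have h2 : d (y l) ≤ d z + (edist (f (y l)) (f z)).toReal := by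
        rw [hd, ← ENNReal.toReal_add (hfin _ _) (hfin _ _)]
        refine ENNReal.toReal_mono (ENNReal.add_ne_top.2 ⟨hfin _ _, hfin _ _⟩) ?_
        rw [edist_comm (f (y l)) (f z)]
        exact edist_triangle _ _ _
      have h3 : d z ≤ d (y l) + (edist (f (y l)) (f z)).toReal := by
        rw [hd, ← ENNReal.toReal_add (hfin _ _) (hfin _ _)]
        exact ENNReal.toReal_mono (ENNReal.add_ne_top.2 ⟨hfin _ _, hfin _ _⟩)
          (edist_triangle _ _ _)
      rw [abs_lt]
      constructor <;> linarith
    have h1 := hlt j hj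
    have h2 := hlt k hk
    rw [hy] at h1 h2
    have h3 : |2 * r * (j : ℕ) - 2 * r * (k : ℕ)| < 2 * r := by
      rw [abs_lt] at h1 h2 ⊢
      constructor <;> linarith
    rw [← mul_sub, abs_mul, abs_of_pos (by positivity : 0 < 2 * r)] at h3
    have h4 : |((j : ℕ) : ℝ) - (k : ℕ)| < 1 := by
      by_contra! hge
      nlinarith
    have h5 : |((j : ℕ) : ℤ) - (k : ℕ)| < 1 := by exact_mod_cast h4
    rw [Int.abs_lt_one_iff, sub_eq_zero] at h5
    exact hjk (Fin.ext (by exact_mod_cast h5))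
  have hsum : ((N + 1 : ℕ) : ℝ≥0∞) * ENNReal.ofReal c ≤ ENNReal.ofReal I := by
    calc ((N + 1 : ℕ) : ℝ≥0∞) * ENNReal.ofReal c
        = ∑ _k : Fin (N + 1), ENNReal.ofReal c := by simp
      _ ≤ ∑ k, ∫⁻ z in B k, b z ∂μ := Finset.sum_le_sum fun k _ => hball (y k)
      _ = ∫⁻ z in ⋃ k, B k, b z ∂μ := by
        rw [lintegral_iUnion hBm hdisj, tsum_fintype]
      _ ≤ ∫⁻ z, b z ∂μ := setLIntegral_le_lintegral _ _
      _ ≤ _ := hI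
  rw [← ENNReal.ofReal_natCast, ← ENNReal.ofReal_mul (by positivity),
    ENNReal.ofReal_le_ofReal_iff hI0] at hsum
  have hlt : d q / (2 * r) < N + 1 := Nat.lt_floor_add_one _
  rw [← ENNReal.ofReal_toReal (hfin p q)]
  apply ENNReal.ofReal_le_ofReal
  change d q ≤ _
  rw [div_lt_iff₀ (by positivity)] at hlt
  rw [le_div_iff₀ hc]
  push_cast at hsum
  nlinarith

/-- The choice of the radius which balances the two terms. -/
lemma exists_radius {α w r₁ : ℝ} (hα : 0 < α) (hw : 0 ≤ w) (hr₁ : 0 < r₁) :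
    ∃ r, 0 < r ∧ r ≤ r₁ ∧
      192 * α / r + 8 * r * w ≤ 200 * (√α * √w) + 200 / r₁ * α := by
  have hnn : 0 ≤ √α * √w := by positivity
  rcases le_or_gt (w * r₁ ^ 2) α with h | h
  · refine ⟨r₁, hr₁, le_rfl, ?_⟩
    have h1 : r₁ * w ≤ α / r₁ := by
      rw [le_div_iff₀ hr₁]; linarith
    have h2 : 192 * α / r₁ = 192 * (α / r₁) := by ring
    have h3 : 200 / r₁ * α = 200 * (α / r₁) := by ring
    nlinarith
  · have hw0 : 0 < w := by
      by_contra h0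
      have : w = 0 := le_antisymm (not_lt.1 h0) hw
      rw [this, zero_mul] at h
      linarith
    have hsα := Real.sqrt_pos.2 hα
    have hsw := Real.sqrt_pos.2 hw0
    refine ⟨√α / √w, by positivity, ?_, ?_⟩
    · rw [div_le_iff₀ hsw]
      apply Real.sqrt_le_iff.2
      refine ⟨by positivity, ?_⟩
      rw [mul_pow, Real.sq_sqrt hw]
      linarith
    · have e1 : 192 * α / (√α / √w) = 192 * (√α * √w) := by
        have : α = √α ^ 2 := (Real.sq_sqrt hα.le).symm
        field_simp
        exact Real.sq_sqrt hα.le |>.symm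
      have e2 : 8 * (√α / √w) * w = 8 * (√α * √w) := by
        have : w = √w * √w := (Real.mul_self_sqrt hw).symm
        nth_rewrite 2 [this]
        field_simp
      rw [e1, e2]
      have : 0 ≤ 200 / r₁ * α := by positivity
      linarith

end Covering

/-! ### The diameter estimate -/

section Conclusion

set_option linter.unusedSectionVars false

variable {M : Type*} [EMetricSpace M] [ChartedSpace (Eu 3) M] [IsManifold (𝓡 3) ∞ M]
  [RiemannianBundle (fun x : M => TangentSpace (𝓡 3) x)]
  [IsContMDiffRiemannianBundle (𝓡 3) ∞ (Eu 3) (fun x : M => TangentSpace (𝓡 3) x)]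
  [IsRiemannianManifold (𝓡 3) M]

/-- Bounded geometry gives normal coordinates on every ball of radius `1 / (C + 1)`, strictly below
the bound for the injectivity radius. -/
lemma HasBoundedGeometry.exists_normal {C : ℝ} (hC : 0 < C) (hM : HasBoundedGeometry 3 M C)
    (p : M) : IsNormalRadius (n := 3) p (1 / (C + 1)) ∧
      IsNormalMetric (nmet p) (nchr p) (nball (n := 3) p (1 / (C + 1))) C := by
  have h : IsNormalRadius (n := 3) p (1 / (C + 1)) := by
    refine isNormalRadius_of_lt (by positivity) (lt_of_lt_of_le ?_ (hM.inj p))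
    rw [ENNReal.ofReal_lt_ofReal_iff (by positivity), ← one_div]
    exact one_div_lt_one_div_of_lt hC (by linarith)
  refine ⟨h, h.isNormalMetric hC.le fun q y hy => ?_⟩
  have h1 := hM.curv q y hy
  have h2 : 0 ≤ tensorNorm (metricCoord q)
      (covDeriv (metricCoord q) (riemannTensor (metricCoord (n := 3) q))) y := Real.sqrt_nonneg _
  linarith

variable {S : Type*} [TopologicalSpace S] [T2Space S] [CompactSpace S] [ConnectedSpace S]
  [ChartedSpace (Eu 2) S] [IsManifold (𝓡 2) ∞ S] [MeasurableSpace S] [BorelSpace S] {f : S → M}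

/-- The area is positive, so that the right-hand side of the diameter bound is infinite when the
Willmore energy is. -/
lemma area_ne_zero {C : ℝ} (hC : 0 < C) (hM : HasBoundedGeometry 3 M C)
    (hf : IsSmoothImmersion (n := 3) (m := 2) f) : area 3 2 f ≠ 0 := by
  obtain ⟨x⟩ := (inferInstance : Nonempty S)
  obtain ⟨ε, hε, -, h⟩ := exists_le_area_preball hf x (hM.exists_normal hC (f x)).1 one_pos
  have h1 : 0 < area 3 2 f :=
    lt_of_lt_of_le (ENNReal.ofReal_pos.2 hε) (h.trans (measure_mono (subset_univ _)))
  exact h1.ne'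

/-- The diameter bound at scale `r`, from the covering argument with `c = 1 / 8`. -/
lemma edist_le_of_finite {C : ℝ} (hC : 0 < C) (hM : HasBoundedGeometry 3 M C)
    (hf : IsSmoothImmersion (n := 3) (m := 2) f) (hA : area 3 2 f ≠ ⊤)
    (hW : willmore 3 2 f ≠ ⊤) {r : ℝ} (hr : 0 < r) (hrC : r < 1 / (C + 1)) (p q : S) :
    edist (f p) (f q) ≤ ENNReal.ofReal
      (192 * (area 3 2 f).toReal / r + 8 * r * (willmore 3 2 f).toReal) := by
  set μ := areaMeasure (n := 3) (m := 2) f with hμ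
  set α := (area 3 2 f).toReal with hα
  set w := (willmore 3 2 f).toReal with hw
  have hα0 : 0 ≤ α := ENNReal.toReal_nonneg
  have hw0 : 0 ≤ w := ENNReal.toReal_nonneg
  have hI : ∫⁻ y, ENNReal.ofReal (12 / r ^ 2 + meanCurvatureSq (n := 3) (m := 2) f y / 4) ∂μ
      ≤ ENNReal.ofReal (12 / r ^ 2 * α + w / 2) := by
    calc ∫⁻ y, ENNReal.ofReal (12 / r ^ 2 + meanCurvatureSq (n := 3) (m := 2) f y / 4) ∂μ
        ≤ ∫⁻ y, (ENNReal.ofReal (12 / r ^ 2) + ENNReal.ofReal (1 / 4)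
            * ENNReal.ofReal (meanCurvatureSq (n := 3) (m := 2) f y)) ∂μ := by
          refine lintegral_mono fun y => ENNReal.ofReal_add_le.trans ?_
          rw [← ENNReal.ofReal_mul (by norm_num)]
          exact add_le_add le_rfl (ENNReal.ofReal_le_ofReal (by linarith))
      _ = ENNReal.ofReal (12 / r ^ 2) * area 3 2 f + ENNReal.ofReal (1 / 2) * willmore 3 2 f := by
          rw [lintegral_add_left measurable_const, lintegral_const,
            lintegral_const_mul' _ _ ENNReal.ofReal_ne_top, willmore, ← mul_assoc]
          congr 2
          rw [← ENNReal.ofReal_one, ← ENNReal.ofReal_ofNat 2, ← ENNReal.ofReal_div_of_pos two_pos,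
            ← ENNReal.ofReal_mul (by norm_num)]
          norm_num
      _ = ENNReal.ofReal (12 / r ^ 2 * α + w / 2) := by
          rw [← ENNReal.ofReal_toReal hA, ← ENNReal.ofReal_toReal hW,
            ← ENNReal.ofReal_mul (by positivity), ← ENNReal.ofReal_mul (by positivity),
            ← ENNReal.ofReal_add (by positivity) (by positivity)]
          congr 1
          rw [← hα, ← hw]
          ring
  have hK : C * (1 / (C + 1)) ^ 2 ≤ 1 := by
    rw [div_pow, one_pow, mul_one_div, div_le_one (by positivity)]
    nlinarith
  refine (edist_le_of_le_lintegral_ball hf.1.continuous hr (c := 1 / 8) (by norm_num) hI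
    (by positivity) (fun x => ?_) p q).trans (ENNReal.ofReal_le_ofReal (le_of_eq ?_))
  · obtain ⟨h1, h2⟩ := hM.exists_normal hC (f x)
    exact le_lintegral_ball hf hA x h1 h2 hK hr hrC
  · field_simp
    ring

end Conclusion

end WillmoreDiam

end

theorem mainTheorem9 (C_B : ℝ) (hC_B : 0 < C_B) :
    ∃ C : ℝ, 0 < C ∧
      ∀ (M : Type*) [EMetricSpace M] [ChartedSpace (EuclideanSpace ℝ (Fin 3)) M]
        [IsManifold (𝓡 3) ∞ M]
        [Bundle.RiemannianBundle (fun x : M => TangentSpace (𝓡 3) x)]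
        [IsContMDiffRiemannianBundle (𝓡 3) ∞ (EuclideanSpace ℝ (Fin 3))
          (fun x : M => TangentSpace (𝓡 3) x)]
        [IsRiemannianManifold (𝓡 3) M]
        (_ : WillmoreDiam.HasBoundedGeometry 3 M C_B)
        (S : Type*) [TopologicalSpace S] [T2Space S] [CompactSpace S] [ConnectedSpace S]
        [ChartedSpace (EuclideanSpace ℝ (Fin 2)) S] [IsManifold (𝓡 2) ∞ S]
        [MeasurableSpace S] [BorelSpace S]
        (f : S → M) (_ : WillmoreDiam.IsSmoothImmersion (n := 3) (m := 2) f),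
        Metric.ediam (Set.range f) ≤
          ENNReal.ofReal C *
            (WillmoreDiam.area 3 2 f ^ (1 / 2 : ℝ) * WillmoreDiam.willmore 3 2 f ^ (1 / 2 : ℝ)
              + WillmoreDiam.area 3 2 f) := by
  -- half of the radius on which there are normal coordinates
  set r₁ : ℝ := 1 / (2 * (C_B + 1)) with hr₁
  have hr₁0 : 0 < r₁ := by positivity
  have hr₁lt : r₁ < 1 / (C_B + 1) :=
    one_div_lt_one_div_of_lt (by positivity) (by linarith)
  have hC0 : 0 < 200 + 200 / r₁ := by positivity
  refine ⟨200 + 200 / r₁, hC0, ?_⟩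
  intro M _ _ _ _ _ _ hM S _ _ _ _ _ _ _ _ f hf
  have hA0 : WillmoreDiam.area 3 2 f ≠ 0 := WillmoreDiam.area_ne_zero hC_B hM hf
  have hCne : ENNReal.ofReal (200 + 200 / r₁) ≠ 0 := (ENNReal.ofReal_pos.2 hC0).ne'
  by_cases hA : WillmoreDiam.area 3 2 f = ⊤
  · rw [hA, add_top, ENNReal.mul_top hCne]
    exact le_top
  by_cases hW : WillmoreDiam.willmore 3 2 f = ⊤
  · have h1 : WillmoreDiam.area 3 2 f ^ (1 / 2 : ℝ) ≠ 0 := by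
      rw [Ne, ENNReal.rpow_eq_zero_iff]
      rintro (⟨h, -⟩ | ⟨h, -⟩)
      · exact hA0 h
      · exact hA h
    rw [hW, ENNReal.top_rpow_of_pos (by norm_num), ENNReal.mul_top h1, top_add,
      ENNReal.mul_top hCne]
    exact le_top
  have hα : 0 < (WillmoreDiam.area 3 2 f).toReal := ENNReal.toReal_pos hA0 hA
  have hw : 0 ≤ (WillmoreDiam.willmore 3 2 f).toReal := ENNReal.toReal_nonneg
  obtain ⟨r, hr, hrr, hbound⟩ := WillmoreDiam.exists_radius hα hw hr₁0
  refine Metric.ediam_le ?_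
  rintro _ ⟨p, rfl⟩ _ ⟨q, rfl⟩
  refine (WillmoreDiam.edist_le_of_finite hC_B hM hf hA hW hr (hrr.trans_lt hr₁lt) p q).trans ?_
  rw [← ENNReal.ofReal_toReal hA, ← ENNReal.ofReal_toReal hW,
    ENNReal.ofReal_rpow_of_nonneg hα.le (by norm_num), ENNReal.ofReal_rpow_of_nonneg hw (by norm_num),
    ← ENNReal.ofReal_mul (by positivity), ← ENNReal.ofReal_add (by positivity) hα.le,
    ← ENNReal.ofReal_mul hC0.le, ← Real.sqrt_eq_rpow, ← Real.sqrt_eq_rpow,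
    ENNReal.toReal_ofReal hα.le, ENNReal.toReal_ofReal hw]
  refine ENNReal.ofReal_le_ofReal (hbound.trans ?_)
  have h1 : 0 ≤ 200 / r₁ * (√(WillmoreDiam.area 3 2 f).toReal * √(WillmoreDiam.willmore 3 2 f).toReal) := by positivity
  linarith
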